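/- **Setting.** An instance of the decision version of the Viterbi Path problem consists of an $n\times n$ matrix $A$ and an $n\times\sigma$ matrix $B$ of non-negative integers ($n\ge 1$), a sequence $S=(s_1,\dots,s_T)\in[\sigma]^T$ of observations, and a threshold $\theta\ge 0$. The question is whether $$\min_{u_0=1,\;u_1,\dots,u_T\in[n]}\ \sum_{t=1}^{T}\bigl[A(u_{t-1},u_t)+B(u_t,s_t)\bigr]\ \le\ \theta .$$ For reals $0<c\le C$ and $w\in\mathbb N$ let $\mathrm{Viterbi}_{c,C,w}$ be this problem on instances with $n^{c}\le T\le n^{C}$ (that is, $T=n^{\Theta(1)}$) whose alphabet size $\sigma$, matrix entries and threshold are all at most $n^{w}$ (polynomially bounded). Computations are those of a random access machine with addition, truncated subtraction, multiplication, integer division, random access memory, and an instruction that guesses a natural number, under the logarithmic cost criterion (an instruction costs one plus the bit lengths of the numbers and addresses it touches). A problem is in $\mathsf{NTIME}(t)$ if some program has, on every yes-instance $x$, an accepting computation of cost $O(t(x))$, and on no-instances no accepting computation; it is in $\mathsf{coNTIME}(t)$ if its complement is in $\mathsf{NTIME}(t)$. NSETH is the statement that for every $\varepsilon>0$ there is a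 $k$ such that the unsatisfiability problem for $k$-CNF formulas on $N$ variables (with distinct clauses) is not in $\mathsf{NTIME}(2^{(1-\varepsilon)N})$. A *tight SETH-based lower bound* for $\mathrm{Viterbi}$ in the range $(c,C)$ means: for every $\varepsilon>0$ there is a $\delta>0$ such that for all $k$ there are a $w$ and a deterministic oracle program that decides $k$-SAT at cost $O(2^{(1-\delta)N})$, queries only instances of $\mathrm{Viterbi}_{c,C,w}$, and satisfies $\sum (Tn^2)^{1-\varepsilon}=O(2^{(1-\delta)N})$, where the sum is over all instances queried and a query also costs its bit length. **Theorem.** Let $0<c\le C$. 1. There is a constant $\alpha\in(0,1)$, depending only on $c$ and $C$, such that for every $w$ $$\mathrm{Viterbi}_{c,C,w}\in\mathsf{NTIME}\bigl((Tn^2)^{1-\alpha}\bigr)\cap\mathsf{coNTIME}\bigl((Tn^2)^{1-\alpha}\bigr).$$ 2. If NSETH holds, then there is no tight SETH-based lower bound for $\mathrm{Viterbi}$ in the range $(c,C)$. -/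

import Mathlib

namespace ViterbiNTIME

/-! ### Nondeterministic oracle RAM with logarithmic cost -/

/-- Arithmetic instructions of the RAM; `sub` is truncated at zero, `div` rounds down. -/
inductive ArithOp where
  | add | sub | mul | div

def ArithOp.eval : ArithOp → ℕ → ℕ → ℕ
  | .add, a, b => a + b
  | .sub, a, b => a - b
  | .mul, a, b => a * b
  | .div, a, b => a / b

/-- RAM programs. Registers and memory arrays are named by natural numbers (so that a program uses
finitely many of them); every array is a random access memory indexed by `ℕ`.
* `const r k`: `reg r := k`
* `arith op r a b`: `reg r := reg a op reg b`
* `load r m a`: `reg r := mem m [reg a]`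
* `store m a r`: `mem m [reg a] := reg r`
* `guess r`: put a nondeterministically chosen number into `reg r`
* `query m l r`: ask the oracle about the list of the first `reg l` entries of array `m` and put the
  answer (`1` for yes, `0` for no) into `reg r`
* `cond r p q`: run `p` if `reg r ≠ 0`, otherwise run `q`
* `loop r p`: while `reg r ≠ 0`, run `p`. -/
inductive Cmd where
  | const (r k : ℕ)
  | arith (op : ArithOp) (r a b : ℕ)
  | load (r m a : ℕ)
  | store (m a r : ℕ)
  | guess (r : ℕ)
  | query (m l r : ℕ)
  | seq (p q : Cmd)
  | cond (r : ℕ) (p q : Cmd)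
  | loop (r : ℕ) (p : Cmd)

/-- The program contains no nondeterministic instruction. -/
def Cmd.GuessFree : Cmd → Prop
  | .guess _ => False
  | .seq p q => p.GuessFree ∧ q.GuessFree
  | .cond _ p q => p.GuessFree ∧ q.GuessFree
  | .loop _ p => p.GuessFree
  | _ => True

/-- The program contains no oracle instruction. -/
def Cmd.QueryFree : Cmd → Prop
  | .query _ _ _ => False
  | .seq p q => p.QueryFree ∧ q.QueryFree
  | .cond _ p q => p.QueryFree ∧ q.QueryFree
  | .loop _ p => p.QueryFree
  | _ => True

/-- A memory state: the contents of the registers and of the arrays. -/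
structure State where
  reg : ℕ → ℕ
  mem : ℕ → ℕ → ℕ

def State.setReg (s : State) (r v : ℕ) : State :=
  { s with reg := Function.update s.reg r v }

def State.setMem (s : State) (m i v : ℕ) : State :=
  { s with mem := Function.update s.mem m (Function.update (s.mem m) i v) }

/-- The first `l` entries of array `m`. -/
def State.block (s : State) (m l : ℕ) : List ℕ :=
  (List.range l).map (s.mem m)

/-- Initially the input list is in array `0`; every other cell and every register holds `0`. -/
def State.init (input : List ℕ) : State where
  reg := fun _ => 0
  mem := fun m i => if m = 0 then input.getD i 0 else 0

/-- A halted state is accepting if register `0` is nonzero. -/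
def State.Accepts (s : State) : Prop := s.reg 0 ≠ 0

/-- `Exec O p s τ qs s'`: with oracle `O`, some computation of program `p` started in state `s` halts
in state `s'`, at total cost `τ`, having made the oracle queries `qs` in this order. Costs are
logarithmic: an instruction costs one plus the number of bits of the numbers (operands, addresses,
guessed numbers, queried lists) that it touches. -/
inductive Exec (O : Set (List ℕ)) : Cmd → State → ℕ → List (List ℕ) → State → Prop where
  | const (r k : ℕ) (s : State) :
      Exec O (.const r k) s (1 + k.size) [] (s.setReg r k)
  | arith (op : ArithOp) (r a b : ℕ) (s : State) :
      Exec O (.arith op r a b) s (1 + (s.reg a).size + (s.reg b).size) []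
        (s.setReg r (op.eval (s.reg a) (s.reg b)))
  | load (r m a : ℕ) (s : State) :
      Exec O (.load r m a) s (1 + (s.reg a).size + (s.mem m (s.reg a)).size) []
        (s.setReg r (s.mem m (s.reg a)))
  | store (m a r : ℕ) (s : State) :
      Exec O (.store m a r) s (1 + (s.reg a).size + (s.reg r).size) []
        (s.setMem m (s.reg a) (s.reg r))
  | guess (r v : ℕ) (s : State) :
      Exec O (.guess r) s (1 + v.size) [] (s.setReg r v)
  | queryYes (m l r : ℕ) (s : State) (h : s.block m (s.reg l) ∈ O) :
      Exec O (.query m l r) s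
        (1 + (s.reg l).size + ((s.block m (s.reg l)).map fun v => 1 + v.size).sum)
        [s.block m (s.reg l)] (s.setReg r 1)
  | queryNo (m l r : ℕ) (s : State) (h : s.block m (s.reg l) ∉ O) :
      Exec O (.query m l r) s
        (1 + (s.reg l).size + ((s.block m (s.reg l)).map fun v => 1 + v.size).sum)
        [s.block m (s.reg l)] (s.setReg r 0)
  | seq {p q : Cmd} {s s' s'' : State} {τ τ' : ℕ} {qs qs' : List (List ℕ)}
      (hp : Exec O p s τ qs s') (hq : Exec O q s' τ' qs' s'') :
      Exec O (.seq p q) s (τ + τ') (qs ++ qs') s''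
  | condTrue {r : ℕ} {p q : Cmd} {s s' : State} {τ : ℕ} {qs : List (List ℕ)}
      (h : s.reg r ≠ 0) (hp : Exec O p s τ qs s') :
      Exec O (.cond r p q) s (1 + (s.reg r).size + τ) qs s'
  | condFalse {r : ℕ} {p q : Cmd} {s s' : State} {τ : ℕ} {qs : List (List ℕ)}
      (h : s.reg r = 0) (hq : Exec O q s τ qs s') :
      Exec O (.cond r p q) s (1 + (s.reg r).size + τ) qs s'
  | loopDone {r : ℕ} {p : Cmd} {s : State} (h : s.reg r = 0) :
      Exec O (.loop r p) s (1 + (s.reg r).size) [] s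
  | loopStep {r : ℕ} {p : Cmd} {s s' s'' : State} {τ τ' : ℕ} {qs qs' : List (List ℕ)}
      (h : s.reg r ≠ 0) (hp : Exec O p s τ qs s') (hl : Exec O (.loop r p) s' τ' qs' s'') :
      Exec O (.loop r p) s (1 + (s.reg r).size + τ + τ') (qs ++ qs') s''

/-! ### Decision problems, nondeterministic time, fine-grained reductions -/

/-- A decision problem: a type of instances, their encodings as lists of numbers, and the set of
yes-instances. -/
structure Problem where
  Inst : Type
  enc : Inst → List ℕ
  yes : Set Inst

/-- The complementary problem: the same instances, with the answers exchanged. -/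
def Problem.compl (P : Problem) : Problem where
  Inst := P.Inst
  enc := P.enc
  yes := P.yesᶜ

/-- The oracle that answers the problem `P`. -/
def Problem.oracle (P : Problem) : Set (List ℕ) := P.enc '' P.yes

/-- `P ∈ NTIME(t)`: some nondeterministic program has, on every yes-instance `x`, an accepting
computation of cost `O(t x)`, and on every no-instance no accepting computation of any cost. -/
def InNTIME (P : Problem) (t : P.Inst → ℝ) : Prop :=
  ∃ p : Cmd, p.QueryFree ∧ ∃ K : ℝ, ∀ x : P.Inst,
    (x ∈ P.yes → ∃ (τ : ℕ) (qs : List (List ℕ)) (s : State),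
      Exec ∅ p (State.init (P.enc x)) τ qs s ∧ s.Accepts ∧ (τ : ℝ) ≤ K * t x) ∧
    (x ∉ P.yes → ∀ (τ : ℕ) (qs : List (List ℕ)) (s : State),
      Exec ∅ p (State.init (P.enc x)) τ qs s → ¬ s.Accepts)

/-- `P ∈ coNTIME(t)`. -/
def InCoNTIME (P : Problem) (t : P.Inst → ℝ) : Prop :=
  InNTIME P.compl t

/-- A deterministic fine-grained Turing reduction from `P` to `Q`: a deterministic oracle program
that decides every instance `x` of `P` at cost `O(t x)`, querying only instances `y` of `Q`, the sum
of `t' y` over all queries being `O(t x)` as well. -/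
def FineGrainedReduces (P : Problem) (t : P.Inst → ℝ) (Q : Problem) (t' : Q.Inst → ℝ) : Prop :=
  ∃ p : Cmd, p.GuessFree ∧ ∃ K : ℝ, ∀ x : P.Inst,
    ∃ (τ : ℕ) (ys : List Q.Inst) (s : State),
      Exec Q.oracle p (State.init (P.enc x)) τ (ys.map Q.enc) s ∧
      (s.Accepts ↔ x ∈ P.yes) ∧
      (τ : ℝ) ≤ K * t x ∧
      (ys.map t').sum ≤ K * t x

/-! ### Satisfiability and the nondeterministic strong exponential time hypothesis -/

/-- A `k`-CNF formula: a list of distinct clauses, each a list of at most `k` literals. The literal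
`(v, b)` says that variable `v` has value `b`. -/
structure KCNF (k : ℕ) where
  numVars : ℕ
  clauses : List (List (Fin numVars × Bool))
  width : ∀ cl ∈ clauses, cl.length ≤ k
  nodup : clauses.Nodup

def KCNF.Satisfiable {k : ℕ} (F : KCNF k) : Prop :=
  ∃ a : Fin F.numVars → Bool, ∀ cl ∈ F.clauses, ∃ l ∈ cl, a l.1 = l.2

/-- Number of variables, number of clauses, then every clause preceded by its length. -/
def KCNF.enc {k : ℕ} (F : KCNF k) : List ℕ :=
  F.numVars :: F.clauses.length ::
    F.clauses.flatMap fun cl =>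
      cl.length :: cl.map fun l => 2 * (l.1 : ℕ) + if l.2 then 1 else 0

def kSAT (k : ℕ) : Problem where
  Inst := KCNF k
  enc := KCNF.enc
  yes := {F | F.Satisfiable}

/-- The function `2 ^ ((1 - ε) N)`, with `N` the number of variables. -/
noncomputable def satTime (ε : ℝ) {k : ℕ} (F : KCNF k) : ℝ :=
  (2 : ℝ) ^ ((1 - ε) * (F.numVars : ℝ))

/-- The nondeterministic strong exponential time hypothesis: for every `ε > 0` there is a `k` such
that unsatisfiability of `k`-CNF formulas is not in `NTIME(2 ^ ((1 - ε) N))`. -/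
def NSETH : Prop :=
  ∀ ε : ℝ, 0 < ε → ∃ k : ℕ, ¬ InCoNTIME (kSAT k) (satTime ε)

/-! ### The Viterbi path problem -/

/-- An instance `(A, B, S)` of the Viterbi path problem with `n` states, `σ` symbols and `T`
observations, together with a threshold. -/
structure ViterbiInstance where
  n : ℕ
  σ : ℕ
  T : ℕ
  n_pos : 0 < n
  A : Fin n → Fin n → ℕ
  B : Fin n → Fin σ → ℕ
  S : Fin T → Fin σ
  threshold : ℕ

namespace ViterbiInstance

/-- The cost of the state sequence `u 0, …, u T`; here `S t` is the observation made on arrival at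
the state `u (t + 1)`. -/
def cost (x : ViterbiInstance) (u : Fin (x.T + 1) → Fin x.n) : ℕ :=
  ∑ t : Fin x.T, (x.A (u t.castSucc) (u t.succ) + x.B (u t.succ) (x.S t))

/-- The decision version: some state sequence that starts in the first state has cost at most the
threshold. -/
def IsYes (x : ViterbiInstance) : Prop :=
  ∃ u : Fin (x.T + 1) → Fin x.n, u 0 = ⟨0, x.n_pos⟩ ∧ x.cost u ≤ x.threshold

/-- The numbers `n, σ, T`, the threshold, then `A` and `B` row by row, then `S`. -/
def enc (x : ViterbiInstance) : List ℕ :=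
  [x.n, x.σ, x.T, x.threshold]
    ++ (List.ofFn fun i => List.ofFn fun j => x.A i j).flatten
    ++ (List.ofFn fun i => List.ofFn fun a => x.B i a).flatten
    ++ List.ofFn fun t => (x.S t : ℕ)

/-- `n ^ c ≤ T ≤ n ^ C`, and the alphabet size and all weights are at most `n ^ w`. -/
structure InRange (c C : ℝ) (w : ℕ) (x : ViterbiInstance) : Prop where
  T_lower : (x.n : ℝ) ^ c ≤ (x.T : ℝ)
  T_upper : (x.T : ℝ) ≤ (x.n : ℝ) ^ C
  σ_le : x.σ ≤ x.n ^ w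
  A_le : ∀ i j, x.A i j ≤ x.n ^ w
  B_le : ∀ i a, x.B i a ≤ x.n ^ w
  threshold_le : x.threshold ≤ x.n ^ w

end ViterbiInstance

/-- The decision version of the Viterbi path problem for instances in the given range. -/
def viterbi (c C : ℝ) (w : ℕ) : Problem where
  Inst := {x : ViterbiInstance // x.InRange c C w}
  enc := fun x => x.1.enc
  yes := {x | x.1.IsYes}

/-- The function `(T n²) ^ (1 - α)`. -/
noncomputable def viterbiTime (α : ℝ) {c C : ℝ} {w : ℕ} (x : (viterbi c C w).Inst) : ℝ :=
  ((x.1.T : ℝ) * (x.1.n : ℝ) ^ 2) ^ (1 - α)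

/-- There is a tight lower bound for the Viterbi path problem based on the strong exponential time
hypothesis: for every `ε > 0` there is `δ > 0` such that for all `k` there is a deterministic
fine-grained reduction that turns `(T n²) ^ (1 - ε)` time algorithms for Viterbi path into
`2 ^ ((1 - δ) N)` time algorithms for `k`-SAT. -/
def TightSETHLowerBound (c C : ℝ) : Prop :=
  ∀ ε : ℝ, 0 < ε → ∃ δ : ℝ, 0 < δ ∧ ∀ k : ℕ, ∃ w : ℕ,
    FineGrainedReduces (kSAT k) (satTime δ) (viterbi c C w) (viterbiTime ε)

end ViterbiNTIME

set_option linter.unusedSimpArgs false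

namespace ViterbiNTIME

/-! ### Determinism and frames for RAM programs -/

/-! A yes-instance is certified by a path. A no-instance is certified by a table V of lower bounds
on the cost of reaching state j at time t, with V(0,0) = 0, V(T,j) > θ for all j, and z(j,t) ≤
x(i,j) + y(t,i) for all triples, where x = A, y(t,i) = V(t,i) and z(j,t) is V(t+1,j) minus the
observation cost (`not_yes_of_table`). The optimal costs, capped at θ + 1, form such a table
(`optV_succ_le`). It has only (T+1)n entries, so what remains is to verify Tn² inequalities
nondeterministically in time (Tn²)^(1-α).

A violated inequality shows up at some binary scale h = 2^l as one of three equations ⌊z/h⌋ = ⌈x/h⌉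
+ ⌈y/h⌉ + v with v = 1, 2, 3 (`le_add_of_levels`), while a valid inequality satisfies none of them
(`div_le_cdiv_add_cdiv`). The equations are considered modulo a guessed small number p. The verifier
computes the exact number of triples that solve such an equation modulo p, guesses that many
distinct solutions, and checks for each that the inequality itself holds. Then the list is complete,
no solution violates its inequality, and so no inequality is violated at all (`listProg_ok`,
`le_add_of_blocks`). This is sound for every p > 0.

The triples are cut into cubes of side 2^d with 2^d close to min(n, T). Inside a cube the number of
solutions is read off the trace of a product of three matrices whose entries are powers of X modulo
X^p - 1 (`count_of_tri`). By the tensor powers of Strassen's trilinear identity the trace is a sum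
of 7^d products, and the factors come from a fast transform (`tri_eq_sum_yates`).

For the optimal table every solution modulo p is a false positive, and p then divides a positive
number of O(log n) bits, which has few prime divisors. As there are many primes up to 2^(d/20 + 1),
averaging yields a prime with few false positives in total (`exists_modulus`). A small p keeps the
matrix entries short, a large p keeps the list short; since 7^d · 8^(d/20) ≤ 8^d, both costs fall
below Tn² by about a factor 2^(d/20), up to logarithms (`no_cost_le`, `le_rpow_of_mul_le`).

For the second part, each oracle call of a deterministic reduction is replaced by guessing the
answer and running the matching verifier (`Cmd.sim_exec`, `Cmd.sim_sound`). A tight lower bound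
would thus put unsatisfiability of k-CNF formulas, for all k, into nondeterministic time 2^((1-δ)N),
against NSETH.

The programs are written in a small structured language. A single triple `Tr m` covers completeness
with a cost bound (`m = true`) and soundness (`m = false`), so each program is analysed once. -/

theorem Exec.deterministic {O : Set (List ℕ)} {p : Cmd} {s s₁ : State} {τ₁ : ℕ}
    {qs₁ : List (List ℕ)} (h : Exec O p s τ₁ qs₁ s₁) (hp : p.GuessFree) :
    ∀ {τ₂ : ℕ} {qs₂ : List (List ℕ)} {s₂ : State}, Exec O p s τ₂ qs₂ s₂ →
      τ₁ = τ₂ ∧ qs₁ = qs₂ ∧ s₁ = s₂ := by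
  induction h with
  | const r k s => intro _ _ _ h2; cases h2; simp
  | arith op r a b s => intro _ _ _ h2; cases h2; simp
  | load r m a s => intro _ _ _ h2; cases h2; simp
  | store m a r s => intro _ _ _ h2; cases h2; simp
  | guess r v s => exact absurd hp (by simp [Cmd.GuessFree])
  | queryYes m l r s h =>
    intro _ _ _ h2
    cases h2 with
    | queryYes => simp
    | queryNo _ _ _ _ h' => exact absurd h h'
  | queryNo m l r s h =>
    intro _ _ _ h2
    cases h2 with
    | queryYes _ _ _ _ h' => exact absurd h' h
    | queryNo => simp
  | seq _ _ ih1 ih2 =>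
    intro _ _ _ h2
    cases h2 with
    | seq a b =>
      obtain ⟨rfl, rfl, rfl⟩ := ih1 hp.1 a
      obtain ⟨rfl, rfl, rfl⟩ := ih2 hp.2 b
      simp
  | condTrue h _ ih =>
    intro _ _ _ h2
    cases h2 with
    | condTrue _ a => obtain ⟨rfl, rfl, rfl⟩ := ih hp.1 a; simp
    | condFalse h' _ => exact absurd h' h
  | condFalse h _ ih =>
    intro _ _ _ h2
    cases h2 with
    | condTrue h' _ => exact absurd h h'
    | condFalse _ a => obtain ⟨rfl, rfl, rfl⟩ := ih hp.2 a; simp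
  | loopDone h =>
    intro _ _ _ h2
    cases h2 with
    | loopDone => simp
    | loopStep h' _ _ => exact absurd h h'
  | loopStep h _ _ ih1 ih2 =>
    intro _ _ _ h2
    cases h2 with
    | loopDone h' => exact absurd h' h
    | loopStep _ a b =>
      obtain ⟨rfl, rfl, rfl⟩ := ih1 hp a
      obtain ⟨rfl, rfl, rfl⟩ := ih2 hp b
      simp

/-- The program writes only registers in `R` and arrays in `M`. -/
def Cmd.WritesIn (R M : ℕ → Prop) : Cmd → Prop
  | .const r _ => R r
  | .arith _ r _ _ => R r
  | .load r _ _ => R r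
  | .store m _ _ => M m
  | .guess r => R r
  | .query _ _ r => R r
  | .seq p q => p.WritesIn R M ∧ q.WritesIn R M
  | .cond _ p q => p.WritesIn R M ∧ q.WritesIn R M
  | .loop _ p => p.WritesIn R M

theorem State.setReg_reg_of_ne {s : State} {r r' v : ℕ} (h : r' ≠ r) :
    (s.setReg r v).reg r' = s.reg r' := by
  simp [State.setReg, Function.update_of_ne h]

theorem State.setMem_mem_of_ne {s : State} {m m' i v : ℕ} (h : m' ≠ m) :
    (s.setMem m i v).mem m' = s.mem m' := by
  simp [State.setMem, Function.update_of_ne h]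

@[simp] theorem State.setReg_mem (s : State) (r v : ℕ) : (s.setReg r v).mem = s.mem := rfl

@[simp] theorem State.setMem_reg (s : State) (m i v : ℕ) : (s.setMem m i v).reg = s.reg := rfl

theorem State.setReg_reg (s : State) (r r' v : ℕ) :
    (s.setReg r v).reg r' = if r' = r then v else s.reg r' := by
  simp [State.setReg, Function.update_apply]

theorem State.setMem_mem (s : State) (m m' i i' v : ℕ) :
    (s.setMem m i v).mem m' i' = if m' = m ∧ i' = i then v else s.mem m' i' := by
  by_cases h : m' = m
  · subst h; simp [State.setMem, Function.update_apply]
  · simp [State.setMem, h]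

@[ext] theorem State.ext' {s t : State} (h1 : s.reg = t.reg) (h2 : s.mem = t.mem) : s = t := by
  cases s; cases t; simp_all

/-- A syntactic frame rule: it lets the later specifications mention only what a program changes. -/
theorem Exec.frame {O : Set (List ℕ)} {R M : ℕ → Prop} {p : Cmd} {s s' : State} {τ : ℕ}
    {qs : List (List ℕ)} (h : Exec O p s τ qs s') (hp : p.WritesIn R M) :
    (∀ r, ¬ R r → s'.reg r = s.reg r) ∧ (∀ m, ¬ M m → s'.mem m = s.mem m) := by
  have key : ∀ (s : State) (r v : ℕ), R r →
      (∀ r', ¬ R r' → (s.setReg r v).reg r' = s.reg r') ∧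
        (∀ m, ¬ M m → (s.setReg r v).mem m = s.mem m) := fun s r v hr =>
    ⟨fun r' hr' => State.setReg_reg_of_ne (by rintro rfl; exact hr' hr), fun m _ => rfl⟩
  induction h with
  | const r k s => exact key _ _ _ hp
  | arith op r a b s => exact key _ _ _ hp
  | load r m a s => exact key _ _ _ hp
  | store m a r s =>
    exact ⟨fun _ _ => rfl, fun m' hm' =>
      State.setMem_mem_of_ne (by rintro rfl; exact hm' hp)⟩
  | guess r v s => exact key _ _ _ hp
  | queryYes m l r s h => exact key _ _ _ hp
  | queryNo m l r s h => exact key _ _ _ hp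
  | seq _ _ ih1 ih2 =>
    have h1 := ih1 hp.1
    have h2 := ih2 hp.2
    exact ⟨fun r hr => (h2.1 r hr).trans (h1.1 r hr), fun r hr => (h2.2 r hr).trans (h1.2 r hr)⟩
  | condTrue _ _ ih => exact ih hp.1
  | condFalse _ _ ih => exact ih hp.2
  | loopDone => exact ⟨fun _ _ => rfl, fun _ _ => rfl⟩
  | loopStep _ _ _ ih1 ih2 =>
    have h1 := ih1 hp
    have h2 := ih2 hp
    exact ⟨fun r hr => (h2.1 r hr).trans (h1.1 r hr), fun r hr => (h2.2 r hr).trans (h1.2 r hr)⟩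

/-! ### A structured language on top of the RAM -/

/-- Expressions over variables, literals and array cells. -/
inductive Expr where
  | var (x : ℕ)
  | lit (k : ℕ)
  | op (o : ArithOp) (a b : Expr)
  | get (m : ℕ) (a : Expr)

namespace Expr

def eval (s : State) : Expr → ℕ
  | var x => s.reg x
  | lit k => k
  | op o a b => o.eval (a.eval s) (b.eval s)
  | get m a => s.mem m (a.eval s)

/-- All variables and array cells that are read hold numbers of at most `b` bits. -/
def Small (b : ℕ) (s : State) : Expr → Prop
  | var x => s.reg x < 2 ^ b
  | lit _ => True
  | op _ a c => a.Small b s ∧ c.Small b s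
  | get m a => a.Small b s ∧ s.mem m (a.eval s) < 2 ^ b

/-- Bounds the bit length of the value, in units of `B + 1` bits when the data have at most `B`
bits. Lengths add up in every operation because of products, and the extra one absorbs a carry. -/
def deg : Expr → ℕ
  | var _ => 1
  | lit k => k.size
  | op _ a b => a.deg + b.deg + 1
  | get _ _ => 1

/-- Bounds the cost of the compiled expression in the same unit; an operation pays for the lengths
of its operands through `deg`. -/
def weight : Expr → ℕ
  | var _ => 3
  | lit k => 1 + k.size
  | op _ a b => a.weight + b.weight + 1 + a.deg + b.deg
  | get _ a => a.weight + 2 + a.deg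

instance : Add Expr := ⟨op .add⟩
instance : Sub Expr := ⟨op .sub⟩
instance : Mul Expr := ⟨op .mul⟩
instance : Div Expr := ⟨op .div⟩
instance (k : ℕ) : OfNat Expr k := ⟨lit k⟩
-- The RAM has no remainder instruction, so remainders are expanded into division, multiplication
-- and subtraction.
instance : Mod Expr := ⟨fun a b => a - a / b * b⟩

section
variable (s : State) (a b : Expr)

@[simp] theorem eval_var (x : ℕ) : (var x).eval s = s.reg x := rfl
@[simp] theorem eval_get (m : ℕ) : (get m a).eval s = s.mem m (a.eval s) := rfl
@[simp] theorem eval_lit (k : ℕ) : (lit k).eval s = k := rfl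
@[simp] theorem eval_two : (2 : Expr).eval s = 2 := rfl
@[simp] theorem eval_three : (3 : Expr).eval s = 3 := rfl
@[simp] theorem eval_four : (4 : Expr).eval s = 4 := rfl
@[simp] theorem eval_seven : (7 : Expr).eval s = 7 := rfl
@[simp] theorem eval_eight : (8 : Expr).eval s = 8 := rfl
@[simp] theorem eval_zero : (0 : Expr).eval s = 0 := rfl
@[simp] theorem eval_one : (1 : Expr).eval s = 1 := rfl
@[simp] theorem eval_add : (a + b).eval s = a.eval s + b.eval s := rfl
@[simp] theorem eval_sub : (a - b).eval s = a.eval s - b.eval s := rfl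
@[simp] theorem eval_mul : (a * b).eval s = a.eval s * b.eval s := rfl
@[simp] theorem eval_div : (a / b).eval s = a.eval s / b.eval s := rfl
@[simp] theorem eval_mod : (a % b).eval s = a.eval s % b.eval s := by
  change a.eval s - a.eval s / b.eval s * b.eval s = _
  rw [Nat.mod_eq_sub_div_mul]

variable (B : ℕ)

@[simp] theorem Small_var (x : ℕ) : (var x).Small B s ↔ s.reg x < 2 ^ B := Iff.rfl
@[simp] theorem Small_get (m : ℕ) :
    (get m a).Small B s ↔ a.Small B s ∧ s.mem m (a.eval s) < 2 ^ B := Iff.rfl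
@[simp] theorem Small_lit (k : ℕ) : (lit k).Small B s ↔ True := Iff.rfl
@[simp] theorem Small_two : (2 : Expr).Small B s ↔ True := Iff.rfl
@[simp] theorem Small_three : (3 : Expr).Small B s ↔ True := Iff.rfl
@[simp] theorem Small_four : (4 : Expr).Small B s ↔ True := Iff.rfl
@[simp] theorem Small_seven : (7 : Expr).Small B s ↔ True := Iff.rfl
@[simp] theorem Small_eight : (8 : Expr).Small B s ↔ True := Iff.rfl
@[simp] theorem Small_zero : (0 : Expr).Small B s ↔ True := Iff.rfl
@[simp] theorem Small_one : (1 : Expr).Small B s ↔ True := Iff.rfl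
@[simp] theorem Small_add : (a + b).Small B s ↔ a.Small B s ∧ b.Small B s := Iff.rfl
@[simp] theorem Small_sub : (a - b).Small B s ↔ a.Small B s ∧ b.Small B s := Iff.rfl
@[simp] theorem Small_mul : (a * b).Small B s ↔ a.Small B s ∧ b.Small B s := Iff.rfl
@[simp] theorem Small_div : (a / b).Small B s ↔ a.Small B s ∧ b.Small B s := Iff.rfl
@[simp] theorem Small_mod : (a % b).Small B s ↔ a.Small B s ∧ b.Small B s := by
  change a.Small B s ∧ (a.Small B s ∧ b.Small B s) ∧ b.Small B s ↔ _
  tauto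

end

theorem size_arith_le (o : ArithOp) (a b : ℕ) : (o.eval a b).size ≤ a.size + b.size + 1 := by
  rw [Nat.size_le]
  have ha := Nat.lt_size_self a
  have hb := Nat.lt_size_self b
  have h1 : 1 ≤ 2 ^ a.size := Nat.one_le_two_pow
  have h2 : 1 ≤ 2 ^ b.size := Nat.one_le_two_pow
  have e : 2 ^ (a.size + b.size + 1) = 2 * (2 ^ a.size * 2 ^ b.size) := by ring
  cases o
  · simp only [ArithOp.eval]; nlinarith
  · simp only [ArithOp.eval]
    have : a - b ≤ a := Nat.sub_le _ _
    nlinarith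
  · simp only [ArithOp.eval]; nlinarith
  · simp only [ArithOp.eval]
    have : a / b ≤ a := Nat.div_le_self _ _
    nlinarith

theorem size_eval_le {B : ℕ} {s : State} (e : Expr) (h : e.Small B s) :
    (e.eval s).size ≤ e.deg * (B + 1) := by
  induction e with
  | var x => have := Nat.size_le.2 h; simp only [eval, deg]; omega
  | lit k => simp only [eval, deg]; exact Nat.le_mul_of_pos_right _ (by omega)
  | op o a b iha ihb =>
    have h1 := iha h.1
    have h2 := ihb h.2
    have h3 := size_arith_le o (a.eval s) (b.eval s)
    simp only [eval, deg]
    nlinarith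
  | get m a _ => have := Nat.size_le.2 h.2; simp only [eval, deg]; omega

/-- Compilation: variable `x` lives in register `β + 2 x`, the temporaries are the registers
`β + 2 t + 1`; array `0` is array `μ`, array `k > 0` is array `β + k`. -/
def arrOf (β μ k : ℕ) : ℕ := if k = 0 then μ else β + k

def comp (β μ : ℕ) : ℕ → Expr → Cmd
  -- There is no register move either; a copy is the sum with a freshly zeroed register.
  | t, var x => .seq (.const (β + 2 * t + 1) 0)
      (.arith .add (β + 2 * t + 1) (β + 2 * x) (β + 2 * t + 1))
  | t, lit k => .const (β + 2 * t + 1) k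
  | t, op o a b => .seq (comp β μ t a) (.seq (comp β μ (t + 1) b)
      (.arith o (β + 2 * t + 1) (β + 2 * t + 1) (β + 2 * (t + 1) + 1)))
  | t, get m a => .seq (comp β μ t a) (.load (β + 2 * t + 1) (arrOf β μ m) (β + 2 * t + 1))

end Expr

open ViterbiNTIME.Expr (arrOf)

/-- The abstract state that a RAM state represents. -/
def State.view (β μ : ℕ) (σ : State) : State where
  reg := fun x => σ.reg (β + 2 * x)
  mem := fun k => σ.mem (arrOf β μ k)

theorem State.view_setReg_var (β μ : ℕ) (σ : State) (x v : ℕ) :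
    (σ.setReg (β + 2 * x) v).view β μ = (σ.view β μ).setReg x v := by
  ext y
  · simp only [view, setReg_reg]
    by_cases h : y = x <;> simp [h]
  · rfl

theorem State.view_setReg_tmp (β μ : ℕ) (σ : State) (t v : ℕ) :
    (σ.setReg (β + 2 * t + 1) v).view β μ = σ.view β μ := by
  ext y
  · simp only [view, setReg_reg]
    rw [if_neg (by omega)]
  · rfl

theorem Expr.arrOf_inj {β μ : ℕ} (hμ : μ < β) {k l : ℕ} : arrOf β μ k = arrOf β μ l ↔ k = l := by
  unfold arrOf
  split_ifs <;> omega

theorem State.view_setMem {β μ : ℕ} (hμ : μ < β) (σ : State) (k i v : ℕ) :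
    (σ.setMem (arrOf β μ k) i v).view β μ = (σ.view β μ).setMem k i v := by
  ext y
  · rfl
  · simp only [view, setMem_mem, Expr.arrOf_inj hμ]

theorem Expr.comp_guessFree (β μ : ℕ) (e : Expr) : ∀ t, (e.comp β μ t).GuessFree := by
  induction e with
  | var x => intro t; simp [comp, Cmd.GuessFree]
  | lit k => intro t; simp [comp, Cmd.GuessFree]
  | op o a b iha ihb => intro t; simp [comp, Cmd.GuessFree, iha, ihb]
  | get m a ih => intro t; simp [comp, Cmd.GuessFree, ih]

/-- The clause about `t' < t` drives the induction: the left operand waits in temporary `t` while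
the right one is evaluated from `t + 1` on. The run exists unconditionally and only its cost needs
bounds on the data, so it can be used for soundness as well. -/
theorem Expr.comp_exec (β μ : ℕ) (e : Expr) (O : Set (List ℕ)) : ∀ (t : ℕ) (σ : State),
    ∃ (τ : ℕ) (σ' : State), Exec O (e.comp β μ t) σ τ [] σ' ∧ σ'.view β μ = σ.view β μ ∧
      σ'.reg (β + 2 * t + 1) = e.eval (σ.view β μ) ∧
      (∀ t' < t, σ'.reg (β + 2 * t' + 1) = σ.reg (β + 2 * t' + 1)) ∧
      ∀ B, e.Small B (σ.view β μ) → τ ≤ e.weight * (B + 1) := by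
  induction e with
  | var x =>
    intro t σ
    refine ⟨_, _, Exec.seq (Exec.const _ _ _) (Exec.arith _ _ _ _ _), ?_, ?_, ?_, ?_⟩
    · simp only [State.view_setReg_tmp]
    · simp only [State.setReg_reg, eval_var, State.view, ArithOp.eval, if_true]
      rw [if_neg (by omega)]; rfl
    · intro t' ht'
      simp only [State.setReg_reg]
      rw [if_neg (by omega), if_neg (by omega)]
    · intro B hB
      have := Nat.size_le.2 hB
      simp only [State.view] at this
      simp only [State.setReg_reg, weight, if_true, Nat.size_zero]
      rw [if_neg (by omega)]
      omega
  | lit k =>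
    intro t σ
    refine ⟨_, _, Exec.const _ _ _, ?_, ?_, ?_, ?_⟩
    · simp only [State.view_setReg_tmp]
    · simp [State.setReg_reg]
    · intro t' ht'
      simp only [State.setReg_reg]
      rw [if_neg (by omega)]
    · intro B _
      simp only [weight]
      exact Nat.le_mul_of_pos_right _ (by omega)
  | op o a b iha ihb =>
    intro t σ
    obtain ⟨τ1, σ1, h1, v1, r1, f1, c1⟩ := iha t σ
    obtain ⟨τ2, σ2, h2, v2, r2, f2, c2⟩ := ihb (t + 1) σ1
    refine ⟨_, _, Exec.seq h1 (Exec.seq h2 (Exec.arith _ _ _ _ _)), ?_, ?_, ?_, ?_⟩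
    · simp only [State.view_setReg_tmp, v2, v1]
    · simp only [State.setReg_reg, if_true, f2 t (by omega), r2, r1, v1, eval]
    · intro t' ht'
      simp only [State.setReg_reg]
      rw [if_neg (by omega), f2 t' (by omega), f1 t' (by omega)]
    · intro B hB
      have k1 := c1 B hB.1
      have k2 := c2 B (by rw [v1]; exact hB.2)
      have d1 := size_eval_le a hB.1
      have d2 := size_eval_le b hB.2
      simp only [f2 t (by omega), r2, r1, v1, weight]
      nlinarith
  | get m a ih =>
    intro t σ
    obtain ⟨τ1, σ1, h1, v1, r1, f1, c1⟩ := ih t σ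
    have hm : σ1.mem (arrOf β μ m) = (σ.view β μ).mem m := by rw [← v1]; rfl
    refine ⟨_, _, Exec.seq h1 (Exec.load _ _ _ _), ?_, ?_, ?_, ?_⟩
    · simp only [State.view_setReg_tmp, v1]
    · simp only [State.setReg_reg, if_true, r1, hm, eval]
    · intro t' ht'
      simp only [State.setReg_reg]
      rw [if_neg (by omega), f1 t' (by omega)]
    · intro B hB
      have k1 := c1 B hB.1
      have d1 := size_eval_le a hB.1
      have d2 := Nat.size_le.2 hB.2
      simp only [r1, hm, weight]
      nlinarith

/-- Statements: assignment to a variable or to an array cell, nondeterministic choice, the check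
that an expression vanishes (a failing check never halts), composition, and a loop that runs as
long as a variable is nonzero. -/
inductive Stmt where
  | set (x : ℕ) (e : Expr)
  | put (k : ℕ) (a e : Expr)
  | pick (x : ℕ)
  | check (e : Expr)
  | seq (p q : Stmt)
  | loop (h : ℕ) (p : Stmt)

namespace Stmt

/-- The body of the loop in `check` never touches the tested register, so a nonzero value makes the
run diverge. Rejection is divergence: a halting run has passed every check. -/
def comp (β μ : ℕ) : Stmt → Cmd
  | set x e => .seq (e.comp β μ 0) (.seq (.const (β + 3) 0)
      (.arith .add (β + 2 * x) (β + 1) (β + 3)))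
  | put k a e => .seq (a.comp β μ 0) (.seq (e.comp β μ 1) (.store (arrOf β μ k) (β + 1) (β + 3)))
  | pick x => .guess (β + 2 * x)
  | check e => .seq (e.comp β μ 0) (.loop (β + 1) (.const (β + 3) 0))
  | seq p q => .seq (p.comp β μ) (q.comp β μ)
  | loop h p => .loop (β + 2 * h) (p.comp β μ)

/-- Variables that may be written. -/
def vars : Stmt → List ℕ
  | set x _ => [x]
  | put _ _ _ => []
  | pick x => [x]
  | check _ => []
  | seq p q => p.vars ++ q.vars
  | loop _ p => p.vars

/-- Arrays that may be written. -/
def arrs : Stmt → List ℕ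
  | set _ _ => []
  | put k _ _ => [k]
  | pick _ => []
  | check _ => []
  | seq p q => p.arrs ++ q.arrs
  | loop _ p => p.arrs

/-- The cost of the atomic statements, in units of the largest bit length. -/
def weight : Stmt → ℕ
  | set _ e => e.weight + e.deg + 2
  | put _ a e => a.weight + e.weight + a.deg + e.deg + 1
  | pick _ => 1
  | check e => e.weight + 1
  | seq p q => p.weight + q.weight
  | loop _ p => p.weight

end Stmt

/-- Total correctness with cost bound `c` if `m` is `true` (some computation reaches `Q`), partial
correctness if `m` is `false` (every halting computation ends in `Q`), for all placements of the
program in the RAM. -/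
def Tr (m : Bool) (S : Stmt) (s : State) (Q : State → Prop) (c : ℕ) : Prop :=
  ∀ β μ : ℕ, μ < β → ∀ σ : State, σ.view β μ = s →
    (m = true → ∃ (τ : ℕ) (σ' : State), Exec ∅ (S.comp β μ) σ τ [] σ' ∧ Q (σ'.view β μ) ∧ τ ≤ c) ∧
    (m = false → ∀ (τ : ℕ) (qs : List (List ℕ)) (σ' : State),
      Exec ∅ (S.comp β μ) σ τ qs σ' → Q (σ'.view β μ))

/-- The states agree except on the listed variables and arrays. -/
def AgreeOff (vs ks : List ℕ) (s s' : State) : Prop :=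
  (∀ x, x ∉ vs → s'.reg x = s.reg x) ∧ (∀ k, k ∉ ks → s'.mem k = s.mem k)

theorem AgreeOff.trans {vs ks : List ℕ} {s s' s'' : State} (h : AgreeOff vs ks s s')
    (h' : AgreeOff vs ks s' s'') : AgreeOff vs ks s s'' :=
  ⟨fun x hx => (h'.1 x hx).trans (h.1 x hx), fun x hx => (h'.2 x hx).trans (h.2 x hx)⟩

theorem AgreeOff.mono {vs ks vs' ks' : List ℕ} {s s' : State} (h : AgreeOff vs ks s s')
    (hv : vs ⊆ vs') (hk : ks ⊆ ks') : AgreeOff vs' ks' s s' :=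
  ⟨fun x hx => h.1 x fun h' => hx (hv h'), fun x hx => h.2 x fun h' => hx (hk h')⟩

theorem Expr.comp_writesIn (β μ : ℕ) {R M : ℕ → Prop} (hR : ∀ t, R (β + 2 * t + 1)) (e : Expr) :
    ∀ t, (e.comp β μ t).WritesIn R M := by
  induction e with
  | var x => intro t; exact ⟨hR _, hR _⟩
  | lit k => intro t; exact hR _
  | op o a b iha ihb => intro t; exact ⟨iha t, ihb _, hR _⟩
  | get m a ih => intro t; exact ⟨ih t, hR _⟩

theorem Stmt.comp_writesIn (β μ : ℕ) {R M : ℕ → Prop} (hR : ∀ t, R (β + 2 * t + 1)) (S : Stmt)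
    (hv : ∀ x ∈ S.vars, R (β + 2 * x)) (ha : ∀ k ∈ S.arrs, M (arrOf β μ k)) :
    (S.comp β μ).WritesIn R M := by
  induction S with
  | set x e => exact ⟨e.comp_writesIn β μ hR 0, hR 1, hv x (by simp [vars])⟩
  | put k a e => exact ⟨a.comp_writesIn β μ hR 0, e.comp_writesIn β μ hR 1, ha k (by simp [arrs])⟩
  | pick x => exact hv x (by simp [vars])
  | check e => exact ⟨e.comp_writesIn β μ hR 0, hR 1⟩
  | seq p q ihp ihq =>
    exact ⟨ihp (fun x hx => hv x (by simp [vars, hx])) (fun x hx => ha x (by simp [arrs, hx])),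
      ihq (fun x hx => hv x (by simp [vars, hx])) (fun x hx => ha x (by simp [arrs, hx]))⟩
  | loop h p ih => exact ih hv ha

theorem Expr.comp_queryFree (β μ : ℕ) (e : Expr) : ∀ t, (e.comp β μ t).QueryFree := by
  induction e with
  | var x => intro t; simp [comp, Cmd.QueryFree]
  | lit k => intro t; simp [comp, Cmd.QueryFree]
  | op o a b iha ihb => intro t; simp [comp, Cmd.QueryFree, iha, ihb]
  | get m a ih => intro t; simp [comp, Cmd.QueryFree, ih]

theorem Stmt.comp_queryFree (β μ : ℕ) (S : Stmt) : (S.comp β μ).QueryFree := by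
  induction S <;> simp_all [comp, Cmd.QueryFree, Expr.comp_queryFree]

theorem Stmt.exec_agreeOff {β μ : ℕ} (hμ : μ < β) {S : Stmt} {σ σ' : State} {τ : ℕ}
    {qs : List (List ℕ)} (h : Exec ∅ (S.comp β μ) σ τ qs σ') :
    AgreeOff S.vars S.arrs (σ.view β μ) (σ'.view β μ) := by
  have hw : (S.comp β μ).WritesIn (fun r => (∃ t, r = β + 2 * t + 1) ∨ ∃ x ∈ S.vars, r = β + 2 * x)
      (fun m => ∃ k ∈ S.arrs, m = arrOf β μ k) :=
    S.comp_writesIn β μ (fun t => Or.inl ⟨t, rfl⟩) (fun x hx => Or.inr ⟨x, hx, rfl⟩)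
      fun k hk => ⟨k, hk, rfl⟩
  obtain ⟨h1, h2⟩ := h.frame hw
  constructor
  · intro x hx
    refine h1 _ ?_
    rintro (⟨t, ht⟩ | ⟨y, hy, hxy⟩)
    · omega
    · exact hx (by rwa [show x = y by omega])
  · intro k hk
    refine h2 _ ?_
    rintro ⟨l, hl, hkl⟩
    rw [Expr.arrOf_inj hμ] at hkl
    exact hk (hkl ▸ hl)

/-! ### Rules -/

section Rules

variable {m : Bool} {s : State} {Q Q' : State → Prop} {c c' : ℕ}

/-- The consequence rule has the frame built in: the new postcondition may use that everything the
statement cannot write is unchanged. -/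
theorem Tr.mono {S : Stmt} (h : Tr m S s Q c) (hQ : ∀ s', AgreeOff S.vars S.arrs s s' → Q s' → Q' s')
    (hc : m = true → c ≤ c') : Tr m S s Q' c' := by
  intro β μ hμ σ hσ
  refine ⟨fun hm => ?_, fun hm τ qs σ' he => ?_⟩
  · obtain ⟨τ, σ', he, hq, ht⟩ := (h β μ hμ σ hσ).1 hm
    exact ⟨τ, σ', he, hQ _ (hσ ▸ Stmt.exec_agreeOff hμ he) hq, ht.trans (hc hm)⟩
  · exact hQ _ (hσ ▸ Stmt.exec_agreeOff hμ he) ((h β μ hμ σ hσ).2 hm τ qs σ' he)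

theorem Tr.seq {S₁ S₂ : Stmt} {c₁ c₂ : ℕ} {P : State → Prop} (h₁ : Tr m S₁ s P c₁)
    (h₂ : ∀ s', AgreeOff S₁.vars S₁.arrs s s' → P s' → Tr m S₂ s' Q c₂) :
    Tr m (.seq S₁ S₂) s Q (c₁ + c₂) := by
  intro β μ hμ σ hσ
  refine ⟨fun hm => ?_, fun hm τ qs σ' he => ?_⟩
  · obtain ⟨τ, σ', he, hq, ht⟩ := (h₁ β μ hμ σ hσ).1 hm
    obtain ⟨τ', σ'', he', hq', ht'⟩ :=
      (h₂ _ (hσ ▸ Stmt.exec_agreeOff hμ he) hq β μ hμ σ' rfl).1 hm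
    exact ⟨τ + τ', σ'', Exec.seq he he', hq', by omega⟩
  · cases he with
    | seq a b =>
      have hq := (h₁ β μ hμ σ hσ).2 hm _ _ _ a
      exact (h₂ _ (hσ ▸ Stmt.exec_agreeOff hμ a) hq β μ hμ _ rfl).2 hm _ _ _ b

theorem Tr.set {x : ℕ} {e : Expr} (b : ℕ) (hs : m = true → e.Small b s)
    (hQ : Q (s.setReg x (e.eval s))) : Tr m (.set x e) s Q ((Stmt.set x e).weight * (b + 1)) := by
  intro β μ hμ σ hσ
  obtain ⟨τ, σ', he, hv, hr, -, hc⟩ := e.comp_exec β μ ∅ 0 σ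
  rw [hσ] at hv hr hc
  simp only [Nat.mul_zero, Nat.add_zero] at hr
  have hE := Exec.seq he (Exec.seq (Exec.const (β + 3) 0 σ')
    (Exec.arith .add (β + 2 * x) (β + 1) (β + 3) _))
  have hr' : (σ'.setReg (β + 3) 0).reg (β + 1) = e.eval s := by
    rw [State.setReg_reg, if_neg (by omega), hr]
  have hfin : (((σ'.setReg (β + 3) 0).setReg (β + 2 * x) (ArithOp.add.eval
      ((σ'.setReg (β + 3) 0).reg (β + 1)) ((σ'.setReg (β + 3) 0).reg (β + 3))))).view β μ =
      s.setReg x (e.eval s) := by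
    have ht : (σ'.setReg (β + 3) 0).view β μ = σ'.view β μ := State.view_setReg_tmp β μ σ' 1 0
    rw [State.view_setReg_var, hr', ht, hv]
    simp [State.setReg_reg, ArithOp.eval]
  refine ⟨fun hm => ⟨_, _, hE, by rw [hfin]; exact hQ, ?_⟩, fun hm τ' qs' σ'' he' => ?_⟩
  · have h1 := hc b (hs hm)
    have h2 := e.size_eval_le (hs hm)
    rw [hr']
    simp only [State.setReg_reg, if_true, Nat.size_zero, Stmt.weight]
    nlinarith
  -- The compiled code makes no guesses, so the run exhibited above is the only one; this turns it
  -- into partial correctness.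
  · obtain ⟨-, -, rfl⟩ := hE.deterministic (by simp [Cmd.GuessFree, Expr.comp_guessFree]) he'
    rw [hfin]; exact hQ

theorem Tr.put {k : ℕ} {a e : Expr} (b : ℕ) (hs : m = true → a.Small b s ∧ e.Small b s)
    (hQ : Q (s.setMem k (a.eval s) (e.eval s))) :
    Tr m (.put k a e) s Q ((Stmt.put k a e).weight * (b + 1)) := by
  intro β μ hμ σ hσ
  obtain ⟨τ, σ₁, he, hv, hr, -, hc⟩ := a.comp_exec β μ ∅ 0 σ
  obtain ⟨τ', σ₂, he', hv', hr', hf, hc'⟩ := e.comp_exec β μ ∅ 1 σ₁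
  have hf := hf 0 (by omega)
  rw [hv, hσ] at hv' hr' hc'
  rw [hσ] at hv hr hc
  simp only [Nat.mul_zero, Nat.add_zero] at hr hf
  simp only [Nat.mul_one] at hr'
  have hE := Exec.seq he (Exec.seq he' (Exec.store (arrOf β μ k) (β + 1) (β + 3) _))
  have hfin : (σ₂.setMem (arrOf β μ k) (σ₂.reg (β + 1)) (σ₂.reg (β + 3))).view β μ =
      s.setMem k (a.eval s) (e.eval s) := by
    rw [State.view_setMem hμ, hf, hr, hr', hv']
  refine ⟨fun hm => ⟨_, _, hE, by rw [hfin]; exact hQ, ?_⟩, fun hm τ' qs' σ'' he' => ?_⟩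
  · have h1 := hc b (hs hm).1
    have h2 := a.size_eval_le (hs hm).1
    have h1' := hc' b (hs hm).2
    have h2' := e.size_eval_le (hs hm).2
    rw [hf, hr, hr']
    simp only [Stmt.weight]
    nlinarith
  · obtain ⟨-, -, rfl⟩ := hE.deterministic (by simp [Cmd.GuessFree, Expr.comp_guessFree]) he'
    rw [hfin]; exact hQ

theorem Tr.pick {x : ℕ} (b : ℕ) (hs : m = true → ∃ v < 2 ^ b, Q (s.setReg x v))
    (hQ : m = false → ∀ v, Q (s.setReg x v)) : Tr m (.pick x) s Q (b + 1) := by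
  intro β μ hμ σ hσ
  refine ⟨fun hm => ?_, fun hm τ' qs' σ'' he' => ?_⟩
  · obtain ⟨v, hv, hq⟩ := hs hm
    refine ⟨_, _, Exec.guess _ v _, by rw [State.view_setReg_var, hσ]; exact hq, ?_⟩
    have := Nat.size_le.2 hv
    omega
  · cases he' with
    | guess r v s => rw [State.view_setReg_var, hσ]; exact hQ hm v

/-- For soundness nothing is assumed about `e`: its vanishing is learnt from the fact that the run
halts. -/
theorem Tr.check {e : Expr} (b : ℕ) (hs : m = true → e.Small b s ∧ e.eval s = 0)
    (hQ : e.eval s = 0 → Q s) : Tr m (.check e) s Q ((Stmt.check e).weight * (b + 1)) := by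
  intro β μ hμ σ hσ
  obtain ⟨τ, σ', he, hv, hr, -, hc⟩ := e.comp_exec β μ ∅ 0 σ
  rw [hσ] at hv hr hc
  simp only [Nat.mul_zero, Nat.add_zero] at hr
  refine ⟨fun hm => ?_, fun hm τ' qs' σ'' he' => ?_⟩
  · refine ⟨_, _, Exec.seq he (Exec.loopDone (hr.trans (hs hm).2)), hv ▸ hQ (hs hm).2, ?_⟩
    have h1 := hc b (hs hm).1
    rw [hr, (hs hm).2]
    simp only [Stmt.weight, Nat.size_zero]
    nlinarith
  · cases he' with
    | seq h1 h2 =>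
      obtain ⟨-, -, rfl⟩ := he.deterministic (Expr.comp_guessFree _ _ _ _) h1
      -- A halting run of this loop must have skipped the body: by induction the state after one
      -- round would have the tested register zero, but the body leaves that register alone.
      have key : ∀ {p : Cmd} {σ₁ σ₂ : State} {τ : ℕ} {qs : List (List ℕ)}, Exec ∅ p σ₁ τ qs σ₂ →
          p = .loop (β + 1) (.const (β + 3) 0) → σ₁.reg (β + 1) = 0 ∧ σ₂ = σ₁ := by
        intro p σ₁ σ₂ τ qs h
        induction h with
        | loopDone h => intro hp; cases hp; exact ⟨h, rfl⟩
        | loopStep h a _ _ ih =>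
          intro hp
          cases hp
          cases a
          have := (ih rfl).1
          rw [State.setReg_reg, if_neg (by omega)] at this
          exact absurd this h
        | _ => intro hp; cases hp
      obtain ⟨h0, rfl⟩ := key h2 rfl
      rw [hv]
      exact hQ (hr ▸ h0)

/-- The loop register is required to drop by exactly one per round. Hence the number of rounds is
known even for partial correctness, and induction on it replaces a termination argument. The index
of the invariant counts the remaining rounds. -/
theorem Tr.loop {h : ℕ} {S : Stmt} {I : ℕ → State → Prop} {c : ℕ → ℕ} (b : ℕ)
    (step : ∀ k s, I (k + 1) s → s.reg h = k + 1 →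
      Tr m S s (fun s' => I k s' ∧ s'.reg h = k) (c k)) :
    ∀ k, (m = true → k < 2 ^ b) → ∀ s, I k s → s.reg h = k →
      Tr m (.loop h S) s (I 0) (∑ i ∈ Finset.range k, c i + (k + 1) * (b + 1)) := by
  intro k
  induction k with
  | zero =>
    intro _ s hI hk β μ hμ σ hσ
    have hz : σ.reg (β + 2 * h) = 0 := by rw [← hk, ← hσ]; rfl
    refine ⟨fun hm => ⟨_, _, Exec.loopDone hz, by rw [hσ]; exact hI, ?_⟩,
      fun hm τ' qs' σ'' he' => ?_⟩
    · simp [hz]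
    · cases he' with
      | loopDone => rw [hσ]; exact hI
      | loopStep h' => exact absurd hz h'
  | succ k ih =>
    intro hb s hI hk β μ hμ σ hσ
    have hz : σ.reg (β + 2 * h) = k + 1 := by rw [← hk, ← hσ]; rfl
    have hz' : σ.reg (β + 2 * h) ≠ 0 := by omega
    have hst := step k s hI hk β μ hμ σ hσ
    refine ⟨fun hm => ?_, fun hm τ' qs' σ'' he' => ?_⟩
    · obtain ⟨τ, σ', he, hq, ht⟩ := hst.1 hm
      obtain ⟨τ', σ'', he', hq', ht'⟩ :=
        (ih (fun hm => by have := hb hm; omega) _ hq.1 hq.2 β μ hμ σ' rfl).1 hm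
      refine ⟨_, _, Exec.loopStep hz' he he', hq', ?_⟩
      have := Nat.size_le.2 (hb hm)
      rw [hz, Finset.sum_range_succ]
      have e : (k + 1 + 1) * (b + 1) = (k + 1) * (b + 1) + (b + 1) := by ring
      omega
    · cases he' with
      | loopDone h' => exact absurd h' hz'
      | loopStep h' h1 h2 =>
        have hq := hst.2 hm _ _ _ h1
        exact (ih (fun hm => by have := hb hm; omega) _ hq.1 hq.2 β μ hμ _ rfl).2 hm _ _ _ h2

/-- Weakest preconditions of loop-free statements, for numbers of at most `b` bits. -/
def wp (m : Bool) (b : ℕ) : Stmt → State → (State → Prop) → Prop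
  | .set x e, s, Q => (m = true → e.Small b s) ∧ Q (s.setReg x (e.eval s))
  | .put k a e, s, Q => (m = true → a.Small b s ∧ e.Small b s) ∧
      Q (s.setMem k (a.eval s) (e.eval s))
  | .pick x, s, Q => (m = true → ∃ v < 2 ^ b, Q (s.setReg x v)) ∧
      (m = false → ∀ v, Q (s.setReg x v))
  | .check e, s, Q => (m = true → e.Small b s ∧ e.eval s = 0) ∧ (e.eval s = 0 → Q s)
  | .seq p q, s, Q => wp m b p s fun s' => wp m b q s' Q
  | .loop _ _, _, _ => False

theorem Tr.wp {S : Stmt} (b : ℕ) : ∀ {s : State} {Q : State → Prop},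
    wp m b S s Q → Tr m S s Q (S.weight * (b + 1)) := by
  induction S with
  | set x e => exact fun h => Tr.set b h.1 h.2
  | put k a e => exact fun h => Tr.put b h.1 h.2
  | pick x => exact fun h => by simpa [Stmt.weight] using Tr.pick b h.1 h.2
  | check e => exact fun h => Tr.check b h.1 h.2
  | seq p q ihp ihq =>
    intro s Q h
    rw [Stmt.weight, Nat.add_mul]
    exact Tr.seq (ihp h) fun s' _ h' => ihq h'
  | loop h p => exact fun h => h.elim

/-- `for x < e do p`, with the auxiliary variable `h` counting the remaining iterations. -/
def Stmt.for (x h : ℕ) (e : Expr) (p : Stmt) : Stmt :=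
  .seq (.set h e) (.seq (.set x 0) (.loop h (.seq p
    (.seq (.set x (.var x + 1)) (.set h (.var h - 1))))))

/-- The overhead of an iteration of a `for` loop. -/
def Expr.forWeight (e : Expr) : ℕ := e.weight + e.deg + 40

/-- This is `Tr.loop` read backwards: with `k` rounds left the index variable is `N - k`. The
invariant must ignore `x` and `h`, since both are updated after the body has established it. -/
theorem Tr.for {x h : ℕ} {e : Expr} {p : Stmt} {I : ℕ → State → Prop} {c : ℕ → ℕ} (b N : ℕ)
    (hN : e.eval s = N) (hb : m = true → e.Small b s ∧ N < 2 ^ b) (hxh : x ≠ h)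
    (hx : x ∉ p.vars) (hh : h ∉ p.vars)
    (hI : ∀ i s s', AgreeOff [x, h] [] s s' → I i s → I i s') (h0 : I 0 s)
    (step : ∀ i < N, ∀ s', AgreeOff (x :: h :: p.vars) p.arrs s s' → s'.reg x = i → I i s' →
      Tr m p s' (I (i + 1)) (c i)) :
    Tr m (.for x h e p) s (I N) (∑ i ∈ Finset.range N, c i + (N + 1) * (e.forWeight * (b + 1))) := by
  set J : ℕ → State → Prop := fun k s' => k ≤ N ∧ AgreeOff (x :: h :: p.vars) p.arrs s s' ∧
    s'.reg x = N - k ∧ I (N - k) s' with hJ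
  have agr : ∀ (t : State) (u v : ℕ), AgreeOff [x, h] [] t ((t.setReg x u).setReg h v) := by
    intro t u v
    refine ⟨fun y hy => ?_, fun _ _ => rfl⟩
    simp only [List.mem_cons, List.not_mem_nil, or_false, not_or] at hy
    rw [State.setReg_reg_of_ne hy.2, State.setReg_reg_of_ne hy.1]
  have agr' : ∀ (t : State) (u v : ℕ), AgreeOff [x, h] [] t ((t.setReg h v).setReg x u) := by
    intro t u v
    refine ⟨fun y hy => ?_, fun _ _ => rfl⟩
    simp only [List.mem_cons, List.not_mem_nil, or_false, not_or] at hy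
    rw [State.setReg_reg_of_ne hy.1, State.setReg_reg_of_ne hy.2]
  have sub1 : [x, h] ⊆ x :: h :: p.vars := by simp
  have sub2 : p.vars ⊆ x :: h :: p.vars := fun y hy => by simp [hy]
  have hloop := Tr.loop (m := m) (h := h)
    (S := .seq p (.seq (.set x (.var x + 1)) (.set h (.var h - 1))))
    (I := fun k s' => J k s' ∧ (m = true → N < 2 ^ b)) (c := fun k => c (N - 1 - k) + 26 * (b + 1)) b
    (by
      rintro k t ⟨⟨hkN, hag, hxk, hIk⟩, hNb⟩ hhk
      have hst := step (N - (k + 1)) (by omega) t hag hxk hIk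
      rw [show N - (k + 1) = N - 1 - k by omega] at hst
      refine Tr.seq hst fun t' hag' hI' => ?_
      have ex : t'.reg x = N - (k + 1) := by rw [hag'.1 x hx, hxk]
      have eh : t'.reg h = k + 1 := by rw [hag'.1 h hh, hhk]
      have hlt : m = true → t'.reg x < 2 ^ b ∧ t'.reg h < 2 ^ b := fun hm => by
        have := hNb hm
        omega
      have hw : (Stmt.seq (.set x (.var x + 1)) (.set h (.var h - 1))).weight = 26 := rfl
      rw [← hw]
      refine Tr.wp b ⟨fun hm => ?_, fun hm => ?_, ?_⟩
      · simpa using (hlt hm).1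
      · simpa [State.setReg_reg, hxh.symm] using (hlt hm).2
      · simp only [Expr.eval_add, Expr.eval_sub, Expr.eval_var, Expr.eval_one,
          State.setReg_reg_of_ne hxh.symm]
        refine ⟨⟨⟨by omega, ?_, ?_, ?_⟩, hNb⟩, ?_⟩
        · exact (hag.trans (hag'.mono sub2 (by simp))).trans ((agr _ _ _).mono sub1 (by simp))
        · simp only [State.setReg_reg, hxh, if_false, if_true]; omega
        · refine hI _ _ _ (agr _ _ _) ?_
          rwa [show N - k = N - 1 - k + 1 by omega]
        · simp [State.setReg_reg, eh])
  have main := Tr.seq (m := m) (s := s) (Tr.set (x := h) (e := e) b (fun hm => (hb hm).1)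
    (Q := fun s' => s' = s.setReg h N) (by rw [hN])) (fun s' _ hs' =>
      Tr.seq (Tr.set (x := x) (e := 0) b (fun _ => trivial)
        (Q := fun s'' => s'' = s'.setReg x 0) rfl)
      (fun s'' _ hs'' => hloop N (fun hm => (hb hm).2) s''
        (by
          subst hs'' hs'
          refine ⟨⟨le_rfl, (agr' _ _ _).mono sub1 (by simp), ?_, ?_⟩, fun hm => (hb hm).2⟩
          · simp [State.setReg_reg]
          · rw [Nat.sub_self]; exact hI _ _ _ (agr' _ _ _) h0)
        (by subst hs'' hs'; simp [State.setReg_reg, hxh.symm])))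
  refine main.mono (fun s' _ h' => ?_) fun hm => ?_
  · simpa using h'.1.2.2.2
  · rw [Finset.sum_add_distrib, Finset.sum_range_reflect, Finset.sum_const, Finset.card_range,
      smul_eq_mul]
    have e1 : (Stmt.set h e).weight = e.weight + e.deg + 2 := rfl
    have e2 : (Stmt.set x 0).weight = 3 := rfl
    rw [e1, e2, Expr.forWeight]
    set w := e.weight + e.deg
    set B := b + 1
    have : (N + 1) * ((w + 40) * B) = N * 26 * B + (N + 1) * B + (w + 2) * B + 3 * B +
      (N * w * B + N * 13 * B + 34 * B) := by ring
    rw [this]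
    have : N * (26 * B) = N * 26 * B := by ring
    omega

end Rules

/-- The total weight of a statement, with the overhead of its loops. -/
def Stmt.wt : Stmt → ℕ
  | .set x e => (Stmt.set x e).weight
  | .put k a e => (Stmt.put k a e).weight
  | .pick x => (Stmt.pick x).weight
  | .check e => (Stmt.check e).weight
  | .seq p q => p.wt + q.wt
  | .loop _ p => p.wt + 14

/-- Like `Tr`, with cost at most `n` times the weight of the statement for numbers of at most `b`
bits. -/
def Ok (m : Bool) (S : Stmt) (s : State) (Q : State → Prop) (b n : ℕ) : Prop :=
  Tr m S s Q (S.wt * (n * (b + 1)))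

/-! ### Rules with a uniform cost unit -/

section Ok

variable {m : Bool} {s : State} {Q Q' : State → Prop} {b n n' : ℕ}

theorem Ok.mono {S : Stmt} (h : Ok m S s Q b n)
    (hQ : ∀ s', AgreeOff S.vars S.arrs s s' → Q s' → Q' s') (hn : m = true → n ≤ n') :
    Ok m S s Q' b n' :=
  Tr.mono h hQ fun hm => Nat.mul_le_mul_left _ (Nat.mul_le_mul_right _ (hn hm))

theorem Ok.seq {S₁ S₂ : Stmt} {n₁ n₂ : ℕ} {P : State → Prop} (h₁ : Ok m S₁ s P b n₁)
    (h₂ : ∀ s', AgreeOff S₁.vars S₁.arrs s s' → P s' → Ok m S₂ s' Q b n₂)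
    (hn : m = true → n₁ ≤ n ∧ n₂ ≤ n) : Ok m (.seq S₁ S₂) s Q b n := by
  refine Tr.mono (Tr.seq h₁ h₂) (fun _ _ h => h) fun hm => ?_
  have := hn hm
  rw [Stmt.wt, Nat.add_mul]
  exact Nat.add_le_add (Nat.mul_le_mul_left _ (Nat.mul_le_mul_right _ this.1))
    (Nat.mul_le_mul_left _ (Nat.mul_le_mul_right _ this.2))

theorem Stmt.weight_le_wt (S : Stmt) : S.weight ≤ S.wt := by
  induction S <;> simp only [weight, wt] at * <;> omega

theorem Ok.wp {S : Stmt} (h : ViterbiNTIME.wp m b S s Q) (hn : m = true → 1 ≤ n) :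
    Ok m S s Q b n :=
  (Tr.wp b h).mono (fun _ _ h => h) fun hm => Nat.mul_le_mul S.weight_le_wt
    (Nat.le_mul_of_pos_left _ (hn hm))

/-- When every round fits into `c` units, `N + 1` times `c` units suffice; the additional round pays
for the initialisation and the last test. -/
theorem Ok.for {x h : ℕ} {e : Expr} {p : Stmt} {I : ℕ → State → Prop} {c : ℕ} (N : ℕ)
    (hN : e.eval s = N) (hb : m = true → e.Small b s ∧ N < 2 ^ b)
    (hxh : x ≠ h ∧ x ∉ p.vars ∧ h ∉ p.vars)
    (hI : ∀ i s s', AgreeOff [x, h] [] s s' → I i s → I i s') (h0 : I 0 s)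
    (step : ∀ i < N, ∀ s', AgreeOff (x :: h :: p.vars) p.arrs s s' → s'.reg x = i → I i s' →
      Ok m p s' (I (i + 1)) b c)
    (hn : m = true → 1 ≤ c ∧ (N + 1) * c ≤ n) :
    Ok m (.for x h e p) s (I N) b n := by
  refine (Tr.for b N hN hb hxh.1 hxh.2.1 hxh.2.2 hI h0 step).mono (fun _ _ h => h) fun hm => ?_
  have hc := hn hm
  -- The summand 14 in `Stmt.wt` is chosen to make this true: the weight of a loop then dominates
  -- the body plus `Expr.forWeight`.
  have hw : (Stmt.for x h e p).wt = p.wt + e.forWeight + 5 := by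
    have : (Stmt.for x h e p).wt = e.weight + e.deg + 2 + (3 + (p.wt + (13 + 13) + 14)) := rfl
    rw [this, Expr.forWeight]; ring
  rw [Finset.sum_const, Finset.card_range, smul_eq_mul, hw]
  have h1 : N * (p.wt * (c * (b + 1))) ≤ p.wt * (n * (b + 1)) := by
    rw [show N * (p.wt * (c * (b + 1))) = p.wt * (N * c * (b + 1)) by ring]
    exact Nat.mul_le_mul_left _ (Nat.mul_le_mul_right _ (by nlinarith))
  have h2 : (N + 1) * (e.forWeight * (b + 1)) ≤ e.forWeight * (n * (b + 1)) := by
    rw [show (N + 1) * (e.forWeight * (b + 1)) = e.forWeight * ((N + 1) * (b + 1)) by ring]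
    exact Nat.mul_le_mul_left _ (Nat.mul_le_mul_right _ (by nlinarith))
  have h3 : (p.wt + e.forWeight + 5) * (n * (b + 1)) = p.wt * (n * (b + 1)) +
    e.forWeight * (n * (b + 1)) + 5 * (n * (b + 1)) := by ring
  omega

end Ok

open Finset

/-! ### Strassen's identity and its tensor powers -/

theorem sum_range_two_mul {M : Type*} [AddCommMonoid M] (f : ℕ → M) (n : ℕ) :
    ∑ i ∈ range (2 * n), f i = ∑ i ∈ range n, (f (2 * i) + f (2 * i + 1)) := by
  induction n with
  | zero => simp
  | succ n ih => rw [Nat.mul_succ, sum_range_succ, sum_range_succ, ih, sum_range_succ, add_assoc]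

theorem sum_range_mul' {M : Type*} [AddCommMonoid M] (f : ℕ → M) (m n : ℕ) :
    ∑ i ∈ range (m * n), f i = ∑ i ∈ range m, ∑ j ∈ range n, f (i * n + j) := by
  induction m with
  | zero => simp
  | succ m ih => rw [Nat.succ_mul, sum_range_add, ih, sum_range_succ]

/-- The coefficients of Strassen's algorithm: seven linear forms in the entries of each of three
matrices of size two. -/
def strassenCoeff (i : ℕ) : ℤ :=
  [1, 0, 0, 1, 0, 0, 1, 1, 1, 0, 0, 0, 0, 0, 0, 1, 1, 1, 0, 0, -1, 0, 1, 0, 0, 1, 0, -1,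
   1, 0, 0, 1, 1, 0, 0, 0, 0, 1, 0, -1, -1, 0, 1, 0, 0, 0, 0, 1, 1, 1, 0, 0, 0, 0, 1, 1,
   1, 0, 0, 1, 0, 1, 0, -1, 0, 0, 1, 1, 1, 1, 0, 0, -1, 0, 1, 0, 0, 0, 0, 1, 1, 0, 0, 0].getD i 0

/-- The ternary digits of this number encode the coefficients, with `2` for `-1`. -/
def strassenCode : ℕ := 197327490171480234134783078072828531212

theorem strassenCode_digit : ∀ i < 84, strassenCoeff i =
    ((strassenCode / 3 ^ i % 3 % 2 : ℕ) : ℤ) - ((strassenCode / 3 ^ i % 3 / 2 : ℕ) : ℤ) := by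
  decide +kernel

/-- The right side is the trace of a product of three matrices of size two. In this trilinear form
the output of Strassen's algorithm becomes a third input, so three transforms of the same shape
suffice and no product matrix has to be assembled. -/
theorem strassen_identity {R : Type*} [CommRing R] (x y z : ℕ → R) :
    ∑ ρ ∈ range 7, (∑ κ ∈ range 4, (strassenCoeff (4 * ρ + κ) : R) * x κ) *
        (∑ κ ∈ range 4, (strassenCoeff (28 + (4 * ρ + κ)) : R) * y κ) *
        (∑ κ ∈ range 4, (strassenCoeff (56 + (4 * ρ + κ)) : R) * z κ) =
      ((x 0 * y 0 * z 0 + x 0 * y 1 * z 2) + (x 1 * y 2 * z 0 + x 1 * y 3 * z 2)) +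
      ((x 2 * y 0 * z 1 + x 2 * y 1 * z 3) + (x 3 * y 2 * z 1 + x 3 * y 3 * z 3)) := by
  simp only [sum_range_succ, sum_range_zero, strassenCoeff]
  norm_num
  ring

/-- Interleaving of the `k` lowest binary digits of `i` and `j`. -/
def mort : ℕ → ℕ → ℕ → ℕ
  | 0, _, _ => 0
  | k + 1, i, j => 4 * mort k (i / 2) (j / 2) + (2 * (i % 2) + j % 2)

/-- The digits of `q` in odd positions. -/
def mrow (q : ℕ) : ℕ := if h : q = 0 then 0 else 2 * mrow (q / 4) + q % 4 / 2
  decreasing_by omega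

/-- The digits of `q` in even positions. -/
def mcol (q : ℕ) : ℕ := if h : q = 0 then 0 else 2 * mcol (q / 4) + q % 2
  decreasing_by omega

theorem mrow_eq (q : ℕ) : mrow q = 2 * mrow (q / 4) + q % 4 / 2 := by
  by_cases h : q = 0
  · subst h; simp [mrow]
  · conv_lhs => rw [mrow]
    simp [h]

theorem mcol_eq (q : ℕ) : mcol q = 2 * mcol (q / 4) + q % 2 := by
  by_cases h : q = 0
  · subst h; simp [mcol]
  · conv_lhs => rw [mcol]
    simp [h]

theorem mrow_mort {k i : ℕ} (hi : i < 2 ^ k) (j : ℕ) : mrow (mort k i j) = i := by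
  induction k generalizing i j with
  | zero => simp only [pow_zero, Nat.lt_one_iff] at hi; simp [mort, mrow, hi]
  | succ k ih =>
    rw [pow_succ] at hi
    have := ih (i := i / 2) (by omega) (j / 2)
    rw [mort, mrow_eq, show (4 * mort k (i / 2) (j / 2) + (2 * (i % 2) + j % 2)) / 4 =
      mort k (i / 2) (j / 2) by omega, this]
    omega

theorem mcol_mort {k j : ℕ} (i : ℕ) (hj : j < 2 ^ k) : mcol (mort k i j) = j := by
  induction k generalizing i j with
  | zero => simp only [pow_zero, Nat.lt_one_iff] at hj; simp [mort, mcol, hj]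
  | succ k ih =>
    rw [pow_succ] at hj
    have := ih (j := j / 2) (i / 2) (by omega)
    rw [mort, mcol_eq, show (4 * mort k (i / 2) (j / 2) + (2 * (i % 2) + j % 2)) / 4 =
      mort k (i / 2) (j / 2) by omega, this]
    omega

theorem mrow_lt {k q : ℕ} (hq : q < 4 ^ k) : mrow q < 2 ^ k := by
  induction k generalizing q with
  | zero => simp only [pow_zero, Nat.lt_one_iff] at hq; simp [hq, mrow]
  | succ k ih =>
    rw [pow_succ] at hq
    have := ih (q := q / 4) (by omega)
    rw [mrow_eq, pow_succ]; omega

theorem mcol_lt {k q : ℕ} (hq : q < 4 ^ k) : mcol q < 2 ^ k := by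
  induction k generalizing q with
  | zero => simp only [pow_zero, Nat.lt_one_iff] at hq; simp [hq, mcol]
  | succ k ih =>
    rw [pow_succ] at hq
    have := ih (q := q / 4) (by omega)
    rw [mcol_eq, pow_succ]; omega

/-! ### Traces of triple products by the fast transform -/

section Trilinear

variable {R : Type*} [CommRing R]

/-- The trace of the product of three matrices of size `2 ^ k` stored in interleaved order. -/
def tri (k : ℕ) (a b c : ℕ → R) : R :=
  ∑ i ∈ range (2 ^ k), ∑ j ∈ range (2 ^ k), ∑ t ∈ range (2 ^ k),
    a (mort k i j) * b (mort k j t) * c (mort k t i)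

/-- Splitting off the lowest bit of each of the three indices leaves matrices of size two, and by
the interleaving the two lowest bits of a cell are its last digit in base four. Strassen's identity
is applied to that digit with all higher digits fixed. -/
theorem tri_succ (k : ℕ) (a b c : ℕ → R) : tri (k + 1) a b c =
    ∑ ρ ∈ range 7, tri k
      (fun Q => ∑ κ ∈ range 4, (strassenCoeff (4 * ρ + κ) : R) * a (4 * Q + κ))
      (fun Q => ∑ κ ∈ range 4, (strassenCoeff (28 + (4 * ρ + κ)) : R) * b (4 * Q + κ))
      (fun Q => ∑ κ ∈ range 4, (strassenCoeff (56 + (4 * ρ + κ)) : R) * c (4 * Q + κ)) := by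
  unfold tri
  symm
  rw [sum_comm]
  simp only [pow_succ, mul_comm _ 2, sum_range_two_mul]
  refine sum_congr rfl fun i _ => ?_
  rw [sum_comm, ← sum_add_distrib]
  refine sum_congr rfl fun j _ => ?_
  rw [sum_comm, ← sum_add_distrib, ← sum_add_distrib, ← sum_add_distrib]
  refine sum_congr rfl fun t _ => ?_
  rw [strassen_identity (fun κ => a (4 * mort k i j + κ)) (fun κ => b (4 * mort k j t + κ))
    (fun κ => c (4 * mort k t i + κ))]
  have e1 : ∀ i : ℕ, (2 * i + 1) / 2 = i := fun i => by omega
  have e2 : ∀ i : ℕ, (2 * i + 1) % 2 = 1 := fun i => by omega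
  simp only [mort, e1, e2, Nat.mul_mod_right, Nat.mul_div_cancel_left _ (Nat.succ_pos 1),
    mul_zero, mul_one, add_zero, zero_add]

/-- One round of the fast transform: the lowest digit in base `4` of the part of the index above
`W` is replaced by a digit in base `7`. -/
def yatesStep (co : ℕ → R) (W : ℕ) (a : ℕ → R) (u : ℕ) : R :=
  ∑ κ ∈ range 4, co (4 * (u / W % 7) + κ) * a ((4 * (u / W / 7) + κ) * W + u % W)

/-- An index `q * W + r` consists of untransformed digits `q` in base four and of the part `r` that
is already in base seven. One round moves the lowest digit of `q`, converted to base seven, to the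
top of `r`. -/
theorem sum_tri_succ (k W : ℕ) (a b c : ℕ → R) :
    ∑ r ∈ range W, tri (k + 1) (fun q => a (q * W + r)) (fun q => b (q * W + r))
        (fun q => c (q * W + r)) =
      ∑ r ∈ range (7 * W), tri k
        (fun q => yatesStep (fun i => (strassenCoeff i : R)) W a (q * (7 * W) + r))
        (fun q => yatesStep (fun i => (strassenCoeff (28 + i) : R)) W b (q * (7 * W) + r))
        (fun q => yatesStep (fun i => (strassenCoeff (56 + i) : R)) W c (q * (7 * W) + r)) := by
  rw [sum_range_mul', sum_comm]
  refine sum_congr rfl fun r hr => ?_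
  rw [tri_succ]
  refine sum_congr rfl fun ρ hρ => ?_
  rw [mem_range] at hr hρ
  have hW : 0 < W := by omega
  have key : ∀ (co : ℕ → R) (a : ℕ → R), (fun q => yatesStep co W a (q * (7 * W) + (ρ * W + r))) =
      fun Q => ∑ κ ∈ range 4, co (4 * ρ + κ) * a ((4 * Q + κ) * W + r) := by
    intro co a
    funext q
    have e0 : q * (7 * W) + (ρ * W + r) = r + W * (7 * q + ρ) := by ring
    have e1 : (q * (7 * W) + (ρ * W + r)) / W = 7 * q + ρ := by
      rw [e0, Nat.add_mul_div_left _ _ hW, Nat.div_eq_of_lt hr, zero_add]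
    have e2 : (q * (7 * W) + (ρ * W + r)) % W = r := by
      rw [e0, Nat.add_mul_mod_self_left, Nat.mod_eq_of_lt hr]
    unfold yatesStep
    rw [e1, e2, show (7 * q + ρ) % 7 = ρ by omega, show (7 * q + ρ) / 7 = q by omega]
  rw [key, key, key]

/-- The fast transform after `l` rounds. -/
def yates (co : ℕ → R) (a : ℕ → R) : ℕ → ℕ → R
  | 0 => a
  | l + 1 => yatesStep co (7 ^ l) (yates co a l)

theorem tri_eq_sum_yates (d : ℕ) (a b c : ℕ → R) : tri d a b c =
    ∑ r ∈ range (7 ^ d), yates (fun i => (strassenCoeff i : R)) a d r *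
      yates (fun i => (strassenCoeff (28 + i) : R)) b d r *
      yates (fun i => (strassenCoeff (56 + i) : R)) c d r := by
  have key : ∀ l ≤ d, tri d a b c = ∑ r ∈ range (7 ^ l), tri (d - l)
      (fun q => yates (fun i => (strassenCoeff i : R)) a l (q * 7 ^ l + r))
      (fun q => yates (fun i => (strassenCoeff (28 + i) : R)) b l (q * 7 ^ l + r))
      (fun q => yates (fun i => (strassenCoeff (56 + i) : R)) c l (q * 7 ^ l + r)) := by
    intro l
    induction l with
    | zero => intro _; simp [yates]
    | succ l ih =>
      intro hl
      rw [ih (by omega), show d - l = d - (l + 1) + 1 by omega, sum_tri_succ, pow_succ, mul_comm]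
      rfl
  rw [key d le_rfl]
  simp [tri, mort]

end Trilinear

/-- The number of triples below `2 ^ d` for which the sum of the three exponents vanishes modulo
`p` can be read off a sum of powers of `X` modulo `X ^ p - 1`. -/
theorem count_of_tri {d p X z : ℕ} (hp : 0 < p) (hX : X = 3 * 8 ^ d) (e₁ e₂ e₃ : ℕ → ℕ → ℕ)
    (hz : z < X ^ p - 1) (h : (z : ZMod (X ^ p - 1)) = tri d
      (fun q => ((X ^ e₁ (mrow q) (mcol q) : ℕ) : ZMod (X ^ p - 1)))
      (fun q => ((X ^ e₂ (mrow q) (mcol q) : ℕ) : ZMod (X ^ p - 1)))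
      (fun q => ((X ^ e₃ (mrow q) (mcol q) : ℕ) : ZMod (X ^ p - 1)))) :
    z % X = #{w ∈ range (8 ^ d) | (e₁ (w / (2 ^ d * 2 ^ d)) (w / 2 ^ d % 2 ^ d) +
      e₂ (w / 2 ^ d % 2 ^ d) (w % 2 ^ d) + e₃ (w % 2 ^ d) (w / (2 ^ d * 2 ^ d))) % p = 0} := by
  set s := 2 ^ d with hs
  have hspos : 0 < s := by positivity
  have hs8 : s * (s * s) = 8 ^ d := by
    rw [hs, ← mul_pow, ← mul_pow]; norm_num
  set E : ℕ → ℕ := fun w => e₁ (w / (s * s)) (w / s % s) + e₂ (w / s % s) (w % s) +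
    e₃ (w % s) (w / (s * s)) with hE
  have h8 : 1 ≤ 8 ^ d := Nat.one_le_pow _ _ (by norm_num)
  have hX3 : 3 ≤ X := by omega
  have hXp : X ≤ X ^ p := by
    calc X = X ^ 1 := (pow_one X).symm
      _ ≤ X ^ p := Nat.pow_le_pow_right (by omega) hp
  have hXM : ((X : ℕ) : ZMod (X ^ p - 1)) ^ p = 1 := by
    have : ((X ^ p - 1 : ℕ) : ZMod (X ^ p - 1)) = 0 := ZMod.natCast_self _
    rw [Nat.cast_sub (by omega), Nat.cast_pow, Nat.cast_one, sub_eq_zero] at this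
    exact this
  -- Since `X ^ p = 1` in this ring, exponents matter only modulo `p`.
  have hmod : ∀ e : ℕ, ((X : ℕ) : ZMod (X ^ p - 1)) ^ e = (X : ZMod (X ^ p - 1)) ^ (e % p) := by
    intro e
    conv_lhs => rw [← Nat.div_add_mod e p, pow_add, pow_mul, hXM, one_pow, one_mul]
  have hsum : (z : ZMod (X ^ p - 1)) = ((∑ w ∈ range (8 ^ d), X ^ (E w % p) : ℕ) :
      ZMod (X ^ p - 1)) := by
    rw [h, ← hs8, sum_range_mul']
    push_cast
    unfold tri
    refine sum_congr rfl fun i hi => ?_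
    rw [sum_range_mul']
    refine sum_congr rfl fun j hj => ?_
    refine sum_congr rfl fun t ht => ?_
    rw [mem_range] at hi hj ht
    beta_reduce
    rw [mrow_mort hi, mcol_mort _ hj, mrow_mort hj, mcol_mort _ ht, mrow_mort ht, mcol_mort _ hi,
      ← pow_add, ← pow_add, hmod]
    have hlt : j * s + t < s * s := by nlinarith
    have w1 : (i * (s * s) + (j * s + t)) / (s * s) = i := by
      rw [mul_comm, Nat.mul_add_div (by positivity), Nat.div_eq_of_lt hlt, add_zero]
    have w2 : (i * (s * s) + (j * s + t)) / s = i * s + j := by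
      rw [show i * (s * s) + (j * s + t) = s * (i * s + j) + t by ring,
        Nat.mul_add_div hspos, Nat.div_eq_of_lt ht, add_zero]
    have w3 : (i * (s * s) + (j * s + t)) % s = t := by
      rw [show i * (s * s) + (j * s + t) = s * (i * s + j) + t by ring,
        Nat.mul_add_mod, Nat.mod_eq_of_lt ht]
    have w4 : (i * s + j) % s = j := by
      rw [mul_comm, Nat.mul_add_mod, Nat.mod_eq_of_lt hj]
    simp only [hE, w1, w2, w3, w4]
  -- The sum is at most a third of `X ^ p`, owing to the factor 3 in `X`. So the residue `z` is this
  -- sum itself, and no information is lost modulo `X ^ p - 1`.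
  have hlt : ∑ w ∈ range (8 ^ d), X ^ (E w % p) < X ^ p - 1 := by
    have h1 : ∑ w ∈ range (8 ^ d), X ^ (E w % p) ≤ 8 ^ d * X ^ (p - 1) := by
      calc _ ≤ ∑ w ∈ range (8 ^ d), X ^ (p - 1) := sum_le_sum fun w _ =>
            Nat.pow_le_pow_right (by omega) (by have := Nat.mod_lt (E w) hp; omega)
        _ = _ := by simp
    have h2 : 3 * (8 ^ d * X ^ (p - 1)) = X ^ p := by
      rw [← mul_assoc, ← hX, ← pow_succ', Nat.sub_add_cancel hp]
    have h3 : 1 ≤ 8 ^ d * X ^ (p - 1) := Nat.mul_pos h8 (Nat.pow_pos (by omega))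
    omega
  have hz' : z = ∑ w ∈ range (8 ^ d), X ^ (E w % p) := by
    rw [ZMod.natCast_eq_natCast_iff] at hsum
    exact Nat.ModEq.eq_of_lt_of_lt hsum hz hlt
  -- Modulo `X` only the terms with exponent zero survive, and there are fewer than `X` of them.
  have hterm : ∀ w, X ^ (E w % p) ≡ (if E w % p = 0 then 1 else 0) [MOD X] := by
    intro w
    split_ifs with h0
    · rw [h0, pow_zero]
    · exact (Nat.modEq_zero_iff_dvd).2 (dvd_pow_self X h0)
  have hcast : z ≡ #{w ∈ range (8 ^ d) | E w % p = 0} [MOD X] := by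
    rw [hz', card_filter]
    exact Nat.ModEq.sum fun w _ => hterm w
  have hcard : #{w ∈ range (8 ^ d) | E w % p = 0} < X := by
    have := card_filter_le (range (8 ^ d)) (fun w => E w % p = 0)
    rw [card_range] at this
    omega
  have := hcast
  rw [Nat.ModEq, Nat.mod_eq_of_lt hcard] at this
  exact this

/-! ### From inequalities to equations modulo `p` -/

/-- Division rounding up. -/
def cdiv (x h : ℕ) : ℕ := (x + (h - 1)) / h

theorem cdiv_step (x h : ℕ) (hh : 0 < h) : 2 * cdiv x (2 * h) ≤ cdiv x h + 1 := by
  unfold cdiv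
  have h1 : 2 * h * ((x + (2 * h - 1)) / (2 * h)) ≤ x + (2 * h - 1) := Nat.mul_div_le _ _
  set q := (x + (2 * h - 1)) / (2 * h)
  rcases Nat.eq_zero_or_pos q with h0 | hq
  · rw [h0]; exact Nat.zero_le _
  · have : 2 * q - 1 ≤ (x + (h - 1)) / h := by
      rw [Nat.le_div_iff_mul_le hh]
      obtain ⟨r, hr⟩ : ∃ r, 2 * q = r + 1 := ⟨2 * q - 1, by omega⟩
      have : 2 * h * q = r * h + h := by rw [mul_assoc, mul_comm h q, ← mul_assoc, hr]; ring
      rw [hr, Nat.add_sub_cancel]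
      omega
    omega

/-- Rounding down on the left and up on the right preserves the inequality. Therefore a valid triple
solves none of the equations over the integers, and its solutions modulo `p` are only false
positives. -/
theorem div_le_cdiv_add_cdiv {x y z h : ℕ} (hh : 0 < h) (hz : z ≤ x + y) :
    z / h ≤ cdiv x h + cdiv y h := by
  have key : ∀ x, x ≤ h * cdiv x h := by
    intro x
    unfold cdiv
    have := Nat.lt_mul_div_succ (x + (h - 1)) hh
    rw [mul_add, mul_one] at this
    omega
  have h1 := key x
  have h2 := key y
  calc z / h ≤ (h * (cdiv x h + cdiv y h)) / h := Nat.div_le_div_right (by rw [mul_add]; omega)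
    _ = _ := Nat.mul_div_cancel_left _ hh

/-- An inequality between `z` and `x + y` is violated only if one of finitely many equations
between roundings of the three numbers holds. -/
theorem le_add_of_levels {x y z L : ℕ} (hz : z < 2 ^ L)
    (h : ∀ l < L, ∀ v < 3, z / 2 ^ l ≠ cdiv x (2 ^ l) + cdiv y (2 ^ l) + (v + 1)) : z ≤ x + y := by
  -- Descent from the coarsest scale, where the left side is zero. Halving the unit at most doubles
  -- the left side plus one, while each rounded summand on the right at least doubles minus one; so
  -- the excess is at most three, and the values one to three are excluded by `h`.
  have key : ∀ k ≤ L, z / 2 ^ (L - k) ≤ cdiv x (2 ^ (L - k)) + cdiv y (2 ^ (L - k)) := by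
    intro k
    induction k with
    | zero => intro _; rw [Nat.sub_zero, Nat.div_eq_of_lt hz]; exact Nat.zero_le _
    | succ k ih =>
      intro hk
      have h1 := ih (by omega)
      have hpos : 0 < 2 ^ (L - (k + 1)) := by positivity
      have e : 2 ^ (L - k) = 2 * 2 ^ (L - (k + 1)) := by
        rw [← pow_succ']; congr 1; omega
      rw [e] at h1
      have h2 := cdiv_step x _ hpos
      have h3 := cdiv_step y _ hpos
      have h4 : z / 2 ^ (L - (k + 1)) ≤ 2 * (z / (2 * 2 ^ (L - (k + 1)))) + 1 := by
        rw [mul_comm 2 (2 ^ _), ← Nat.div_div_eq_div_mul]; omega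
      have n1 := h (L - (k + 1)) (by omega) 0 (by omega)
      have n2 := h (L - (k + 1)) (by omega) 1 (by omega)
      have n3 := h (L - (k + 1)) (by omega) 2 (by omega)
      omega
  have := key L le_rfl
  simpa [cdiv] using this

/-- The multiple `p - 1` stands for minus one, so that all exponents are natural numbers. -/
theorem residue_of_eq {p cx cy v z : ℕ} (hp : 0 < p) (h : z = cx + cy + v) :
    (cx + (v + (p - 1) * z) + cy) % p = 0 := by
  obtain ⟨r, rfl⟩ : ∃ r, p = r + 1 := ⟨p - 1, by omega⟩
  rw [Nat.add_sub_cancel, show cx + (v + r * z) + cy = (r + 1) * z by rw [add_mul, one_mul]; omega]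
  exact Nat.mul_mod_right _ _

theorem dvd_of_residue {p cx cy v z : ℕ} (hp : 0 < p) (hz : z ≤ cx + cy)
    (h : (cx + (v + (p - 1) * z) + cy) % p = 0) : p ∣ cx + cy + v - z := by
  obtain ⟨r, rfl⟩ : ∃ r, p = r + 1 := ⟨p - 1, by omega⟩
  rw [Nat.add_sub_cancel] at h
  have e : cx + (v + r * z) + cy = (cx + cy + v - z) + (r + 1) * z := by
    rw [add_mul, one_mul]; omega
  rw [e, Nat.add_mul_mod_self_left] at h
  exact Nat.dvd_of_mod_eq_zero h

/-! ### The fast transform with natural numbers -/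

/-- The coefficients of Strassen's algorithm modulo `M`. -/
def strassenMod (M i : ℕ) : ℕ :=
  strassenCode / 3 ^ i % 3 % 2 + strassenCode / 3 ^ i % 3 / 2 * (M - 1)

theorem cast_strassenMod {M i : ℕ} (hM : 0 < M) (hi : i < 84) :
    (strassenMod M i : ZMod M) = ((strassenCoeff i : ℤ) : ZMod M) := by
  rw [strassenCode_digit i hi, strassenMod]
  have : ((M : ℕ) : ZMod M) = 0 := ZMod.natCast_self _
  generalize strassenCode / 3 ^ i % 3 % 2 = u
  generalize strassenCode / 3 ^ i % 3 / 2 = u'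
  push_cast [Nat.cast_sub hM, this]
  ring

theorem strassenMod_le {M i : ℕ} (hM : 2 ≤ M) : strassenMod M i ≤ M := by
  unfold strassenMod
  set q := strassenCode / 3 ^ i % 3 with hq
  have : q < 3 := Nat.mod_lt _ (by norm_num)
  interval_cases q <;> omega

def yatesModStep (M : ℕ) (co : ℕ → ℕ) (W : ℕ) (a : ℕ → ℕ) (u : ℕ) : ℕ :=
  (co (4 * (u / W % 7) + 0) * a ((4 * (u / W / 7) + 0) * W + u % W) +
    co (4 * (u / W % 7) + 1) * a ((4 * (u / W / 7) + 1) * W + u % W) +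
    co (4 * (u / W % 7) + 2) * a ((4 * (u / W / 7) + 2) * W + u % W) +
    co (4 * (u / W % 7) + 3) * a ((4 * (u / W / 7) + 3) * W + u % W)) % M

def yatesMod (M : ℕ) (co : ℕ → ℕ) (a : ℕ → ℕ) : ℕ → ℕ → ℕ
  | 0 => a
  | l + 1 => yatesModStep M co (7 ^ l) (yatesMod M co a l)

theorem cast_yatesMod {M o : ℕ} (hM : 0 < M) (ho : o + 28 ≤ 84) (a : ℕ → ℕ) (l u : ℕ) :
    (yatesMod M (fun i => strassenMod M (o + i)) a l u : ZMod M) =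
      yates (fun i => ((strassenCoeff (o + i) : ℤ) : ZMod M)) (fun q => (a q : ZMod M)) l u := by
  induction l generalizing u with
  | zero => rfl
  | succ l ih =>
    have hlt : u / 7 ^ l % 7 < 7 := Nat.mod_lt _ (by norm_num)
    rw [yatesMod, yatesModStep, ZMod.natCast_mod, yates, yatesStep]
    simp only [sum_range_succ, sum_range_zero, zero_add]
    push_cast
    rw [cast_strassenMod hM (by omega), cast_strassenMod hM (by omega),
      cast_strassenMod hM (by omega), cast_strassenMod hM (by omega), ih, ih, ih, ih]

/-- The remainder modulo `M` of the sum of the first `r` products. -/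
def sumMod (M : ℕ) (a b c : ℕ → ℕ) : ℕ → ℕ
  | 0 => 0
  | r + 1 => (sumMod M a b c r + a r * b r * c r) % M

theorem cast_sumMod (M : ℕ) (a b c : ℕ → ℕ) (r : ℕ) :
    (sumMod M a b c r : ZMod M) = ∑ i ∈ range r, (a i : ZMod M) * b i * c i := by
  induction r with
  | zero => simp [sumMod]
  | succ r ih => rw [sumMod, ZMod.natCast_mod, sum_range_succ, ← ih]; push_cast; ring

theorem sumMod_lt {M : ℕ} (hM : 0 < M) (a b c : ℕ → ℕ) (r : ℕ) : sumMod M a b c r < M := by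
  cases r with
  | zero => exact hM
  | succ r => exact Nat.mod_lt _ hM

/-- Counting the triples with vanishing sum of exponents by the fast transform. -/
theorem sumMod_yatesMod {d p X : ℕ} (hp : 0 < p) (hX : X = 3 * 8 ^ d) (e₁ e₂ e₃ : ℕ → ℕ → ℕ)
    {M : ℕ} (hM : M = X ^ p - 1) :
    sumMod M
      (yatesMod M (fun i => strassenMod M (0 + i)) (fun q => X ^ e₁ (mrow q) (mcol q)) d)
      (yatesMod M (fun i => strassenMod M (28 + i)) (fun q => X ^ e₂ (mrow q) (mcol q)) d)
      (yatesMod M (fun i => strassenMod M (56 + i)) (fun q => X ^ e₃ (mrow q) (mcol q)) d)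
      (7 ^ d) % X =
    #{w ∈ range (8 ^ d) | (e₁ (w / (2 ^ d * 2 ^ d)) (w / 2 ^ d % 2 ^ d) +
      e₂ (w / 2 ^ d % 2 ^ d) (w % 2 ^ d) + e₃ (w % 2 ^ d) (w / (2 ^ d * 2 ^ d))) % p = 0} := by
  have h8 : 1 ≤ 8 ^ d := Nat.one_le_pow _ _ (by norm_num)
  have hXp : X ≤ X ^ p := by
    calc X = X ^ 1 := (pow_one X).symm
      _ ≤ X ^ p := Nat.pow_le_pow_right (by omega) hp
  have hM0 : 0 < M := by omega
  subst hM
  refine count_of_tri hp hX e₁ e₂ e₃ (sumMod_lt hM0 _ _ _ _) ?_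
  rw [cast_sumMod, tri_eq_sum_yates]
  refine sum_congr rfl fun r _ => ?_
  rw [cast_yatesMod hM0 (by norm_num), cast_yatesMod hM0 (by norm_num),
    cast_yatesMod hM0 (by norm_num)]
  simp only [zero_add]

infixr:60 " ;; " => Stmt.seq

open ViterbiNTIME.Expr ViterbiNTIME.Stmt

/-- The step of the fast transform of the array `arr` that computes one cell. -/
def yatesCell (arr o : ℕ) : Stmt :=
  .put arr ((.var 60 + 1) * .var 10 + .var 64)
    ((.get 4 (.lit o + (4 * (.var 64 / .var 63 % 7) + 0)) *
          .get arr (.var 60 * .var 10 +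
            ((4 * (.var 64 / .var 63 / 7) + 0) * .var 63 + .var 64 % .var 63)) +
        .get 4 (.lit o + (4 * (.var 64 / .var 63 % 7) + 1)) *
          .get arr (.var 60 * .var 10 +
            ((4 * (.var 64 / .var 63 / 7) + 1) * .var 63 + .var 64 % .var 63)) +
        .get 4 (.lit o + (4 * (.var 64 / .var 63 % 7) + 2)) *
          .get arr (.var 60 * .var 10 +
            ((4 * (.var 64 / .var 63 / 7) + 2) * .var 63 + .var 64 % .var 63)) +
        .get 4 (.lit o + (4 * (.var 64 / .var 63 % 7) + 3)) *
          .get arr (.var 60 * .var 10 +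
            ((4 * (.var 64 / .var 63 / 7) + 3) * .var 63 + .var 64 % .var 63))) % .var 12)

/-- One round of the fast transform. -/
def yatesRound (arr o : ℕ) : Stmt :=
  .set 62 (.var 62 / 4) ;;
  .for 64 65 (.var 62 * (7 * .var 63)) (yatesCell arr o) ;;
  .set 63 (7 * .var 63)

/-- The fast transform of the array `arr`, with the coefficients that start at index `o` of array
`4`. Round `l` fills the cells from index `l * 7 ^ d` on. -/
def yatesProg (arr o : ℕ) : Stmt :=
  (.set 62 (.var 9) ;; .set 63 1) ;; .for 60 61 (.var 6) (yatesRound arr o)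

/-- After `l` rounds the transform has this many cells, so consecutive rounds fit into consecutive
stripes of length `7 ^ d`. -/
theorem four_pow_mul_seven_pow_le {k l d : ℕ} (h : k + l = d) : 4 ^ k * 7 ^ l ≤ 7 ^ d := by
  subst h
  rw [pow_add]
  exact Nat.mul_le_mul_right _ (Nat.pow_le_pow_left (by norm_num) _)

theorem yatesMod_lt {M : ℕ} (hM : 0 < M) {co a : ℕ → ℕ} {d B : ℕ} (hMB : M < 2 ^ B)
    (ha : ∀ q < 4 ^ d, a q < 2 ^ B) (l u : ℕ) (hu : u < 4 ^ (d - l) * 7 ^ l) :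
    yatesMod M co a l u < 2 ^ B := by
  cases l with
  | zero => exact ha u (by simpa using hu)
  | succ l => exact (Nat.mod_lt _ hM).trans hMB

/-! ### Correctness of the transform program -/

section Yates

variable {arr o : ℕ} {m : Bool} {s : State} {d M B : ℕ} {a : ℕ → ℕ}

/-- The values that the fast transform reads. -/
structure YatesEnv (o d M : ℕ) (s : State) : Prop where
  h6 : s.reg 6 = d
  h9 : s.reg 9 = 4 ^ d
  h10 : s.reg 10 = 7 ^ d
  h12 : s.reg 12 = M
  hco : ∀ i < 84, s.mem 4 i = strassenMod M i
  ho : o + 28 ≤ 84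
  hM : 2 ≤ M

theorem YatesEnv.of_agree {vs ks : List ℕ} {s s' : State} (h : YatesEnv o d M s)
    (hag : AgreeOff vs ks s s') (hv : ∀ x ∈ vs, 60 ≤ x) (hk : 4 ∉ ks) : YatesEnv o d M s' := by
  have g : ∀ x < 60, s'.reg x = s.reg x := fun x hx => hag.1 x fun h' => by
    have := hv x h'; omega
  exact ⟨(g 6 (by norm_num)).trans h.h6, (g 9 (by norm_num)).trans h.h9,
    (g 10 (by norm_num)).trans h.h10, (g 12 (by norm_num)).trans h.h12,
    by rw [hag.2 4 hk]; exact h.hco, h.ho, h.hM⟩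

theorem yatesCell_ok {l u : ℕ} (E : YatesEnv o d M s) (hl : l < d) (h60 : s.reg 60 = l)
    (h63 : s.reg 63 = 7 ^ l) (h64 : s.reg 64 = u) (hu : u < 4 ^ (d - (l + 1)) * 7 ^ (l + 1))
    (hY : ∀ u < 4 ^ (d - l) * 7 ^ l, s.mem arr (l * 7 ^ d + u) =
      yatesMod M (fun i => strassenMod M (o + i)) a l u)
    (hB : m = true → 7 ^ d < 2 ^ B ∧ M < 2 ^ B ∧ ∀ q < 4 ^ d, a q < 2 ^ B) :
    Ok m (yatesCell arr o) s (fun s' => s' = s.setMem arr ((l + 1) * 7 ^ d + u)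
      (yatesMod M (fun i => strassenMod M (o + i)) a (l + 1) u)) B 1 := by
  obtain ⟨-, -, h10, h12, hco, ho, hM⟩ := E
  set Y := yatesMod M (fun i => strassenMod M (o + i)) a with hYdef
  have e4 : 4 ^ (d - l) = 4 * 4 ^ (d - (l + 1)) := by
    rw [← pow_succ']; congr 1; omega
  have hd7 : d < 7 ^ d := Nat.lt_pow_self (by norm_num)
  have hW : 7 ^ l ≤ 7 ^ d := Nat.pow_le_pow_right (by norm_num) (by omega)
  have hN : 4 ^ (d - (l + 1)) * 7 ^ (l + 1) ≤ 7 ^ d := four_pow_mul_seven_pow_le (by omega)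
  have hlt7 : u / 7 ^ l % 7 < 7 := Nat.mod_lt _ (by norm_num)
  have hr : u % 7 ^ l < 7 ^ l := Nat.mod_lt _ (by positivity)
  have hQ : u / 7 ^ l / 7 < 4 ^ (d - (l + 1)) := by
    rw [Nat.div_div_eq_div_mul, ← pow_succ]
    exact Nat.div_lt_of_lt_mul (by rwa [mul_comm])
  -- The four cells that are read lie in the part of stripe `l` that the previous round has filled.
  have hidx : ∀ κ < 4, (4 * (u / 7 ^ l / 7) + κ) * 7 ^ l + u % 7 ^ l < 4 ^ (d - l) * 7 ^ l := by
    intro κ hκ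
    rw [e4]
    have : (4 * (u / 7 ^ l / 7) + κ) + 1 ≤ 4 * 4 ^ (d - (l + 1)) := by omega
    have := Nat.mul_le_mul_right (7 ^ l) this
    rw [Nat.add_mul _ 1, one_mul] at this
    omega
  have gc : ∀ κ < 4, s.mem 4 (o + (4 * (u / 7 ^ l % 7) + κ)) =
    strassenMod M (o + (4 * (u / 7 ^ l % 7) + κ)) := fun κ hκ => hco _ (by omega)
  have gm : ∀ κ < 4, s.mem arr (l * 7 ^ d + ((4 * (u / 7 ^ l / 7) + κ) * 7 ^ l + u % 7 ^ l)) =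
    Y l ((4 * (u / 7 ^ l / 7) + κ) * 7 ^ l + u % 7 ^ l) := fun κ hκ => hY _ (hidx κ hκ)
  have gY : ∀ κ < 4, m = true → Y l ((4 * (u / 7 ^ l / 7) + κ) * 7 ^ l + u % 7 ^ l) < 2 ^ B :=
    fun κ hκ hm => yatesMod_lt (by omega) (hB hm).2.1 (hB hm).2.2 _ _ (hidx κ hκ)
  have gM : ∀ κ < 4, m = true → strassenMod M (o + (4 * (u / 7 ^ l % 7) + κ)) < 2 ^ B :=
    fun κ hκ hm => (strassenMod_le hM).trans_lt (hB hm).2.1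
  refine Ok.wp ⟨fun hm => ?_, ?_⟩ fun _ => le_rfl
  · have hb := hB hm
    have b1 : l < 2 ^ B := by omega
    have b2 : u < 2 ^ B := by omega
    have b3 : 7 ^ l < 2 ^ B := by omega
    simp only [Small_add, Small_mul, Small_var, Small_two, Small_three, Small_four, Small_seven, Small_get, Small_div,
      Small_mod, Small_lit, Small_one, Small_zero, eval_add, eval_mul, eval_var,
      eval_two, eval_three, eval_four, eval_seven, eval_div, eval_mod, eval_lit, eval_one, eval_zero, h10, h12, h60, h63,
      h64, gc 0 (by norm_num), gc 1 (by norm_num), gc 2 (by norm_num), gc 3 (by norm_num),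
      gm 0 (by norm_num), gm 1 (by norm_num), gm 2 (by norm_num), gm 3 (by norm_num),
      gM 0 (by norm_num) hm, gM 1 (by norm_num) hm, gM 2 (by norm_num) hm,
      gM 3 (by norm_num) hm, gY 0 (by norm_num) hm, gY 1 (by norm_num) hm,
      gY 2 (by norm_num) hm, gY 3 (by norm_num) hm, b1, b2, b3, hb.1, hb.2.1, and_self]
  · simp only [eval_mod, eval_get, eval_add, eval_mul, eval_div, eval_var, eval_two, eval_three, eval_four, eval_seven,
      eval_one, eval_zero, eval_lit, h10, h12, h60, h63, h64, gc 0 (by norm_num),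
      gc 1 (by norm_num), gc 2 (by norm_num), gc 3 (by norm_num), gm 0 (by norm_num),
      gm 1 (by norm_num), gm 2 (by norm_num), gm 3 (by norm_num)]
    rfl

theorem yatesRound_ok {l : ℕ} (E : YatesEnv o d M s) (harr : arr ≠ 4) (hl : l < d)
    (h60 : s.reg 60 = l) (h62 : s.reg 62 = 4 ^ (d - l)) (h63 : s.reg 63 = 7 ^ l)
    (hY : ∀ u < 4 ^ (d - l) * 7 ^ l, s.mem arr (l * 7 ^ d + u) =
      yatesMod M (fun i => strassenMod M (o + i)) a l u)
    (hB : m = true → 7 ^ d < 2 ^ B ∧ M < 2 ^ B ∧ ∀ q < 4 ^ d, a q < 2 ^ B) :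
    Ok m (yatesRound arr o) s (fun s' => s'.reg 62 = 4 ^ (d - (l + 1)) ∧
      s'.reg 63 = 7 ^ (l + 1) ∧ ∀ u < 4 ^ (d - (l + 1)) * 7 ^ (l + 1),
        s'.mem arr ((l + 1) * 7 ^ d + u) = yatesMod M (fun i => strassenMod M (o + i)) a (l + 1) u)
      B (7 ^ d + 1) := by
  have e4 : 4 ^ (d - l) = 4 * 4 ^ (d - (l + 1)) := by
    rw [← pow_succ']; congr 1; omega
  have hd7 : d < 7 ^ d := Nat.lt_pow_self (by norm_num)
  have h47 : 4 ^ d ≤ 7 ^ d := Nat.pow_le_pow_left (by norm_num) _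
  have h44 : 4 ^ (d - l) ≤ 4 ^ d := Nat.pow_le_pow_right (by norm_num) (by omega)
  have hW : 7 ^ l ≤ 7 ^ d := Nat.pow_le_pow_right (by norm_num) (by omega)
  have hN : 4 ^ (d - (l + 1)) * 7 ^ (l + 1) ≤ 7 ^ d := four_pow_mul_seven_pow_le (by omega)
  have hN' : 4 ^ (d - l) * 7 ^ l ≤ 7 ^ d := four_pow_mul_seven_pow_le (by omega)
  refine Ok.seq (n₁ := 1) (n₂ := 7 ^ d + 1) (P := fun s' => s'.reg 62 = 4 ^ (d - (l + 1)))
    (Ok.wp ⟨fun hm => ?_, ?_⟩ fun _ => le_rfl) (fun s₁ hs₁ j62 => ?_) (by omega)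
  · have := hB hm; simp [h62]; omega
  · simp [State.setReg_reg, h62]; omega
  have E₁ := E.of_agree hs₁ (by simp [Stmt.vars]) (by simp [Stmt.arrs])
  have q60 : s₁.reg 60 = l := by rw [hs₁.1 60 (by simp [Stmt.vars]), h60]
  have q63 : s₁.reg 63 = 7 ^ l := by rw [hs₁.1 63 (by simp [Stmt.vars]), h63]
  have qm : ∀ k, s₁.mem k = s.mem k := fun k => hs₁.2 k (by simp [Stmt.arrs])
  refine Ok.seq (n₁ := 7 ^ d + 1) (n₂ := 1)
    (P := fun s' => ∀ u < 4 ^ (d - (l + 1)) * 7 ^ (l + 1), s'.mem arr ((l + 1) * 7 ^ d + u) =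
      yatesMod M (fun i => strassenMod M (o + i)) a (l + 1) u)
    (Ok.mono (Ok.for (c := 1) (n := 7 ^ d + 1)
      (I := fun n s' => (∀ u < 4 ^ (d - l) * 7 ^ l, s'.mem arr (l * 7 ^ d + u) =
          yatesMod M (fun i => strassenMod M (o + i)) a l u) ∧
        ∀ u < n, s'.mem arr ((l + 1) * 7 ^ d + u) =
          yatesMod M (fun i => strassenMod M (o + i)) a (l + 1) u)
      (4 ^ (d - (l + 1)) * 7 ^ (l + 1)) (by simp [j62, q63, pow_succ', mul_comm]) (fun hm => ?_)
      (by simp [Stmt.vars, yatesCell]) ?_ ⟨by simpa [qm] using hY, by simp⟩ ?_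
      (fun _ => by omega)) (fun _ _ h => h.2) (fun _ => le_rfl))
    (fun s₂ hs₂ hY₂ => Ok.wp ⟨fun hm => ?_, ?_, ?_, ?_⟩ fun _ => le_rfl) (by omega)
  · have := hB hm
    simp only [Small_mul, Small_var, Small_two, Small_three, Small_four, Small_seven, j62, q63, true_and]
    omega
  · intro l s s' hag h
    simpa [hag.2] using h
  · intro u hu s₂ hs₂ k64 hI
    refine (yatesCell_ok (E₁.of_agree hs₂ (by simp [Stmt.vars, yatesCell])
      (by simp [Stmt.arrs, yatesCell, harr.symm])) hl
      (by rw [hs₂.1 60 (by simp [Stmt.vars, yatesCell]), q60])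
      (by rw [hs₂.1 63 (by simp [Stmt.vars, yatesCell]), q63]) k64 hu hI.1 hB).mono
      (fun s₃ _ h₃ => ?_) fun _ => le_rfl
    subst h₃
    refine ⟨fun u' hu' => ?_, fun u' hu' => ?_⟩
    -- Writing into stripe `l + 1` cannot damage stripe `l`, which occupies at most `7 ^ d` cells.
    · rw [State.setMem_mem, if_neg, hI.1 u' hu']
      rintro ⟨-, h⟩
      rw [add_mul, one_mul] at h
      omega
    · rw [State.setMem_mem]
      by_cases hu2 : u' = u
      · rw [hu2]; simp
      · rw [if_neg (by omega), hI.2 u' (by omega)]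
  · have := hB hm
    simp [hs₂.1, Stmt.vars, Stmt.for, yatesCell, q63]; omega
  · simp [State.setReg_reg, hs₂.1, Stmt.vars, Stmt.for, yatesCell, j62]
  · simp [State.setReg_reg, hs₂.1, Stmt.vars, Stmt.for, yatesCell, q63, pow_succ']
  · simpa using hY₂

theorem yatesProg_ok (E : YatesEnv o d M s) (harr : arr ≠ 4)
    (ha : ∀ q < 4 ^ d, s.mem arr q = a q)
    (hB : m = true → 7 ^ d < 2 ^ B ∧ M < 2 ^ B ∧ ∀ q < 4 ^ d, a q < 2 ^ B) :
    Ok m (yatesProg arr o) s (fun s' => ∀ u < 7 ^ d, s'.mem arr (d * 7 ^ d + u) =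
      yatesMod M (fun i => strassenMod M (o + i)) a d u) B ((d + 1) * (7 ^ d + 1)) := by
  have hd7 : d < 7 ^ d := Nat.lt_pow_self (by norm_num)
  have h47 : 4 ^ d ≤ 7 ^ d := Nat.pow_le_pow_left (by norm_num) _
  refine Ok.seq (n₁ := 1) (P := fun s' => s'.reg 62 = 4 ^ d ∧ s'.reg 63 = 1)
    (Ok.wp ⟨fun hm => ?_, ⟨fun hm => ?_, ?_⟩⟩ fun _ => le_rfl) (fun s₁ hs₁ j => ?_)
    (fun _ => ⟨Nat.mul_pos (by omega) (by omega), le_rfl⟩)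
  · have := hB hm; simp [E.h9]; omega
  · simp
  · simp [State.setReg_reg, E.h9]
  have E₁ := E.of_agree hs₁ (by simp [Stmt.vars]) (by simp [Stmt.arrs])
  refine Ok.mono (Ok.for (c := 7 ^ d + 1) (n := (d + 1) * (7 ^ d + 1))
    (I := fun l s' => s'.reg 62 = 4 ^ (d - l) ∧ s'.reg 63 = 7 ^ l ∧
      ∀ u < 4 ^ (d - l) * 7 ^ l, s'.mem arr (l * 7 ^ d + u) =
        yatesMod M (fun i => strassenMod M (o + i)) a l u) d
    (by simp [E₁.h6]) (fun hm => ?_) (by simp [Stmt.vars, Stmt.for, yatesRound, yatesCell]) ?_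
    ?_ ?_ (fun _ => ⟨by omega, le_rfl⟩)) (fun s' _ h u hu => h.2.2 u (by simpa using hu))
    (fun _ => le_rfl)
  · have := hB hm; simp [E₁.h6]; omega
  · intro l s s' hag h
    simpa [hag.1, hag.2] using h
  · simpa [j.1, j.2, hs₁.2, Stmt.arrs, yatesMod] using ha
  · intro l hl s₂ hs₂ h60 hI
    exact yatesRound_ok (E₁.of_agree hs₂ (by simp [Stmt.vars, Stmt.for, yatesRound, yatesCell])
      (by simp [Stmt.arrs, Stmt.for, yatesRound, yatesCell, harr.symm])) harr hl h60 hI.1 hI.2.1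
      hI.2.2 hB

end Yates

/-! ### Checking one block of triples -/

/-- The smaller one of `a` and `n - 1`. -/
def clamp (a n : ℕ) : ℕ := a - (a - (n - 1))

theorem clamp_lt {n : ℕ} (hn : 0 < n) (a : ℕ) : clamp a n < n := by unfold clamp; omega

theorem clamp_of_lt {a n : ℕ} (h : a < n) : clamp a n = a := by unfold clamp; omega

/-- The data of a block: the arrays `f0`, `f1`, `f2` hold numbers `x i j`, `y i t`, `z j t` for
`i, j < n` and `t < T`; the block consists of the triples with `i`, `j`, `t` in the intervals of
length `2 ^ d` that start at `i0`, `j0`, `t0`. -/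
structure Block where
  f0 : ℕ → ℕ
  f1 : ℕ → ℕ
  f2 : ℕ → ℕ
  n : ℕ
  T : ℕ
  d : ℕ
  p : ℕ
  i0 : ℕ
  j0 : ℕ
  t0 : ℕ
  v : ℕ
  h : ℕ

namespace Block

variable (K : Block)

def I (i : ℕ) : ℕ := clamp (K.i0 + i) K.n
def J (j : ℕ) : ℕ := clamp (K.j0 + j) K.n
def U (t : ℕ) : ℕ := clamp (K.t0 + t) K.T
def x (i j : ℕ) : ℕ := K.f0 (4 + K.I i * K.n + K.J j)
def y (t i : ℕ) : ℕ := K.f1 (K.U t * K.n + K.I i)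
def z (j t : ℕ) : ℕ := K.f2 (K.U t * K.n + K.J j)
def zres (j t : ℕ) : ℕ := K.v + (K.p - 1) * (K.z j t / K.h)
def X : ℕ := 3 * 8 ^ K.d
def M : ℕ := K.X ^ K.p - 1

/-- The first, second and third coordinate of the triple with number `w`. -/
def ci (w : ℕ) : ℕ := w / (2 ^ K.d * 2 ^ K.d)
def cj (w : ℕ) : ℕ := w / 2 ^ K.d % 2 ^ K.d
def ct (w : ℕ) : ℕ := w % 2 ^ K.d

/-- The equation between the rounded numbers holds modulo `p`. -/
def Res (w : ℕ) : Prop :=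
  (cdiv (K.x (K.ci w) (K.cj w)) K.h + K.zres (K.cj w) (K.ct w) +
    cdiv (K.y (K.ct w) (K.ci w)) K.h) % K.p = 0

/-- The inequality holds. -/
def Good (w : ℕ) : Prop :=
  K.z (K.cj w) (K.ct w) ≤ K.x (K.ci w) (K.cj w) + K.y (K.ct w) (K.ci w)

instance : DecidablePred K.Res := fun _ => inferInstanceAs (Decidable (_ = _))
instance : DecidablePred K.Good := fun _ => inferInstanceAs (Decidable (_ ≤ _))

/-- The number of triples that satisfy the equation modulo `p`. -/
def count : ℕ := Nat.count K.Res (8 ^ K.d)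

/-- The state holds the data of the block. -/
structure Env (s : State) : Prop where
  yates : YatesEnv 0 K.d K.M s
  r0 : s.reg 0 = K.n
  r2 : s.reg 2 = K.T
  r7 : s.reg 7 = K.p
  r8 : s.reg 8 = 2 ^ K.d
  r11 : s.reg 11 = K.X
  r42 : s.reg 42 = K.i0
  r43 : s.reg 43 = K.j0
  r44 : s.reg 44 = K.t0
  r45 : s.reg 45 = K.v
  r46 : s.reg 46 = K.h
  m0 : s.mem 0 = K.f0
  m1 : s.mem 1 = K.f1
  m2 : s.mem 2 = K.f2
  m3 : ∀ e < K.p, s.mem 3 e = K.X ^ e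
  m5 : ∀ q < 4 ^ K.d, s.mem 5 q = mrow q
  m6 : ∀ q < 4 ^ K.d, s.mem 6 q = mcol q
  n_pos : 0 < K.n
  T_pos : 0 < K.T
  p_pos : 0 < K.p

variable {K}

/-- The allocation behind this: the data of a block and the tables sit in registers below 50 and
arrays below 8, register 22 only receives guesses, and everything above is working space. -/
theorem Env.of_agree {vs ks : List ℕ} {s s' : State} (E : K.Env s) (hag : AgreeOff vs ks s s')
    (hv : ∀ x ∈ vs, x = 22 ∨ 50 ≤ x) (hk : ∀ k ∈ ks, 8 ≤ k) : K.Env s' := by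
  have g : ∀ x < 50, x ≠ 22 → s'.reg x = s.reg x := fun x hx hx' => hag.1 x fun h' => by
    have := hv x h'; omega
  have gm : ∀ k < 8, s'.mem k = s.mem k := fun k hk' => hag.2 k fun h' => by
    have := hk k h'; omega
  obtain ⟨⟨a1, a2, a3, a4, a5, a6, a7⟩, b1, b2, b3, b4, b5, b6, b7, b8, b9, b10, c1, c2, c3, c4, c5,
    c6, d1, d2, d3⟩ := E
  constructor
  · constructor <;> first | assumption | (rw [g _ (by norm_num) (by norm_num)]; assumption) | skip
    rw [gm 4 (by norm_num)]; exact a5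
  all_goals first | assumption | (rw [g _ (by norm_num) (by norm_num)]; assumption) |
    (rw [gm _ (by norm_num)]; assumption)

variable (K) in
/-- The numbers that occur have at most `b` bits, and the powers of `X` at most `B` bits. -/
structure Bounded (b B : ℕ) : Prop where
  bB : b ≤ B
  n : K.n < 2 ^ b
  T : K.T < 2 ^ b
  p : K.p < 2 ^ b
  d : 8 ^ K.d < 2 ^ b
  i0 : K.i0 < 2 ^ b
  j0 : K.j0 < 2 ^ b
  t0 : K.t0 < 2 ^ b
  v : K.v < 2 ^ b
  h : K.h < 2 ^ b
  x : ∀ i < K.n, ∀ j < K.n, K.f0 (4 + i * K.n + j) < 2 ^ b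
  y : ∀ t < K.T, ∀ i < K.n, K.f1 (t * K.n + i) < 2 ^ b
  z : ∀ t < K.T, ∀ j < K.n, K.f2 (t * K.n + j) < 2 ^ b
  X : K.X ^ K.p < 2 ^ B

end Block

/-- Expressions for the clamped indices. -/
def clampE (e n : Expr) : Expr := e - (e - (n - 1))
def exprI (a : Expr) : Expr := clampE (.var 42 + a) (.var 0)
def exprJ (a : Expr) : Expr := clampE (.var 43 + a) (.var 0)
def exprU (a : Expr) : Expr := clampE (.var 44 + a) (.var 2)

/-- Expressions for the three numbers at given indices. -/
def exprX (i j : Expr) : Expr := .get 0 (4 + i * .var 0 + j)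
def exprY (t i : Expr) : Expr := .get 1 (t * .var 0 + i)
def exprZ (t j : Expr) : Expr := .get 2 (t * .var 0 + j)

def exprCdiv (e : Expr) : Expr := (e + (.var 46 - 1)) / .var 46
def exprZres (e : Expr) : Expr := .var 45 + (.var 7 - 1) * (e / .var 46)

/-- Fill the arrays `8`, `9`, `10` with powers of `X`. -/
def fillProg : Stmt :=
  .for 50 51 (.var 9) (
    .put 8 (.var 50) (.get 3 (exprCdiv (exprX (exprI (.get 5 (.var 50))) (exprJ (.get 6 (.var 50)))) %
      .var 7)) ;;
    .put 9 (.var 50) (.get 3 (exprZres (exprZ (exprU (.get 6 (.var 50))) (exprJ (.get 5 (.var 50)))) %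
      .var 7)) ;;
    .put 10 (.var 50) (.get 3 (exprCdiv (exprY (exprU (.get 5 (.var 50))) (exprI (.get 6 (.var 50)))) %
      .var 7)))

/-- Sum up the products of the transformed arrays and extract the number of solutions. -/
def sumProg : Stmt :=
  .set 72 0 ;;
  .for 70 71 (.var 10) (.set 72 ((.var 72 + .get 8 (.var 6 * .var 10 + .var 70) *
    .get 9 (.var 6 * .var 10 + .var 70) * .get 10 (.var 6 * .var 10 + .var 70)) % .var 12)) ;;
  .set 73 (.var 72 % .var 11)

/-- Guess as many solutions as there are, in increasing order, and check them. -/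
def listStep : Stmt :=
  .pick 22 ;;
  .set 83 (.var 82 + .var 22) ;;
  .set 82 (.var 83 + 1) ;;
  .check (.var 82 - .var 8 * (.var 8 * .var 8)) ;;
  .set 84 (exprI (.var 83 / (.var 8 * .var 8))) ;;
  .set 85 (exprJ (.var 83 / .var 8 % .var 8)) ;;
  .set 86 (exprU (.var 83 % .var 8)) ;;
  .check ((exprCdiv (exprX (.var 84) (.var 85)) + exprZres (exprZ (.var 86) (.var 85)) +
    exprCdiv (exprY (.var 86) (.var 84))) % .var 7) ;;
  .check (exprZ (.var 86) (.var 85) - (exprX (.var 84) (.var 85) + exprY (.var 86) (.var 84)))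

def listProg : Stmt := .set 82 0 ;; .for 80 81 (.var 73) listStep

/-! ### Correctness of filling, counting and listing in one block -/

section Specs

variable {K : Block} {m : Bool} {s : State} {b B : ℕ}

/-- The three arrays hold the factors of the trace in the cyclic order (i, j), (j, t), (t, i).
Exponents are reduced modulo `p` first, so that all powers come from the table in array `3`. -/
theorem fillProg_ok (E : K.Env s) (hB : m = true → K.Bounded b B) :
    Ok m fillProg s (fun s' => ∀ q < 4 ^ K.d,
      s'.mem 8 q = K.X ^ (cdiv (K.x (mrow q) (mcol q)) K.h % K.p) ∧
      s'.mem 9 q = K.X ^ (K.zres (mrow q) (mcol q) % K.p) ∧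
      s'.mem 10 q = K.X ^ (cdiv (K.y (mrow q) (mcol q)) K.h % K.p)) B (4 ^ K.d + 1) := by
  have h48 : 4 ^ K.d ≤ 8 ^ K.d := Nat.pow_le_pow_left (by norm_num) _
  have h28 : 2 ^ K.d ≤ 8 ^ K.d := Nat.pow_le_pow_left (by norm_num) _
  have up : ∀ {a : ℕ}, m = true → a < 2 ^ b → a < 2 ^ B := fun hm h =>
    h.trans_le (Nat.pow_le_pow_right (by norm_num) (hB hm).bB)
  refine Ok.for (c := 1) (I := fun n s' => ∀ q < n,
      s'.mem 8 q = K.X ^ (cdiv (K.x (mrow q) (mcol q)) K.h % K.p) ∧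
      s'.mem 9 q = K.X ^ (K.zres (mrow q) (mcol q) % K.p) ∧
      s'.mem 10 q = K.X ^ (cdiv (K.y (mrow q) (mcol q)) K.h % K.p)) (4 ^ K.d)
    (by simp [E.yates.h9]) (fun hm => ?_) (by simp [Stmt.vars]) ?_ (by simp) ?_ (fun _ => by omega)
  · have := up hm (hB hm).d
    simp only [Small_var, E.yates.h9]; omega
  · intro i s s' hag h
    simpa [hag.2] using h
  · intro q hq s₁ hs₁ h50 hI
    have E₁ := E.of_agree hs₁ (by simp [Stmt.vars]) (by simp [Stmt.arrs])
    have e0 : s₁.mem 5 q = mrow q := E₁.m5 q hq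
    have e1 : s₁.mem 6 q = mcol q := E₁.m6 q hq
    have e3 : ∀ u, s₁.mem 3 (u % K.p) = K.X ^ (u % K.p) := fun u =>
      E₁.m3 _ (Nat.mod_lt _ E₁.p_pos)
    have p3 : m = true → ∀ u, K.X ^ (u % K.p) < 2 ^ B := fun hm u =>
      (Nat.pow_le_pow_right (by simp [Block.X]) (Nat.mod_lt _ E₁.p_pos).le).trans_lt (hB hm).X
    have evX : ∀ s₂ : State, s₂.reg = s₁.reg → (∀ k < 8, s₂.mem k = s₁.mem k) →
      (exprCdiv (exprX (exprI (.get 5 (.var 50))) (exprJ (.get 6 (.var 50))))).eval s₂ =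
        cdiv (K.x (mrow q) (mcol q)) K.h := by
      intro s₂ hr hm
      simp [exprCdiv, exprX, exprI, exprJ, clampE, hr, hm, h50, e0, e1, E₁.r0, E₁.r42, E₁.r43,
        E₁.r46, E₁.m0, cdiv, Block.x, Block.I, Block.J, clamp]
    have evZ : ∀ s₂ : State, s₂.reg = s₁.reg → (∀ k < 8, s₂.mem k = s₁.mem k) →
      (exprZres (exprZ (exprU (.get 6 (.var 50))) (exprJ (.get 5 (.var 50))))).eval s₂ =
        K.zres (mrow q) (mcol q) := by
      intro s₂ hr hm
      simp [exprZres, exprZ, exprU, exprJ, clampE, hr, hm, h50, e0, e1, E₁.r0, E₁.r44, E₁.r43,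
        E₁.r46, E₁.r45, E₁.r7, E₁.r2, E₁.m2, Block.zres, Block.z, Block.U, Block.J, clamp]
    have evY : ∀ s₂ : State, s₂.reg = s₁.reg → (∀ k < 8, s₂.mem k = s₁.mem k) →
      (exprCdiv (exprY (exprU (.get 5 (.var 50))) (exprI (.get 6 (.var 50))))).eval s₂ =
        cdiv (K.y (mrow q) (mcol q)) K.h := by
      intro s₂ hr hm
      simp [exprCdiv, exprY, exprI, exprU, clampE, hr, hm, h50, e0, e1, E₁.r0, E₁.r42, E₁.r44,
        E₁.r46, E₁.r2, E₁.m1, cdiv, Block.y, Block.I, Block.U, clamp]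
    have sm : m = true → ∀ s₂ : State, s₂.reg = s₁.reg → (∀ k < 8, s₂.mem k = s₁.mem k) →
      (Expr.var 50).Small B s₂ ∧ (Expr.var 7).Small B s₂ ∧
      (exprCdiv (exprX (exprI (.get 5 (.var 50))) (exprJ (.get 6 (.var 50))))).Small B s₂ ∧
      (exprZres (exprZ (exprU (.get 6 (.var 50))) (exprJ (.get 5 (.var 50))))).Small B s₂ ∧
      (exprCdiv (exprY (exprU (.get 5 (.var 50))) (exprI (.get 6 (.var 50))))).Small B s₂ := by
      intro hm s₂ hr hm'
      have bd := hB hm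
      have l1 := mrow_lt hq
      have l2 := mcol_lt hq
      have l3 := up hm bd.d
      have x1 := bd.x _ (clamp_lt E₁.n_pos (K.i0 + mrow q)) _ (clamp_lt E₁.n_pos (K.j0 + mcol q))
      have y1 := bd.y _ (clamp_lt E₁.T_pos (K.t0 + mrow q)) _ (clamp_lt E₁.n_pos (K.i0 + mcol q))
      have z1 := bd.z _ (clamp_lt E₁.T_pos (K.t0 + mcol q)) _ (clamp_lt E₁.n_pos (K.j0 + mrow q))
      unfold clamp at x1 y1 z1
      have n1 := up hm bd.n
      have n2 := up hm bd.T
      have n3 := up hm bd.p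
      have n4 := up hm bd.i0
      have n5 := up hm bd.j0
      have n6 := up hm bd.t0
      have n7 := up hm bd.v
      have n8 := up hm bd.h
      have g1 : mrow q < 2 ^ B := by omega
      have g2 : mcol q < 2 ^ B := by omega
      have g3 : q < 2 ^ B := by omega
      simp [exprCdiv, exprZres, exprX, exprY, exprZ, exprI, exprU, exprJ, clampE, hr, hm', h50, e0,
        e1, E₁.r0, E₁.r42, E₁.r43, E₁.r44, E₁.r46, E₁.r45, E₁.r7, E₁.r2, E₁.m0, E₁.m1, E₁.m2,
        n1, n2, n3, n4, n5, n6, n7, n8, g1, g2, g3, up hm x1, up hm y1, up hm z1]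
    refine Ok.wp ⟨fun hm => ?_, ⟨fun hm => ?_, ⟨fun hm => ?_, ?_⟩⟩⟩ (fun _ => le_rfl)
    · have := sm hm s₁ rfl (fun _ _ => rfl)
      simp only [Small_get, Small_mod, eval_mod, evX s₁ rfl (fun _ _ => rfl), eval_var, E₁.r7, e3]
      exact ⟨this.1, ⟨this.2.2.1, this.2.1⟩, p3 hm _⟩
    · set s₂ := s₁.setMem 8 _ _ with hs₂
      have hk : ∀ k < 8, s₂.mem k = s₁.mem k := fun k hk =>
        State.setMem_mem_of_ne (by omega)
      have := sm hm s₂ rfl hk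
      simp only [Small_get, Small_mod, eval_mod, evZ s₂ rfl hk, eval_var, hk 3 (by norm_num), e3,
        show s₂.reg 7 = K.p from E₁.r7]
      exact ⟨this.1, ⟨this.2.2.2.1, this.2.1⟩, p3 hm _⟩
    · set s₃ := (s₁.setMem 8 _ _).setMem 9 _ _ with hs₃
      have hk : ∀ k < 8, s₃.mem k = s₁.mem k := fun k hk => by
        rw [hs₃, State.setMem_mem_of_ne (by omega), State.setMem_mem_of_ne (by omega)]
      have := sm hm s₃ rfl hk
      simp only [Small_get, Small_mod, eval_mod, evY s₃ rfl hk, eval_var, hk 3 (by norm_num), e3,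
        show s₃.reg 7 = K.p from E₁.r7]
      exact ⟨this.1, ⟨this.2.2.2.2, this.2.1⟩, p3 hm _⟩
    · intro q' hq'
      set s₂ := s₁.setMem 8 _ _ with hs₂
      set s₃ := s₂.setMem 9 _ _ with hs₃
      have hk2 : ∀ k < 8, s₂.mem k = s₁.mem k := fun k hk =>
        State.setMem_mem_of_ne (by omega)
      have hk3 : ∀ k < 8, s₃.mem k = s₁.mem k := fun k hk => by
        rw [hs₃, State.setMem_mem_of_ne (by omega), hk2 k hk]
      have v1 : (exprCdiv (exprX (exprI (.get 5 (.var 50))) (exprJ (.get 6 (.var 50))))).eval s₁ = _ :=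
        evX s₁ rfl fun _ _ => rfl
      have v2 := evZ s₂ rfl hk2
      have v3 := evY s₃ rfl hk3
      have r7 : s₂.reg 7 = K.p := E₁.r7
      have r7' : s₃.reg 7 = K.p := E₁.r7
      have r50 : s₂.reg 50 = q := h50
      have r50' : s₃.reg 50 = q := h50
      simp only [eval_get, eval_mod, v3, eval_var, r7', hk3 3 (by norm_num), e3, r50',
        State.setMem_mem]
      simp only [hs₃, State.setMem_mem, eval_get, eval_mod, v2, eval_var, r7, hk2 3 (by norm_num),
        e3, r50]
      simp only [hs₂, State.setMem_mem, eval_get, eval_mod, v1, eval_var, E₁.r7, e3, h50]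
      by_cases hqq : q' = q
      · subst hqq; simp
      · simpa [hqq] using hI q' (by omega)

theorem sumProg_ok (E : K.Env s) (hB : m = true → K.Bounded b B)
    {a₁ a₂ a₃ : ℕ → ℕ} (h₁ : ∀ u < 7 ^ K.d, s.mem 8 (K.d * 7 ^ K.d + u) = a₁ u)
    (h₂ : ∀ u < 7 ^ K.d, s.mem 9 (K.d * 7 ^ K.d + u) = a₂ u)
    (h₃ : ∀ u < 7 ^ K.d, s.mem 10 (K.d * 7 ^ K.d + u) = a₃ u)
    (hb : m = true → ∀ u < 7 ^ K.d, a₁ u < 2 ^ B ∧ a₂ u < 2 ^ B ∧ a₃ u < 2 ^ B) :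
    Ok m sumProg s (fun s' => s'.reg 73 = sumMod K.M a₁ a₂ a₃ (7 ^ K.d) % K.X) B (7 ^ K.d + 1) := by
  have h78 : 7 ^ K.d ≤ 8 ^ K.d := Nat.pow_le_pow_left (by norm_num) _
  have hd7 : K.d < 7 ^ K.d := Nat.lt_pow_self (by norm_num)
  have up : ∀ {a : ℕ}, m = true → a < 2 ^ b → a < 2 ^ B := fun hm h =>
    h.trans_le (Nat.pow_le_pow_right (by norm_num) (hB hm).bB)
  have hM := E.yates.hM
  have hMB : m = true → K.M < 2 ^ B := fun hm => by
    have := (hB hm).X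
    unfold Block.M; omega
  have hXB : m = true → K.X < 2 ^ B := fun hm => by
    refine lt_of_le_of_lt ?_ (hB hm).X
    calc K.X = K.X ^ 1 := (pow_one _).symm
      _ ≤ _ := Nat.pow_le_pow_right (by simp [Block.X]) E.p_pos
  refine Ok.seq (n₁ := 1) (n₂ := 7 ^ K.d + 1) (P := fun s' => s'.reg 72 = 0)
    (Ok.wp ⟨fun _ => by simp, by simp [State.setReg_reg]⟩ fun _ => le_rfl) (fun s₁ hs₁ h72 => ?_)
    (by omega)
  have E₁ := E.of_agree hs₁ (by simp [Stmt.vars]) (by simp [Stmt.arrs])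
  have hm₁ : ∀ k, s₁.mem k = s.mem k := fun k => hs₁.2 k (by simp [Stmt.arrs])
  refine Ok.seq (n₁ := 7 ^ K.d + 1) (n₂ := 1)
    (Ok.for (c := 1) (n := 7 ^ K.d + 1) (I := fun r s' => s'.reg 72 = sumMod K.M a₁ a₂ a₃ r) (7 ^ K.d)
      (by simp [E₁.yates.h10]) (fun hm => ?_) (by simp [Stmt.vars]) ?_ (by simpa [sumMod] using h72) ?_
      (fun _ => by omega)) (fun s₂ hs₂ h72' => ?_) (fun _ => by omega)
  · have := up hm (hB hm).d
    simp only [Small_var, E₁.yates.h10]; omega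
  · intro i s s' hag h
    simpa [hag.1] using h
  · intro r hr s₂ hs₂ h70 hI
    have E₂ := E₁.of_agree hs₂ (by simp [Stmt.vars]) (by simp [Stmt.arrs])
    have hm₂ : ∀ k, s₂.mem k = s.mem k := fun k => (hs₂.2 k (by simp [Stmt.arrs])).trans (hm₁ k)
    refine Ok.wp ⟨fun hm => ?_, ?_⟩ fun _ => le_rfl
    · have q1 := hb hm r hr
      have q2 := up hm (hB hm).d
      have q3 : K.d < 2 ^ B := by omega
      have q4 : 7 ^ K.d < 2 ^ B := by omega
      have q5 : r < 2 ^ B := by omega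
      have q6 := (sumMod_lt (by omega) a₁ a₂ a₃ r).trans (hMB hm)
      simp [hI, hm₂, h₁ r hr, h₂ r hr, h₃ r hr, h70, E₂.yates.h6, E₂.yates.h10, E₂.yates.h12, q1,
        q3, q4, q5, q6, hMB hm]
    · simp [State.setReg_reg, hI, hm₂, h₁ r hr, h₂ r hr, h₃ r hr, h70, E₂.yates.h6, E₂.yates.h10,
        E₂.yates.h12, sumMod]
  · have E₂ := E₁.of_agree hs₂ (by simp [Stmt.vars, Stmt.for]) (by simp [Stmt.arrs, Stmt.for])
    refine Ok.wp ⟨fun hm => ?_, ?_⟩ fun _ => le_rfl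
    · have q6 := (sumMod_lt (by omega) a₁ a₂ a₃ (7 ^ K.d)).trans (hMB hm)
      simp [h72', E₂.r11, q6, hXB hm]
    · simp [State.setReg_reg, h72', E₂.r11]

end Specs

/-- The next solution at or after `a`; the last conclusion says that taking the first one skips
none. -/
theorem exists_of_lt_count {p : ℕ → Prop} [DecidablePred p] {a i N : ℕ}
    (ha : Nat.count p a ≤ i) (hN : i < Nat.count p N) :
    ∃ w, a ≤ w ∧ w < N ∧ p w ∧ Nat.count p (w + 1) ≤ i + 1 := by
  have hex : ∃ n, i < Nat.count p n := ⟨N, hN⟩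
  classical
  have h1 := Nat.find_spec hex
  have h2 : ∀ n < Nat.find hex, Nat.count p n ≤ i := fun n hn => not_lt.1 (Nat.find_min hex hn)
  have h3 : Nat.find hex ≤ N := Nat.find_min' hex hN
  set n := Nat.find hex
  have hpos : 0 < n := by
    rcases Nat.eq_zero_or_pos n with h | h
    · rw [h, Nat.count_zero] at h1; omega
    · exact h
  obtain ⟨w, hw⟩ : ∃ w, n = w + 1 := ⟨n - 1, by omega⟩
  have h4 := h2 w (by omega)
  rw [hw, Nat.count_succ] at h1
  refine ⟨w, ?_, by omega, ?_, ?_⟩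
  · by_contra hlt
    have := Nat.count_monotone p (show n ≤ a by omega)
    rw [hw, Nat.count_succ] at this
    omega
  · by_contra hp
    simp only [hp, if_false] at h1
    omega
  · rw [Nat.count_succ]; split_ifs <;> omega

section Specs

variable {K : Block} {m : Bool} {s : State} {b B : ℕ}

/-- What a round of `listProg` establishes for the next solution `w`. -/
theorem listStep_wp (E : K.Env s) (hB : m = true → K.Bounded b B) {nxt : ℕ} (h82 : s.reg 82 = nxt)
    {Q : State → Prop}
    (hr : m = true → ∃ w, nxt ≤ w ∧ w < 8 ^ K.d ∧ K.Res w ∧ K.Good w ∧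
      ∀ s', s'.reg 82 = w + 1 → Q s')
    (hs : m = false → ∀ w, nxt ≤ w → w < 8 ^ K.d → K.Res w → K.Good w →
      ∀ s', s'.reg 82 = w + 1 → Q s') : wp m b listStep s Q := by
  have h28 : 2 ^ K.d ≤ 8 ^ K.d := Nat.pow_le_pow_left (by norm_num) _
  have h8 : 2 ^ K.d * (2 ^ K.d * 2 ^ K.d) = 8 ^ K.d := by
    rw [← mul_pow, ← mul_pow]; norm_num
  obtain ⟨-, r0, r2, r7, r8, -, r42, r43, r44, r45, r46, m0, m1, m2, -, -, -, hn, hT, hp⟩ := E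
  -- What is guessed is the gap to the least admissible number, so the listed solutions increase
  -- strictly and are distinct by construction.
  have aux : ∀ w, nxt ≤ w → ∀ hh : (m = true → w < 8 ^ K.d ∧ K.Res w ∧ K.Good w),
      (K.Res w → K.Good w → w < 8 ^ K.d → ∀ s', s'.reg 82 = w + 1 → Q s') →
      wp m b (.set 83 (.var 82 + .var 22) ;;
        .set 82 (.var 83 + 1) ;;
        .check (.var 82 - .var 8 * (.var 8 * .var 8)) ;;
        .set 84 (exprI (.var 83 / (.var 8 * .var 8))) ;;
        .set 85 (exprJ (.var 83 / .var 8 % .var 8)) ;;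
        .set 86 (exprU (.var 83 % .var 8)) ;;
        .check ((exprCdiv (exprX (.var 84) (.var 85)) + exprZres (exprZ (.var 86) (.var 85)) +
          exprCdiv (exprY (.var 86) (.var 84))) % .var 7) ;;
        .check (exprZ (.var 86) (.var 85) - (exprX (.var 84) (.var 85) +
          exprY (.var 86) (.var 84)))) (s.setReg 22 (w - nxt)) Q := by
    intro w hw hh hq
    have e1 : nxt + (w - nxt) = w := by omega
    have e2 : K.i0 + w / (2 ^ K.d * 2 ^ K.d) - (K.i0 + w / (2 ^ K.d * 2 ^ K.d) - (K.n - 1)) =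
      K.I (K.ci w) := rfl
    have e3 : K.j0 + w / 2 ^ K.d % 2 ^ K.d - (K.j0 + w / 2 ^ K.d % 2 ^ K.d - (K.n - 1)) =
      K.J (K.cj w) := rfl
    have e4 : K.t0 + w % 2 ^ K.d - (K.t0 + w % 2 ^ K.d - (K.T - 1)) = K.U (K.ct w) := rfl
    have f1 : K.f0 (4 + K.I (K.ci w) * K.n + K.J (K.cj w)) = K.x (K.ci w) (K.cj w) := rfl
    have f2 : K.f1 (K.U (K.ct w) * K.n + K.I (K.ci w)) = K.y (K.ct w) (K.ci w) := rfl
    have f3 : K.f2 (K.U (K.ct w) * K.n + K.J (K.cj w)) = K.z (K.cj w) (K.ct w) := rfl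
    have g1 : ∀ a, (a + (K.h - 1)) / K.h = cdiv a K.h := fun _ => rfl
    have g2 : K.v + (K.p - 1) * (K.z (K.cj w) (K.ct w) / K.h) = K.zres (K.cj w) (K.ct w) := rfl
    simp only [wp, exprCdiv, exprZres, exprX, exprY, exprZ, exprI, exprU, exprJ, clampE,
      Small_add, Small_sub, Small_mul, Small_div, Small_mod, Small_var, Small_get, Small_one,
      Small_four, Small_zero, eval_add, eval_sub, eval_mul, eval_div, eval_mod, eval_var, eval_get,
      eval_one, eval_four, eval_zero, State.setReg_reg, State.setReg_mem, Nat.reduceEqDiff,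
      reduceIte, r0, r2, r7, r8, r42, r43, r44, r45, r46, m0, m1, m2, h82,
      e1, e2, e3, e4, f1, f2, f3, g1, g2, h8, true_and, and_true]
    have b1 : m = true → w < 2 ^ b ∧ w + 1 < 2 ^ b := fun hm => by
      have := (hh hm).1
      have := (hB hm).d
      constructor <;> omega
    have b2 : m = true → nxt < 2 ^ b ∧ w - nxt < 2 ^ b := fun hm => by
      have := b1 hm
      constructor <;> omega
    have b3 : m = true → 2 ^ K.d < 2 ^ b := fun hm => h28.trans_lt (hB hm).d
    have hI : K.I (K.ci w) < K.n := clamp_lt hn _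
    have hJ : K.J (K.cj w) < K.n := clamp_lt hn _
    have hU : K.U (K.ct w) < K.T := clamp_lt hT _
    have b4 : m = true → K.I (K.ci w) < 2 ^ b ∧ K.J (K.cj w) < 2 ^ b ∧ K.U (K.ct w) < 2 ^ b :=
      fun hm => ⟨hI.trans (hB hm).n, hJ.trans (hB hm).n, hU.trans (hB hm).T⟩
    have b5 : m = true → K.x (K.ci w) (K.cj w) < 2 ^ b ∧ K.y (K.ct w) (K.ci w) < 2 ^ b ∧
        K.z (K.cj w) (K.ct w) < 2 ^ b := fun hm =>
      ⟨(hB hm).x _ hI _ hJ, (hB hm).y _ hU _ hI, (hB hm).z _ hU _ hJ⟩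
    refine ⟨fun hm => b2 hm, fun hm => (b1 hm).1, fun hm => ⟨⟨(b1 hm).2, b3 hm, b3 hm, b3 hm⟩, ?_⟩, fun hc =>
      ⟨fun hm => ?_, fun hm => ?_, fun hm => ?_, fun hm => ⟨?_, ?_⟩, fun hres => ⟨fun hm => ⟨?_, ?_⟩,
      fun hgood => ?_⟩⟩⟩
    · have := (hh hm).1; omega
    · have := hB hm
      simp only [this.i0, this.n, (b1 hm).1, b3 hm, and_self]
    · have := hB hm
      simp only [this.j0, this.n, (b1 hm).1, b3 hm, and_self]
    · have := hB hm
      simp only [this.t0, this.T, (b1 hm).1, b3 hm, and_self]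
    · have := hB hm
      simp only [this.n, this.h, this.v, this.p, b4 hm, b5 hm, and_self]
    · exact (hh hm).2.1
    · have := hB hm
      simp only [this.n, b4 hm, b5 hm, and_self]
    · exact Nat.sub_eq_zero_of_le (hh hm).2.2
    · refine hq hres (Nat.sub_eq_zero_iff_le.1 hgood) (by omega) _ ?_
      simp only [State.setReg_reg, Nat.reduceEqDiff, reduceIte]
  refine ⟨fun hm => ?_, fun hm v => ?_⟩
  · obtain ⟨w, h1, h2, h3, h4, h5⟩ := hr hm
    refine ⟨w - nxt, ?_, aux w h1 (fun _ => ⟨h2, h3, h4⟩) fun _ _ _ => h5⟩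
    have := (hB hm).d
    omega
  · have := aux (nxt + v) (by omega) (fun hm' => absurd hm' (by simp [hm]))
      fun h1 h2 h3 => hs hm (nxt + v) (by omega) h3 h1 h2
    rwa [Nat.add_sub_cancel_left] at this

/-- As many distinct solutions as there are have been found good, and a subset of full cardinality
is everything. The last clause of the invariant serves completeness only: no solution has been
skipped, so there is a next one to guess. All numbers here have `b` bits, never the `B` bits of the
powers of `X`. -/
theorem listProg_ok (E : K.Env s) (h73 : s.reg 73 = K.count) (hB : m = true → K.Bounded b B)
    (hg : m = true → ∀ w < 8 ^ K.d, K.Res w → K.Good w) :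
    Ok m listProg s (fun _ => ∀ w < 8 ^ K.d, K.Res w → K.Good w) b (K.count + 1) := by
  have hcnt : K.count ≤ 8 ^ K.d := Nat.count_le _
  refine Ok.seq (n₁ := 1) (n₂ := K.count + 1) (P := fun s' => s'.reg 82 = 0)
    (Ok.wp ⟨fun _ => by simp, by simp [State.setReg_reg]⟩ fun _ => le_rfl) (fun s₁ hs₁ h82 => ?_)
    (by omega)
  have E₁ := E.of_agree hs₁ (by simp [Stmt.vars]) (by simp [Stmt.arrs])
  refine Ok.mono (Ok.for (c := 1) (n := K.count + 1) (I := fun i s' => s'.reg 82 ≤ 8 ^ K.d ∧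
      i ≤ Nat.count (fun w => K.Res w ∧ K.Good w) (s'.reg 82) ∧
      (m = true → Nat.count K.Res (s'.reg 82) ≤ i)) K.count
    (by simp [hs₁.1, Stmt.vars, h73]) (fun hm => ?_) (by simp [Stmt.vars, listStep]) ?_
    (by simp [h82]) ?_ (fun _ => by omega)) (fun s' _ h => ?_) fun _ => le_rfl
  · have := (hB hm).d
    simp [hs₁.1, Stmt.vars, h73]; omega
  · intro i s s' hag h
    simpa [hag.1] using h
  · intro i hi s₂ hs₂ h80 hI
    have E₂ := E₁.of_agree hs₂ (by simp [Stmt.vars, listStep]) (by simp [Stmt.arrs, listStep])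
    obtain ⟨i1, i2, i3⟩ := hI
    refine Ok.wp (listStep_wp E₂ hB rfl (fun hm => ?_) fun hm w h1 h2 h3 h4 s' hs' => ?_)
      fun _ => le_rfl
    · obtain ⟨w, h1, h2, h3, h4⟩ := exists_of_lt_count (i3 hm) hi
      refine ⟨w, h1, h2, h3, hg hm w h2 h3, fun s' hs' => ?_⟩
      rw [hs']
      refine ⟨h2, ?_, fun _ => h4⟩
      rw [Nat.count_succ, if_pos ⟨h3, hg hm w h2 h3⟩]
      exact Nat.succ_le_succ (i2.trans (Nat.count_monotone _ h1))
    · rw [hs']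
      refine ⟨h2, ?_, fun hm' => absurd hm' (by simp [hm])⟩
      rw [Nat.count_succ, if_pos ⟨h3, h4⟩]
      exact Nat.succ_le_succ (i2.trans (Nat.count_monotone _ h1))
  · obtain ⟨i1, i2, -⟩ := h
    have h1 := i2.trans (Nat.count_monotone _ i1)
    unfold Block.count at h1
    rw [Nat.count_eq_card_filter_range, Nat.count_eq_card_filter_range] at h1
    have hsub : #{w ∈ range (8 ^ K.d) | K.Res w ∧ K.Good w} ≤ _ :=
      card_le_card (t := {w ∈ range (8 ^ K.d) | K.Res w}) fun w hw => by
        simp only [mem_filter] at hw ⊢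
        exact ⟨hw.1, hw.2.1⟩
    have heq := eq_of_subset_of_card_le (s := {w ∈ range (8 ^ K.d) | K.Res w ∧ K.Good w})
      (t := {w ∈ range (8 ^ K.d) | K.Res w}) (fun w hw => by
        simp only [mem_filter] at hw ⊢
        exact ⟨hw.1, hw.2.1⟩) h1
    intro w hw hres
    have : w ∈ ({w ∈ range (8 ^ K.d) | K.Res w} : Finset ℕ) := by
      simp only [mem_filter, mem_range]; exact ⟨hw, hres⟩
    rw [← heq] at this
    exact (mem_filter.1 this).2.2

/-- The computation of the number of solutions in a block. -/
def countProg : Stmt := fillProg ;; yatesProg 8 0 ;; yatesProg 9 28 ;; yatesProg 10 56 ;; sumProg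

theorem countProg_ok (E : K.Env s) (hB : m = true → K.Bounded b B) :
    Ok m countProg s (fun s' => s'.reg 73 = K.count) B ((K.d + 1) * (7 ^ K.d + 1)) := by
  have h78 : 7 ^ K.d ≤ 8 ^ K.d := Nat.pow_le_pow_left (by norm_num) _
  have h47 : 4 ^ K.d ≤ 7 ^ K.d := Nat.pow_le_pow_left (by norm_num) _
  have up : ∀ {a : ℕ}, m = true → a < 2 ^ b → a < 2 ^ B := fun hm h =>
    h.trans_le (Nat.pow_le_pow_right (by norm_num) (hB hm).bB)
  have hMB : m = true → K.M < 2 ^ B := fun hm => by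
    have := (hB hm).X
    unfold Block.M; omega
  have hM := E.yates.hM
  have hX : ∀ u, m = true → K.X ^ (u % K.p) < 2 ^ B := fun u hm =>
    (Nat.pow_le_pow_right (by simp [Block.X]) (Nat.mod_lt _ E.p_pos).le).trans_lt (hB hm).X
  have hbase : m = true → 7 ^ K.d < 2 ^ B := fun hm => h78.trans_lt (up hm (hB hm).d)
  have hn : 7 ^ K.d + 1 ≤ (K.d + 1) * (7 ^ K.d + 1) := Nat.le_mul_of_pos_left _ (by omega)
  have hn' : 4 ^ K.d + 1 ≤ (K.d + 1) * (7 ^ K.d + 1) := le_trans (by omega) hn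
  have E' : ∀ {s' : State}, K.Env s' → ∀ o, o + 28 ≤ 84 → YatesEnv o K.d K.M s' := fun E o ho => by
    obtain ⟨a, b, c, d, e, f, g⟩ := E.yates
    exact ⟨a, b, c, d, e, ho, g⟩
  have vY : ∀ arr o, ∀ x ∈ (yatesProg arr o).vars, x = 22 ∨ 50 ≤ x := fun arr o => by
    simp [Stmt.vars, Stmt.for, yatesProg, yatesRound, yatesCell]
  have aY : ∀ arr o, (yatesProg arr o).arrs = [arr] := fun arr o => by
    simp [Stmt.arrs, Stmt.for, yatesProg, yatesRound, yatesCell]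
  refine Ok.seq (fillProg_ok E hB) (fun s₁ hs₁ hf => ?_) fun _ => ⟨hn', le_rfl⟩
  have E₁ := E.of_agree hs₁ (by simp [Stmt.vars, fillProg, Stmt.for])
    (by simp [Stmt.arrs, fillProg, Stmt.for])
  refine Ok.seq (yatesProg_ok (E' E₁ 0 (by norm_num)) (by norm_num) (fun q hq => (hf q hq).1)
    fun hm => ⟨hbase hm, hMB hm, fun q _ => hX _ hm⟩) (fun s₂ hs₂ hy₁ => ?_) fun _ => ⟨le_rfl, le_rfl⟩
  have E₂ := E₁.of_agree hs₂ (vY _ _) (by simp [aY])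
  have k9 : s₂.mem 9 = s₁.mem 9 := hs₂.2 9 (by simp [aY])
  have k10 : s₂.mem 10 = s₁.mem 10 := hs₂.2 10 (by simp [aY])
  refine Ok.seq (yatesProg_ok (E' E₂ 28 (by norm_num)) (by norm_num)
    (fun q hq => by rw [k9]; exact (hf q hq).2.1)
    fun hm => ⟨hbase hm, hMB hm, fun q _ => hX _ hm⟩) (fun s₃ hs₃ hy₂ => ?_) fun _ => ⟨le_rfl, le_rfl⟩
  have E₃ := E₂.of_agree hs₃ (vY _ _) (by simp [aY])
  have k8 : s₃.mem 8 = s₂.mem 8 := hs₃.2 8 (by simp [aY])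
  have k10' : s₃.mem 10 = s₁.mem 10 := (hs₃.2 10 (by simp [aY])).trans k10
  refine Ok.seq (yatesProg_ok (E' E₃ 56 (by norm_num)) (by norm_num)
    (fun q hq => by rw [k10']; exact (hf q hq).2.2)
    fun hm => ⟨hbase hm, hMB hm, fun q _ => hX _ hm⟩) (fun s₄ hs₄ hy₃ => ?_) fun _ => ⟨le_rfl, le_rfl⟩
  have E₄ := E₃.of_agree hs₄ (vY _ _) (by simp [aY])
  have k8' : s₄.mem 8 = s₂.mem 8 := (hs₄.2 8 (by simp [aY])).trans k8
  have k9' : s₄.mem 9 = s₃.mem 9 := hs₄.2 9 (by simp [aY])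
  have t₁ := hy₁
  have t₂ := hy₂
  rw [← k8'] at t₁
  rw [← k9'] at t₂
  have bd : ∀ (co f : ℕ → ℕ), m = true → ∀ u < 7 ^ K.d,
      yatesMod K.M co (fun q => K.X ^ (f q % K.p)) K.d u < 2 ^ B := fun co f hm u hu =>
    yatesMod_lt (d := K.d) (by omega) (hMB hm) (fun _ _ => hX _ hm) _ _ (by simpa using hu)
  refine Ok.mono (sumProg_ok E₄ hB t₁ t₂ hy₃ fun hm u hu =>
    ⟨bd _ _ hm u hu, bd _ _ hm u hu, bd _ _ hm u hu⟩) (fun s' _ h => ?_) fun _ => hn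
  rw [h, sumMod_yatesMod (d := K.d) (X := K.X) (M := K.M) E.p_pos rfl (fun i j => cdiv (K.x i j) K.h % K.p)
    (fun j t => K.zres j t % K.p) (fun t i => cdiv (K.y t i) K.h % K.p) rfl, Block.count,
    Nat.count_eq_card_filter_range]
  congr 1
  refine filter_congr fun w _ => ?_
  unfold Block.Res
  -- The three exponents were reduced separately, which does not affect their sum modulo `p`.
  rw [Nat.add_mod, Nat.mod_mod, ← Nat.add_mod (cdiv _ _), ← Nat.add_mod]
  rfl

end Specs

/-! ### Checking all triples -/

/-- The block with number `g`, among all blocks, levels and offsets. -/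
def blockOf (f0 f1 f2 : ℕ → ℕ) (n T d p g : ℕ) : Block where
  f0 := f0
  f1 := f1
  f2 := f2
  n := n
  T := T
  d := d
  p := p
  i0 := g / (T / 2 ^ d + 1) / (n / 2 ^ d + 1) % (n / 2 ^ d + 1) * 2 ^ d
  j0 := g / (T / 2 ^ d + 1) % (n / 2 ^ d + 1) * 2 ^ d
  t0 := g % (T / 2 ^ d + 1) * 2 ^ d
  v := g / (T / 2 ^ d + 1) / (n / 2 ^ d + 1) / (n / 2 ^ d + 1) % 3 + 1
  h := 2 ^ (g / (T / 2 ^ d + 1) / (n / 2 ^ d + 1) / (n / 2 ^ d + 1) / 3)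

/-- The number of blocks, with `L` levels. -/
def numBlocks (n T d L : ℕ) : ℕ := L * 3 * (n / 2 ^ d + 1) * (n / 2 ^ d + 1) * (T / 2 ^ d + 1)

/-- A violated inequality would yield an equation at some scale, hence a solution modulo `p` in the
block containing the triple. Such a solution is good by `h`, and a good triple cannot satisfy the
equation since `v + 1` is positive. -/
theorem le_add_of_blocks {f0 f1 f2 : ℕ → ℕ} {n T d p L : ℕ} (hp : 0 < p)
    (h : ∀ g < numBlocks n T d L, ∀ w < 8 ^ d, (blockOf f0 f1 f2 n T d p g).Res w →
      (blockOf f0 f1 f2 n T d p g).Good w) {i j t : ℕ} (hi : i < n) (hj : j < n) (ht : t < T)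
    (hz : f2 (t * n + j) < 2 ^ L) : f2 (t * n + j) ≤ f0 (4 + i * n + j) + f1 (t * n + i) := by
  refine le_add_of_levels hz fun l hl v hv heq => ?_
  set s := 2 ^ d with hs
  have hspos : 0 < s := by positivity
  have h8 : s * (s * s) = 8 ^ d := by
    rw [hs, ← mul_pow, ← mul_pow]; norm_num
  set nI := n / s + 1 with hnI
  set nT := T / s + 1 with hnT
  have bi : i / s < nI := Nat.lt_succ_of_le (Nat.div_le_div_right hi.le)
  have bj : j / s < nI := Nat.lt_succ_of_le (Nat.div_le_div_right hj.le)
  have bt : t / s < nT := Nat.lt_succ_of_le (Nat.div_le_div_right ht.le)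
  have dm : ∀ a b c : ℕ, b < c → (a * c + b) / c = a ∧ (a * c + b) % c = b := fun a b c hbc => by
    constructor
    · rw [mul_comm, Nat.mul_add_div (by omega), Nat.div_eq_of_lt hbc, add_zero]
    · rw [mul_comm, Nat.mul_add_mod, Nat.mod_eq_of_lt hbc]
  -- The mixed radix number of scale, offset and block coordinates, inverse to the decoding in
  -- `blockOf`; `w` below does the same for the position inside the block.
  set g := (((l * 3 + v) * nI + i / s) * nI + j / s) * nT + t / s with hg
  have e1 : g / nT = ((l * 3 + v) * nI + i / s) * nI + j / s := (dm _ _ _ bt).1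
  have e2 : g % nT = t / s := (dm _ _ _ bt).2
  have e3 : g / nT / nI = (l * 3 + v) * nI + i / s := by rw [e1, (dm _ _ _ bj).1]
  have e4 : g / nT % nI = j / s := by rw [e1, (dm _ _ _ bj).2]
  have e5 : g / nT / nI / nI = l * 3 + v := by rw [e3, (dm _ _ _ bi).1]
  have e6 : g / nT / nI % nI = i / s := by rw [e3, (dm _ _ _ bi).2]
  have lift : ∀ a b c e : ℕ, a < e → b < c → a * c + b < e * c := fun a b c e hae hbc => by
    have := Nat.mul_le_mul_right c (show a + 1 ≤ e from hae)
    rw [add_mul, one_mul] at this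
    omega
  have hgN : g < numBlocks n T d L :=
    lift _ _ _ _ (lift _ _ _ _ (lift _ _ _ _ (lift _ _ _ _ hl hv) bi) bj) bt
  set w := (i % s * s + j % s) * s + t % s with hw
  have mi : i % s < s := Nat.mod_lt _ hspos
  have mj : j % s < s := Nat.mod_lt _ hspos
  have mt : t % s < s := Nat.mod_lt _ hspos
  have hw8 : w < 8 ^ d := by
    rw [← h8, ← mul_assoc]
    exact lift _ _ _ _ (lift _ _ _ _ mi mj) mt
  set K := blockOf f0 f1 f2 n T d p g with hK
  have c1 : K.ci w = i % s := by
    change w / (s * s) = _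
    rw [← Nat.div_div_eq_div_mul, (dm _ _ _ mt).1, (dm _ _ _ mj).1]
  have c2 : K.cj w = j % s := by
    change w / s % s = _
    rw [(dm _ _ _ mt).1, (dm _ _ _ mj).2]
  have c3 : K.ct w = t % s := (dm _ _ _ mt).2
  have i1 : K.I (K.ci w) = i := by
    rw [c1]
    change clamp (g / nT / nI % nI * s + i % s) n = i
    rw [e6, mul_comm, Nat.div_add_mod, clamp_of_lt hi]
  have i2 : K.J (K.cj w) = j := by
    rw [c2]
    change clamp (g / nT % nI * s + j % s) n = j
    rw [e4, mul_comm, Nat.div_add_mod, clamp_of_lt hj]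
  have i3 : K.U (K.ct w) = t := by
    rw [c3]
    change clamp (g % nT * s + t % s) T = t
    rw [e2, mul_comm, Nat.div_add_mod, clamp_of_lt ht]
  have x1 : K.x (K.ci w) (K.cj w) = f0 (4 + i * n + j) := by
    unfold Block.x; rw [i1, i2]; rfl
  have y1 : K.y (K.ct w) (K.ci w) = f1 (t * n + i) := by
    unfold Block.y; rw [i1, i3]; rfl
  have z1 : K.z (K.cj w) (K.ct w) = f2 (t * n + j) := by
    unfold Block.z; rw [i2, i3]; rfl
  have hh : K.h = 2 ^ l := by
    change 2 ^ (g / nT / nI / nI / 3) = _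
    rw [e5]; congr 1; omega
  have hv' : K.v = v + 1 := by
    change g / nT / nI / nI % 3 + 1 = _
    rw [e5]; omega
  have hgood : K.Good w := by
    refine h g hgN w hw8 ?_
    unfold Block.Res Block.zres
    rw [x1, y1, z1, hh, hv']
    exact residue_of_eq hp heq
  unfold Block.Good at hgood
  rw [x1, y1, z1] at hgood
  have := div_le_cdiv_add_cdiv (h := 2 ^ l) (by positivity) hgood
  omega

/-- Guess the size `2 ^ d` of the blocks and the modulus `p`. -/
def paramProg : Stmt :=
  .pick 6 ;; .pick 22 ;; .set 7 (.var 22 + 1) ;; .set 8 1 ;; .set 9 1 ;; .set 10 1 ;; .set 11 3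

def paramLoop : Stmt :=
  .for 29 30 (.var 6) (.set 8 (.var 8 * 2) ;; .set 9 (.var 9 * 4) ;; .set 10 (.var 10 * 7) ;;
    .set 11 (.var 11 * 8))

/-- Tabulate the powers of `X`. -/
def powProg : Stmt :=
  .put 3 0 1 ;;
  .for 31 32 (.var 7) (.put 3 (.var 31 + 1) (.get 3 (.var 31) * .var 11)) ;;
  .set 12 (.get 3 (.var 7) - 1)

/-- Tabulate the coefficients of Strassen's algorithm. -/
def coeffProg : Stmt :=
  .set 35 (.lit strassenCode) ;;
  .for 33 34 (.lit 84) (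
    .put 4 (.var 33) (.var 35 % 3 % 2 + .var 35 % 3 / 2 * (.var 12 - 1)) ;;
    .set 35 (.var 35 / 3))

/-- Tabulate rows and columns of the interleaved order. -/
def mortProg : Stmt :=
  .put 5 0 0 ;; .put 6 0 0 ;;
  .for 36 37 (.var 9) (
    .put 5 (.var 36) (2 * .get 5 (.var 36 / 4) + .var 36 % 4 / 2) ;;
    .put 6 (.var 36) (2 * .get 6 (.var 36 / 4) + .var 36 % 2))

def setupProg : Stmt := paramProg ;; paramLoop ;; powProg ;; coeffProg ;; mortProg

/-- The state after the setup. -/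
structure Setup (d p : ℕ) (s : State) : Prop where
  yates : YatesEnv 0 d ((3 * 8 ^ d) ^ p - 1) s
  r7 : s.reg 7 = p
  r8 : s.reg 8 = 2 ^ d
  r11 : s.reg 11 = 3 * 8 ^ d
  m3 : ∀ e < p, s.mem 3 e = (3 * 8 ^ d) ^ e
  m5 : ∀ q < 4 ^ d, s.mem 5 q = mrow q
  m6 : ∀ q < 4 ^ d, s.mem 6 q = mcol q
  p_pos : 0 < p

/-! ### Correctness of the setup -/

section Setup

variable {m : Bool} {s : State} {B d p : ℕ}

theorem paramLoop_ok (h6 : s.reg 6 = d) (h8 : s.reg 8 = 1) (h9 : s.reg 9 = 1) (h10 : s.reg 10 = 1)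
    (h11 : s.reg 11 = 3) (hB : m = true → 3 * 8 ^ d < 2 ^ B) :
    Ok m paramLoop s (fun s' => s'.reg 8 = 2 ^ d ∧ s'.reg 9 = 4 ^ d ∧ s'.reg 10 = 7 ^ d ∧
      s'.reg 11 = 3 * 8 ^ d) B (d + 1) := by
  have hd : d < 8 ^ d := Nat.lt_pow_self (by norm_num)
  refine Ok.for (c := 1) (I := fun i s' => s'.reg 8 = 2 ^ i ∧ s'.reg 9 = 4 ^ i ∧ s'.reg 10 = 7 ^ i ∧
    s'.reg 11 = 3 * 8 ^ i) d (by simp [h6]) (fun hm => ?_) (by simp [Stmt.vars]) ?_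
    (by simp [h8, h9, h10, h11]) ?_ (fun _ => by omega)
  · have := hB hm; simp only [Small_var, h6]; omega
  · intro i s s' hag h
    simpa [hag.1] using h
  · intro i hi s₁ hs₁ h29 hI
    have b1 : m = true → 2 ^ i < 2 ^ B ∧ 4 ^ i < 2 ^ B ∧ 7 ^ i < 2 ^ B ∧ 3 * 8 ^ i < 2 ^ B :=
      fun hm => by
        have := hB hm
        have c1 : 8 ^ i ≤ 8 ^ d := Nat.pow_le_pow_right (by norm_num) hi.le
        have c2 : 2 ^ i ≤ 8 ^ i := Nat.pow_le_pow_left (by norm_num) _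
        have c3 : 4 ^ i ≤ 8 ^ i := Nat.pow_le_pow_left (by norm_num) _
        have c4 : 7 ^ i ≤ 8 ^ i := Nat.pow_le_pow_left (by norm_num) _
        omega
    refine Ok.wp ?_ fun _ => le_rfl
    simp only [wp, Small_mul, Small_var, Small_two, Small_four, Small_seven, Small_eight, eval_mul,
      eval_var, eval_two, eval_four, eval_seven, eval_eight, State.setReg_reg, Nat.reduceEqDiff,
      reduceIte, hI, and_true]
    refine ⟨fun hm => (b1 hm).1, fun hm => (b1 hm).2.1, fun hm => (b1 hm).2.2.1,
      fun hm => (b1 hm).2.2.2, ?_, ?_, ?_, ?_⟩ <;> ring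

theorem powProg_ok (h7 : s.reg 7 = p) (h11 : s.reg 11 = 3 * 8 ^ d) (hp : 0 < p)
    (hB : m = true → p < 2 ^ B ∧ (3 * 8 ^ d) ^ p < 2 ^ B) :
    Ok m powProg s (fun s' => s'.reg 12 = (3 * 8 ^ d) ^ p - 1 ∧
      ∀ e < p, s'.mem 3 e = (3 * 8 ^ d) ^ e) B (p + 1) := by
  set X := 3 * 8 ^ d with hX
  have hX0 : 0 < X := by positivity
  have hXe : m = true → ∀ e ≤ p, X ^ e < 2 ^ B := fun hm e he =>
    (Nat.pow_le_pow_right hX0 he).trans_lt (hB hm).2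
  refine Ok.seq (n₁ := 1) (n₂ := p + 1) (P := fun s' => s'.mem 3 0 = 1)
    (Ok.wp ⟨fun _ => by simp, by simp [State.setMem_mem]⟩ fun _ => le_rfl) (fun s₁ hs₁ h0 => ?_)
    (by omega)
  have k7 : s₁.reg 7 = p := (hs₁.1 7 (by simp [Stmt.vars])).trans h7
  have k11 : s₁.reg 11 = X := (hs₁.1 11 (by simp [Stmt.vars])).trans h11
  refine Ok.seq (n₁ := p + 1) (n₂ := 1) (Ok.for (c := 1)
    (I := fun i s' => ∀ e ≤ i, s'.mem 3 e = X ^ e) p (by simp [k7])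
    (fun hm => by simp only [Small_var, k7]; exact ⟨(hB hm).1, (hB hm).1⟩) (by simp [Stmt.vars]) ?_
    (by simpa using h0) ?_ (fun _ => by omega)) (fun s₂ hs₂ hI => ?_) (by omega)
  · intro i s s' hag h
    simpa [hag.2] using h
  · intro i hi s₂ hs₂ h31 hI
    have j11 : s₂.reg 11 = X := (hs₂.1 11 (by simp [Stmt.vars])).trans k11
    refine Ok.wp ⟨fun hm => ?_, fun e he => ?_⟩ fun _ => le_rfl
    · have c1 := hXe hm i hi.le
      have c2 := (hB hm).1
      have c3 : X < 2 ^ B := by simpa using hXe hm 1 hp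
      have c4 : i < 2 ^ B := by omega
      simp [h31, hI i le_rfl, j11, c1, c3, c4]
    · simp only [State.setMem_mem, eval_add, eval_var, eval_one, h31, true_and, eval_mul, eval_get,
        hI i le_rfl, j11]
      split_ifs with he'
      · rw [he', pow_succ]
      · exact hI e (by omega)
  · have j7 : s₂.reg 7 = p := (hs₂.1 7 (by simp [Stmt.vars, Stmt.for])).trans k7
    refine Ok.wp ⟨fun hm => ?_, ?_, fun e he => hI e he.le⟩ fun _ => le_rfl
    · simp only [Small_sub, Small_get, Small_var, eval_var, j7, hI p le_rfl, Small_one, and_true]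
      exact hB hm
    · simp [State.setReg_reg, j7, hI p le_rfl]

theorem coeffProg_ok {M : ℕ} (h12 : s.reg 12 = M) (hB : m = true → 128 ≤ B ∧ M < 2 ^ B) :
    Ok m coeffProg s (fun s' => ∀ i < 84, s'.mem 4 i = strassenMod M i) B 85 := by
  have hcode : m = true → ∀ i, strassenCode / 3 ^ i < 2 ^ B := fun hm i => by
    refine (Nat.div_le_self _ _).trans_lt ?_
    refine lt_of_lt_of_le ?_ (Nat.pow_le_pow_right (by norm_num) (hB hm).1)
    unfold strassenCode; norm_num
  refine Ok.seq (n₁ := 1) (n₂ := 85) (P := fun s' => s'.reg 35 = strassenCode)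
    (Ok.wp ⟨fun _ => by simp, by simp [State.setReg_reg]⟩ fun _ => le_rfl) (fun s₁ hs₁ h35 => ?_)
    (by omega)
  have k12 : s₁.reg 12 = M := (hs₁.1 12 (by simp [Stmt.vars])).trans h12
  refine Ok.mono (Ok.for (c := 1) (n := 85) (I := fun i s' => s'.reg 35 = strassenCode / 3 ^ i ∧
    ∀ j < i, s'.mem 4 j = strassenMod M j) 84 (by simp) (fun hm => ?_) (by simp [Stmt.vars]) ?_
    (by simp [h35]) ?_ (fun _ => by omega)) (fun _ _ h => h.2) fun _ => le_rfl
  · simp only [Small_lit, true_and]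
    exact lt_of_lt_of_le (b := 2 ^ 128) (by norm_num) (Nat.pow_le_pow_right (by norm_num) (hB hm).1)
  · intro i s s' hag h
    simpa [hag.1, hag.2] using h
  · intro i hi s₂ hs₂ h33 hI
    have j12 : s₂.reg 12 = M := (hs₂.1 12 (by simp [Stmt.vars])).trans k12
    refine Ok.wp ?_ fun _ => le_rfl
    simp only [wp, Small_add, Small_mul, Small_mod, Small_div, Small_sub, Small_var, Small_two,
      Small_three, Small_one, eval_add, eval_mul, eval_div, eval_mod, eval_sub, eval_var, eval_two,
      eval_three, eval_one, State.setReg_reg, State.setMem_reg, State.setReg_mem, State.setMem_mem,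
      h33, hI.1, j12, reduceIte, true_and, and_true]
    refine ⟨fun hm => ?_, fun hm => hcode hm i, ?_, fun j hj => ?_⟩
    · have c1 := hcode hm i
      have c2 : i < 2 ^ B := hi.trans (lt_of_lt_of_le (b := 2 ^ 128) (by norm_num)
        (Nat.pow_le_pow_right (by norm_num) (hB hm).1))
      simp only [c1, c2, (hB hm).2, and_self]
    · rw [Nat.div_div_eq_div_mul, pow_succ]
    · by_cases hj' : j = i
      · subst hj'; simp [strassenMod]
      · rw [if_neg hj', hI.2 j (by omega)]

theorem mortProg_ok (h9 : s.reg 9 = 4 ^ d) (hB : m = true → 4 ^ d < 2 ^ B) :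
    Ok m mortProg s (fun s' => ∀ q < 4 ^ d, s'.mem 5 q = mrow q ∧ s'.mem 6 q = mcol q)
      B (4 ^ d + 1) := by
  refine Ok.seq (n₁ := 1) (n₂ := 4 ^ d + 1) (P := fun s' => s'.mem 5 0 = 0)
    (Ok.wp ⟨fun _ => by simp, by simp [State.setMem_mem]⟩ fun _ => le_rfl) (fun s₁ hs₁ h0 => ?_)
    (by omega)
  refine Ok.seq (n₁ := 1) (n₂ := 4 ^ d + 1) (P := fun s' => s'.mem 6 0 = 0)
    (Ok.wp ⟨fun _ => by simp, by simp [State.setMem_mem]⟩ fun _ => le_rfl) (fun s₂ hs₂ h0' => ?_)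
    (by omega)
  have k9 : s₂.reg 9 = 4 ^ d := by
    rw [hs₂.1 9 (by simp [Stmt.vars]), hs₁.1 9 (by simp [Stmt.vars]), h9]
  have k5 : s₂.mem 5 0 = 0 := by rw [hs₂.2 5 (by simp [Stmt.arrs]), h0]
  refine Ok.mono (Ok.for (c := 1) (n := 4 ^ d + 1) (I := fun i s' => (s'.mem 5 0 = 0 ∧ s'.mem 6 0 = 0) ∧
    ∀ q < i, s'.mem 5 q = mrow q ∧ s'.mem 6 q = mcol q) (4 ^ d) (by simp [k9])
    (fun hm => by simp only [Small_var, k9]; exact ⟨hB hm, hB hm⟩) (by simp [Stmt.vars]) ?_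
    (by simp [k5, h0']) ?_ (fun _ => by omega)) (fun _ _ h => h.2) fun _ => le_rfl
  · intro i s s' hag h
    simpa [hag.2] using h
  · intro q hq s₃ hs₃ h36 hI
    -- For `q = 0` the cell read is the one about to be written; this is why cell 0 is initialised
    -- before the loop.
    have v5 : s₃.mem 5 (q / 4) = mrow (q / 4) := by
      rcases Nat.eq_zero_or_pos q with h | h
      · subst h; simp [hI.1, mrow]
      · exact (hI.2 (q / 4) (by omega)).1
    have v6 : s₃.mem 6 (q / 4) = mcol (q / 4) := by
      rcases Nat.eq_zero_or_pos q with h | h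
      · subst h; simp [hI.1, mcol]
      · exact (hI.2 (q / 4) (by omega)).2
    have bnd : m = true → q < 2 ^ B ∧ mrow (q / 4) < 2 ^ B ∧ mcol (q / 4) < 2 ^ B := fun hm => by
      have h1 := mrow_lt (k := d) (q := q / 4) (by omega)
      have h2 := mcol_lt (k := d) (q := q / 4) (by omega)
      have h3 : 2 ^ d ≤ 4 ^ d := Nat.pow_le_pow_left (by norm_num) _
      have := hB hm
      omega
    refine Ok.wp ?_ fun _ => le_rfl
    simp only [wp, Small_add, Small_mul, Small_mod, Small_div, Small_get, Small_var, Small_two,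
      Small_four, eval_add, eval_mul, eval_div, eval_mod, eval_get, eval_var, eval_two, eval_four,
      State.setMem_reg, State.setMem_mem, h36, v5, v6, Nat.reduceEqDiff, false_and, reduceIte,
      true_and]
    refine ⟨fun hm => by simp only [bnd hm, and_self], fun hm => by simp only [bnd hm, and_self],
      ⟨?_, ?_⟩, fun q' hq' => ⟨?_, ?_⟩⟩
    · split_ifs with h
      · subst h; simp [mrow]
      · exact hI.1.1
    · split_ifs with h
      · subst h; simp [mcol]
      · exact hI.1.2
    · split_ifs with h
      · rw [h, mrow_eq q]
      · exact (hI.2 q' (by omega)).1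
    · split_ifs with h
      · rw [h, mcol_eq q]
      · exact (hI.2 q' (by omega)).2

/-- Completeness needs the prescribed `d₀` and `p₀`, while soundness holds for whatever was guessed.
In particular the primality of the modulus is never verified. -/
theorem setupProg_ok (d₀ p₀ : ℕ) (hp₀ : 0 < p₀) (hB : m = true → 128 ≤ B ∧ p₀ < 2 ^ B ∧
      (3 * 8 ^ d₀) ^ p₀ < 2 ^ B) :
    Ok m setupProg s (fun s' => ∃ d p, (m = true → d = d₀ ∧ p = p₀) ∧ Setup d p s') B
      (p₀ + 7 ^ d₀ + 100) := by
  have hd8 : d₀ < 8 ^ d₀ := Nat.lt_pow_self (by norm_num)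
  have hd7 : d₀ < 7 ^ d₀ := Nat.lt_pow_self (by norm_num)
  have hX : m = true → 3 * 8 ^ d₀ < 2 ^ B := fun hm => lt_of_le_of_lt (by
    calc 3 * 8 ^ d₀ = (3 * 8 ^ d₀) ^ 1 := (pow_one _).symm
      _ ≤ _ := Nat.pow_le_pow_right (by positivity) hp₀) (hB hm).2.2
  refine Ok.seq (n₁ := 1) (n₂ := p₀ + 7 ^ d₀ + 100)
    (P := fun s' => ∃ d p, 0 < p ∧ (m = true → d = d₀ ∧ p = p₀) ∧ s'.reg 6 = d ∧ s'.reg 7 = p ∧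
      s'.reg 8 = 1 ∧ s'.reg 9 = 1 ∧ s'.reg 10 = 1 ∧ s'.reg 11 = 3)
    (Ok.wp ?_ fun _ => le_rfl) (fun s₁ hs₁ hP => ?_) (by omega)
  · have key : ∀ dd pp, (m = true → dd = d₀ ∧ pp + 1 = p₀) →
      wp m B (.set 7 (.var 22 + 1) ;; .set 8 1 ;; .set 9 1 ;; .set 10 1 ;; .set 11 3)
        ((s.setReg 6 dd).setReg 22 pp) (fun s' => ∃ d p, 0 < p ∧ (m = true → d = d₀ ∧ p = p₀) ∧
        s'.reg 6 = d ∧ s'.reg 7 = p ∧ s'.reg 8 = 1 ∧ s'.reg 9 = 1 ∧ s'.reg 10 = 1 ∧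
        s'.reg 11 = 3) := by
      intro dd pp h
      simp only [wp, Small_add, Small_var, Small_one, Small_three, eval_add, eval_var, eval_one,
        eval_three, State.setReg_reg, Nat.reduceEqDiff, reduceIte, and_true, implies_true,
        exists_eq_right_right', true_and]
      refine ⟨fun hm => ?_, dd, pp + 1, by omega, h, rfl, rfl⟩
      have := hB hm
      have := h hm
      omega
    -- The guess is `p₀ - 1` because the program adds one, which makes the modulus positive in every
    -- run.
    refine ⟨fun hm => ⟨d₀, by have := hX hm; omega, fun _ => ⟨p₀ - 1, by have := hB hm; omega,
      key _ _ fun _ => ⟨rfl, by omega⟩⟩, fun hm' => by simp [hm] at hm'⟩,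
      fun hm dd => ⟨fun hm' => by simp [hm] at hm', fun _ pp =>
        key dd pp fun hm' => by simp [hm] at hm'⟩⟩
  · obtain ⟨d, p, hp, hdp, h6, h7, h8, h9, h10, h11⟩ := hP
    have hdp' : m = true → 3 * 8 ^ d < 2 ^ B ∧ p < 2 ^ B ∧ (3 * 8 ^ d) ^ p < 2 ^ B ∧ 128 ≤ B ∧
        d = d₀ ∧ p = p₀ := fun hm => by
      obtain ⟨rfl, rfl⟩ := hdp hm
      exact ⟨hX hm, (hB hm).2.1, (hB hm).2.2, (hB hm).1, rfl, rfl⟩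
    have h48 : 4 ^ d ≤ 8 ^ d := Nat.pow_le_pow_left (by norm_num) _
    have h47 : 4 ^ d ≤ 7 ^ d := Nat.pow_le_pow_left (by norm_num) _
    refine Ok.seq (paramLoop_ok h6 h8 h9 h10 h11 fun hm => (hdp' hm).1) (fun s₂ hs₂ hP₂ => ?_)
      (n₂ := p₀ + 7 ^ d₀ + 100) fun hm => by have := hdp hm; omega
    have v2 : (paramLoop).vars = [30, 29, 8, 9, 10, 11, 29, 30] := rfl
    have a2 : (paramLoop).arrs = [] := rfl
    rw [v2, a2] at hs₂
    have k7 : s₂.reg 7 = p := (hs₂.1 7 (by simp)).trans h7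
    refine Ok.seq (powProg_ok k7 hP₂.2.2.2 hp fun hm => ⟨(hdp' hm).2.1, (hdp' hm).2.2.1⟩)
      (fun s₃ hs₃ hP₃ => ?_) (n₂ := p₀ + 7 ^ d₀ + 100) fun hm => by have := hdp hm; omega
    have v3 : (powProg).vars = [32, 31, 31, 32, 12] := rfl
    have a3 : (powProg).arrs = [3, 3] := rfl
    rw [v3, a3] at hs₃
    refine Ok.seq (coeffProg_ok hP₃.1 fun hm => ⟨(hdp' hm).2.2.2.1, by
      have := (hdp' hm).2.2.1; omega⟩) (fun s₄ hs₄ hP₄ => ?_) (n₂ := p₀ + 7 ^ d₀ + 100) fun hm => by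
        omega
    have v4 : (coeffProg).vars = [35, 34, 33, 35, 33, 34] := rfl
    have a4 : (coeffProg).arrs = [4] := rfl
    rw [v4, a4] at hs₄
    have k9 : s₄.reg 9 = 4 ^ d := by
      rw [hs₄.1 9 (by simp), hs₃.1 9 (by simp), hP₂.2.1]
    refine (mortProg_ok k9 fun hm => by have := (hdp' hm).1; omega).mono (fun s₅ hs₅ hP₅ => ?_)
      fun hm => by
        have := hdp hm
        have : 4 ^ d ≤ 7 ^ d₀ := by rw [← this.1]; exact h47
        omega
    have v5 : (mortProg).vars = [37, 36, 36, 37] := rfl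
    have a5 : (mortProg).arrs = [5, 6, 5, 6] := rfl
    rw [v5, a5] at hs₅
    have h83 : 3 ≤ 3 * 8 ^ d := Nat.le_mul_of_pos_right _ (by positivity)
    have hpow : 3 * 8 ^ d ≤ (3 * 8 ^ d) ^ p := by
      calc 3 * 8 ^ d = (3 * 8 ^ d) ^ 1 := (pow_one _).symm
        _ ≤ _ := Nat.pow_le_pow_right (by positivity) hp
    have q3 : s₅.mem 3 = s₃.mem 3 := by rw [hs₅.2 3 (by simp), hs₄.2 3 (by simp)]
    have q4 : s₅.mem 4 = s₄.mem 4 := by rw [hs₅.2 4 (by simp)]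
    have r : ∀ x ∈ [6, 7, 8, 9, 10, 11], s₅.reg x = s₂.reg x := fun x hx => by
      fin_cases hx <;> rw [hs₅.1 _ (by simp), hs₄.1 _ (by simp), hs₃.1 _ (by simp)]
    refine ⟨d, p, hdp, ⟨⟨?_, ?_, ?_, ?_, by rw [q4]; exact hP₄, by norm_num, by omega⟩, ?_, ?_, ?_,
      by rw [q3]; exact hP₃.2, fun q hq => (hP₅ q hq).1, fun q hq => (hP₅ q hq).2, hp⟩⟩
    · rw [r 6 (by simp), hs₂.1 6 (by simp), h6]
    · rw [r 9 (by simp), hP₂.2.1]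
    · rw [r 10 (by simp), hP₂.2.2.1]
    · rw [hs₅.1 12 (by simp), hs₄.1 12 (by simp), hP₃.1]
    · rw [r 7 (by simp), k7]
    · rw [r 8 (by simp), hP₂.1]
    · rw [r 11 (by simp), hP₂.2.2.2]

end Setup

/-! ### The loop over all blocks -/

/-- Compute the data of the block with number `var 40`. -/
def decodeProg : Stmt :=
  .set 44 (.var 40 % .var 16 * .var 8) ;;
  .set 43 (.var 40 / .var 16 % .var 15 * .var 8) ;;
  .set 42 (.var 40 / .var 16 / .var 15 % .var 15 * .var 8) ;;
  .set 45 (.var 40 / .var 16 / .var 15 / .var 15 % 3 + 1) ;;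
  .set 46 (.get 7 (.var 40 / .var 16 / .var 15 / .var 15 / 3))

def blockProg : Stmt := decodeProg ;; countProg ;; listProg

def triLoop : Stmt := .for 40 41 (.var 13 * 3 * .var 15 * .var 15 * .var 16) blockProg

def triProg : Stmt := .set 15 (.var 0 / .var 8 + 1) ;; .set 16 (.var 2 / .var 8 + 1) ;; triLoop

/-- The state holds the three arrays, the powers of two below `2 ^ L`, and the setup. -/
structure TriEnv (f0 f1 f2 : ℕ → ℕ) (n T d p L : ℕ) (s : State) : Prop where
  setup : Setup d p s
  r0 : s.reg 0 = n
  r2 : s.reg 2 = T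
  r13 : s.reg 13 = L
  m0 : s.mem 0 = f0
  m1 : s.mem 1 = f1
  m2 : s.mem 2 = f2
  m7 : ∀ l < L, s.mem 7 l = 2 ^ l
  n_pos : 0 < n
  T_pos : 0 < T

/-- Bounds for the numbers that occur in the loop over all blocks. -/
structure TriBounded (f0 f1 f2 : ℕ → ℕ) (n T d p L b B : ℕ) : Prop where
  bB : b ≤ B
  two_le : 2 ≤ b
  L_pos : 0 < L
  L_le : L ≤ b
  G_lt : numBlocks n T d L < 2 ^ b
  n_lt : n < 2 ^ b
  T_lt : T < 2 ^ b
  p_lt : p < 2 ^ b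
  d_lt : 8 ^ d < 2 ^ b
  x_lt : ∀ i < n, ∀ j < n, f0 (4 + i * n + j) < 2 ^ b
  y_lt : ∀ t < T, ∀ i < n, f1 (t * n + i) < 2 ^ b
  z_lt : ∀ t < T, ∀ j < n, f2 (t * n + j) < 2 ^ b
  X_lt : (3 * 8 ^ d) ^ p < 2 ^ B

section Tri

variable {f0 f1 f2 : ℕ → ℕ} {n T d p L b B : ℕ} {m : Bool} {s : State}

theorem level_lt {g : ℕ} (hg : g < numBlocks n T d L) :
    g / (T / 2 ^ d + 1) / (n / 2 ^ d + 1) / (n / 2 ^ d + 1) / 3 < L := by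
  unfold numBlocks at hg
  refine Nat.div_lt_of_lt_mul ?_
  refine Nat.div_lt_of_lt_mul ?_
  refine Nat.div_lt_of_lt_mul ?_
  refine Nat.div_lt_of_lt_mul ?_
  calc g < _ := hg
    _ = _ := by ring

theorem TriBounded.block (h : TriBounded f0 f1 f2 n T d p L b B) {g : ℕ}
    (hg : g < numBlocks n T d L) : (blockOf f0 f1 f2 n T d p g).Bounded b B := by
  have hs : 0 < 2 ^ d := by positivity
  have key : ∀ a N, N < 2 ^ b → a % (N / 2 ^ d + 1) * 2 ^ d < 2 ^ b := fun a N hN => by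
    have h1 : a % (N / 2 ^ d + 1) ≤ N / 2 ^ d := Nat.le_of_lt_succ (Nat.mod_lt _ (Nat.succ_pos _))
    exact lt_of_le_of_lt ((Nat.mul_le_mul_right _ h1).trans (Nat.div_mul_le_self _ _)) hN
  have h4 : 4 ≤ 2 ^ b := by
    calc 4 = 2 ^ 2 := by norm_num
      _ ≤ 2 ^ b := Nat.pow_le_pow_right (by norm_num) h.two_le
  refine ⟨h.bB, h.n_lt, h.T_lt, h.p_lt, h.d_lt, key _ _ h.n_lt, key _ _ h.n_lt, key _ _ h.T_lt, ?_, ?_,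
    h.x_lt, h.y_lt, h.z_lt, h.X_lt⟩
  · change _ % 3 + 1 < _
    omega
  · exact Nat.pow_lt_pow_right (by norm_num) ((level_lt hg).trans_le h.L_le)

theorem TriBounded.sizes (h : TriBounded f0 f1 f2 n T d p L b B) : n / 2 ^ d + 1 < 2 ^ b ∧
    T / 2 ^ d + 1 < 2 ^ b ∧ L < 2 ^ b ∧ 3 < 2 ^ b := by
  have h1 := h.G_lt
  have hL := h.L_pos
  have h5 : n / 2 ^ d + 1 ≤ numBlocks n T d L := by
    unfold numBlocks
    calc n / 2 ^ d + 1 = 1 * 1 * 1 * (n / 2 ^ d + 1) * 1 := by ring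
      _ ≤ _ := by gcongr <;> first | omega | exact Nat.succ_pos _
  have h6 : T / 2 ^ d + 1 ≤ numBlocks n T d L := by
    unfold numBlocks
    calc T / 2 ^ d + 1 = 1 * 1 * 1 * 1 * (T / 2 ^ d + 1) := by ring
      _ ≤ _ := by gcongr <;> first | omega | exact Nat.succ_pos _
  have h7 : L * 3 ≤ numBlocks n T d L := by
    unfold numBlocks
    calc L * 3 = L * 3 * 1 * 1 * 1 := by ring
      _ ≤ _ := by gcongr <;> first | omega | exact Nat.succ_pos _
  omega

theorem TriEnv.of_agree {vs ks : List ℕ} {s' : State} (E : TriEnv f0 f1 f2 n T d p L s)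
    (hag : AgreeOff vs ks s s') (hv : ∀ x ∈ vs, x = 22 ∨ x = 15 ∨ x = 16 ∨ 40 ≤ x)
    (hk : ∀ k ∈ ks, 8 ≤ k) : TriEnv f0 f1 f2 n T d p L s' := by
  have g : ∀ x < 40, x ≠ 22 → x ≠ 15 → x ≠ 16 → s'.reg x = s.reg x := fun x hx h1 h2 h3 =>
    hag.1 x fun h' => by have := hv x h'; omega
  have gm : ∀ k < 8, s'.mem k = s.mem k := fun k hk' => hag.2 k fun h' => by
    have := hk k h'; omega
  obtain ⟨⟨⟨a1, a2, a3, a4, a5, a6, a7⟩, b1, b2, b3, b4, b5, b6, b7⟩, c1, c2, c3, c4, c5, c6, c7,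
    c8, c9⟩ := E
  refine ⟨⟨⟨?_, ?_, ?_, ?_, ?_, a6, a7⟩, ?_, ?_, ?_, ?_, ?_, ?_, b7⟩, ?_, ?_, ?_, ?_, ?_, ?_, ?_,
    c8, c9⟩
  all_goals first | (rw [g _ (by norm_num) (by norm_num) (by norm_num) (by norm_num)]; assumption) |
    (rw [gm _ (by norm_num)]; assumption)

theorem countProg_vars : ∀ x ∈ countProg.vars, x = 22 ∨ 50 ≤ x := by
  simp [Stmt.vars, Stmt.for, countProg, fillProg, sumProg, yatesProg, yatesRound, yatesCell]

theorem countProg_arrs : ∀ k ∈ countProg.arrs, 8 ≤ k := by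
  simp [Stmt.arrs, Stmt.for, countProg, fillProg, sumProg, yatesProg, yatesRound, yatesCell]

/-- Two bit lengths have to be kept apart: the transform works with `B` bits, whereas decoding and
listing cost only `b` bits per step. A common unit would charge every false positive for long
numbers and lose the saving. -/
theorem blockProg_tr {g : ℕ} (E : TriEnv f0 f1 f2 n T d p L s) (h15 : s.reg 15 = n / 2 ^ d + 1)
    (h16 : s.reg 16 = T / 2 ^ d + 1) (h40 : s.reg 40 = g) (hg : g < numBlocks n T d L)
    (hB : m = true → TriBounded f0 f1 f2 n T d p L b B)
    (hgood : m = true → ∀ w < 8 ^ d, (blockOf f0 f1 f2 n T d p g).Res w →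
      (blockOf f0 f1 f2 n T d p g).Good w) :
    Tr m blockProg s (fun _ => ∀ w < 8 ^ d, (blockOf f0 f1 f2 n T d p g).Res w →
      (blockOf f0 f1 f2 n T d p g).Good w)
      (decodeProg.weight * (b + 1) + (countProg.wt * ((d + 1) * (7 ^ d + 1) * (B + 1)) +
        listProg.wt * (((blockOf f0 f1 f2 n T d p g).count + 1) * (b + 1)))) := by
  set K := blockOf f0 f1 f2 n T d p g with hK
  have hl := level_lt hg
  have hs : m = true → n / 2 ^ d + 1 < 2 ^ b ∧ T / 2 ^ d + 1 < 2 ^ b ∧ g < 2 ^ b ∧ 2 ^ d < 2 ^ b ∧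
      2 ^ (g / (T / 2 ^ d + 1) / (n / 2 ^ d + 1) / (n / 2 ^ d + 1) / 3) < 2 ^ b := fun hm => by
    have h := hB hm
    have h1 := h.G_lt
    have h2 : 2 ^ d ≤ 8 ^ d := Nat.pow_le_pow_left (by norm_num) _
    have h3 := h.d_lt
    have h4 := h.sizes
    refine ⟨by omega, by omega, by omega, by omega, (h.block hg).h⟩
  refine Tr.seq (P := fun s' => s'.reg 42 = K.i0 ∧ s'.reg 43 = K.j0 ∧ s'.reg 44 = K.t0 ∧
    s'.reg 45 = K.v ∧ s'.reg 46 = K.h) (Tr.wp b ?_) fun s₁ hs₁ hP => ?_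
  · have m7 := E.m7 _ hl
    have r8 := E.setup.r8
    simp only [decodeProg, wp, Small_add, Small_mul, Small_mod, Small_div, Small_get, Small_var,
      Small_one, Small_three, eval_add, eval_mul, eval_div, eval_mod, eval_get, eval_var, eval_one,
      eval_three, State.setReg_reg, State.setReg_mem, Nat.reduceEqDiff, reduceIte, h15, h16, h40,
      r8, m7, and_true, true_and]
    refine ⟨fun hm => ?_, fun hm => ?_, fun hm => ?_, fun hm => ?_, fun hm => ?_, ?_⟩
    iterate 5 (have := hs hm; simp only [this, and_self])
    exact ⟨rfl, rfl, rfl, rfl, rfl⟩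
  · have E₁ := E.of_agree hs₁ (by simp [Stmt.vars, decodeProg]) (by simp [Stmt.arrs, decodeProg])
    have S := E₁.setup
    have KE : K.Env s₁ := ⟨S.yates, E₁.r0, E₁.r2, S.r7, S.r8, S.r11, hP.1, hP.2.1, hP.2.2.1,
      hP.2.2.2.1, hP.2.2.2.2, E₁.m0, E₁.m1, E₁.m2, S.m3, S.m5, S.m6, E₁.n_pos, E₁.T_pos, S.p_pos⟩
    refine Tr.seq (countProg_ok KE fun hm => (hB hm).block hg) fun s₂ hs₂ h73 => ?_
    have KE₂ := KE.of_agree hs₂ countProg_vars countProg_arrs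
    exact listProg_ok KE₂ h73 (fun hm => (hB hm).block hg) hgood

/-- A constant factor for the cost of `triProg`. -/
def triWeight : ℕ := triProg.wt

/-- The cost per block varies with its number of solutions, of which only the total is controlled;
hence the rule `Tr.for` with a sum in place of `Ok.for`. -/
theorem triProg_tr (E : TriEnv f0 f1 f2 n T d p L s)
    (hB : m = true → TriBounded f0 f1 f2 n T d p L b B)
    (hgood : m = true → ∀ g < numBlocks n T d L, ∀ w < 8 ^ d, (blockOf f0 f1 f2 n T d p g).Res w →
      (blockOf f0 f1 f2 n T d p g).Good w) :
    Tr m triProg s (fun _ => ∀ g < numBlocks n T d L, ∀ w < 8 ^ d,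
      (blockOf f0 f1 f2 n T d p g).Res w → (blockOf f0 f1 f2 n T d p g).Good w)
      (triWeight * ((numBlocks n T d L + 1) * ((d + 1) * (7 ^ d + 1)) * (B + 1) +
        (∑ g ∈ range (numBlocks n T d L), (blockOf f0 f1 f2 n T d p g).count) * (b + 1))) := by
  set G := numBlocks n T d L with hG
  have h2d : m = true → 2 ^ d < 2 ^ b := fun hm =>
    (Nat.pow_le_pow_left (by norm_num) _ : 2 ^ d ≤ 8 ^ d).trans_lt (hB hm).d_lt
  refine Tr.mono (Tr.seq (P := fun s' => s'.reg 15 = n / 2 ^ d + 1)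
    (Q := fun _ => ∀ g < G, ∀ w < 8 ^ d, (blockOf f0 f1 f2 n T d p g).Res w →
      (blockOf f0 f1 f2 n T d p g).Good w)
    (Tr.set b (fun hm => ?_) ?_) fun s₁ hs₁ h15 => Tr.seq
    (P := fun s' => s'.reg 15 = n / 2 ^ d + 1 ∧ s'.reg 16 = T / 2 ^ d + 1)
    (Q := fun _ => ∀ g < G, ∀ w < 8 ^ d, (blockOf f0 f1 f2 n T d p g).Res w →
      (blockOf f0 f1 f2 n T d p g).Good w)
    (Tr.set b (fun hm => ?_) ?_) fun s₂ hs₂ h => Tr.for (I := fun i _ => ∀ g < i, ∀ w < 8 ^ d,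
      (blockOf f0 f1 f2 n T d p g).Res w → (blockOf f0 f1 f2 n T d p g).Good w)
    (c := fun g => decodeProg.weight * (b + 1) + (countProg.wt * ((d + 1) * (7 ^ d + 1) * (B + 1)) +
        listProg.wt * (((blockOf f0 f1 f2 n T d p g).count + 1) * (b + 1)))) b G ?_ (fun hm => ?_)
      (by norm_num) (by simp [blockProg, Stmt.vars, Stmt.for, decodeProg, countProg, fillProg,
        sumProg, yatesProg, yatesRound, yatesCell, listProg, listStep])
      (by simp [blockProg, Stmt.vars, Stmt.for, decodeProg, countProg, fillProg,
        sumProg, yatesProg, yatesRound, yatesCell, listProg, listStep])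
      (fun _ _ _ _ h => h) (by simp) fun g hg s₃ hs₃ h40 hI => ?_) (fun _ _ h => h) fun hm => ?_
  · simp [E.r0, E.setup.r8, (hB hm).n_lt, h2d hm]
  · simp [E.r0, E.setup.r8, State.setReg_reg]
  · have E₁ := E.of_agree hs₁ (by simp [Stmt.vars]) (by simp [Stmt.arrs])
    simp [E₁.r2, E₁.setup.r8, (hB hm).T_lt, h2d hm]
  · have E₁ := E.of_agree hs₁ (by simp [Stmt.vars]) (by simp [Stmt.arrs])
    simp [E₁.r2, E₁.setup.r8, State.setReg_reg, h15]
  · have E₁ := E.of_agree hs₁ (by simp [Stmt.vars]) (by simp [Stmt.arrs])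
    have E₂ := E₁.of_agree hs₂ (by simp [Stmt.vars]) (by simp [Stmt.arrs])
    simp [E₂.r13, h.1, h.2, hG, numBlocks]
  · have E₁ := E.of_agree hs₁ (by simp [Stmt.vars]) (by simp [Stmt.arrs])
    have E₂ := E₁.of_agree hs₂ (by simp [Stmt.vars]) (by simp [Stmt.arrs])
    have hb := hB hm
    have h1 := hb.sizes
    have h2 := hb.G_lt
    refine ⟨?_, h2⟩
    simp only [Small_mul, Small_var, Small_three, E₂.r13, h.1, h.2, h1, and_self]
  · have E₁ := E.of_agree hs₁ (by simp [Stmt.vars]) (by simp [Stmt.arrs])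
    have E₂ := E₁.of_agree hs₂ (by simp [Stmt.vars]) (by simp [Stmt.arrs])
    have vb : ∀ x ∈ 40 :: 41 :: blockProg.vars, x = 22 ∨ x = 15 ∨ x = 16 ∨ 40 ≤ x := by
      simp [blockProg, Stmt.vars, Stmt.for, decodeProg, countProg, fillProg,
        sumProg, yatesProg, yatesRound, yatesCell, listProg, listStep]
    have vb' : 15 ∉ 40 :: 41 :: blockProg.vars ∧ 16 ∉ 40 :: 41 :: blockProg.vars := by
      simp [blockProg, Stmt.vars, Stmt.for, decodeProg, countProg, fillProg,
        sumProg, yatesProg, yatesRound, yatesCell, listProg, listStep]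
    have ab : ∀ k ∈ blockProg.arrs, 8 ≤ k := by
      simp [blockProg, Stmt.arrs, Stmt.for, decodeProg, countProg, fillProg,
        sumProg, yatesProg, yatesRound, yatesCell, listProg, listStep]
    have E₃ := E₂.of_agree hs₃ vb ab
    refine (blockProg_tr E₃ ((hs₃.1 15 vb'.1).trans h.1) ((hs₃.1 16 vb'.2).trans h.2) h40 hg hB
      fun hm => hgood hm g hg).mono (fun _ _ hq g' hg' => ?_) fun _ => le_rfl
    rcases Nat.lt_succ_iff_lt_or_eq.1 hg' with h' | rfl
    · exact hI g' h'
    · exact hq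
  · have hb := (hB hm).bB
    have wt1 : triWeight = (Stmt.set 15 (.var 0 / .var 8 + 1)).weight +
      ((Stmt.set 16 (.var 2 / .var 8 + 1)).weight + triLoop.wt) := rfl
    have wt2 : triLoop.wt = (decodeProg.wt + (countProg.wt + listProg.wt)) +
      Expr.forWeight (.var 13 * 3 * .var 15 * .var 15 * .var 16) + 5 := rfl
    have hw := decodeProg.weight_le_wt
    rw [wt1, wt2]
    generalize (Stmt.set 15 (.var 0 / .var 8 + 1)).weight = w1
    generalize (Stmt.set 16 (.var 2 / .var 8 + 1)).weight = w2
    generalize Expr.forWeight (.var 13 * 3 * .var 15 * .var 15 * .var 16) = w3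
    generalize countProg.wt = w4
    generalize listProg.wt = w5
    generalize decodeProg.wt = w6 at hw ⊢
    generalize decodeProg.weight = w7 at hw ⊢
    have hD : 0 < (d + 1) * (7 ^ d + 1) := by positivity
    generalize (d + 1) * (7 ^ d + 1) = D at hD ⊢
    have hsum : ∑ g ∈ range G, (w7 * (b + 1) + (w4 * (D * (B + 1)) +
        w5 * (((blockOf f0 f1 f2 n T d p g).count + 1) * (b + 1)))) =
        w7 * (G * (b + 1)) + w4 * (G * (D * (B + 1))) + w5 * (G * (b + 1)) +
        w5 * ((∑ g ∈ range G, (blockOf f0 f1 f2 n T d p g).count) * (b + 1)) := by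
      simp only [add_mul, mul_add, sum_add_distrib, ← mul_sum, ← sum_mul, sum_const, card_range,
        smul_eq_mul]
      ring
    rw [hsum]
    generalize ∑ g ∈ range G, (blockOf f0 f1 f2 n T d p g).count = C
    set P := (G + 1) * D * (B + 1) with hP
    have e1 : b + 1 ≤ P := by
      calc b + 1 = 1 * 1 * (b + 1) := by ring
        _ ≤ P := by rw [hP]; gcongr <;> omega
    have e2 : (G + 1) * (b + 1) ≤ P := by
      calc (G + 1) * (b + 1) = (G + 1) * 1 * (b + 1) := by ring
        _ ≤ P := by rw [hP]; gcongr; omega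
    have e3 : G * (b + 1) ≤ P := (Nat.mul_le_mul_right _ (by omega)).trans e2
    have e4 : G * (D * (B + 1)) ≤ P := by
      rw [hP, mul_assoc]; gcongr; omega
    calc _ = w1 * (b + 1) + (w2 * (b + 1) + (w7 * (G * (b + 1)) + w4 * (G * (D * (B + 1))) +
          w5 * (G * (b + 1)) + w5 * (C * (b + 1)) + w3 * ((G + 1) * (b + 1)))) := by ring
      _ ≤ w1 * P + (w2 * P + (w6 * P + w4 * P + w5 * P + w5 * (C * (b + 1)) + w3 * P)) := by gcongr
      _ ≤ (w1 + (w2 + (w6 + (w4 + w5) + w3 + 5))) * P +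
          (w1 + (w2 + (w6 + (w4 + w5) + w3 + 5))) * (C * (b + 1)) := by
        have : w5 * (C * (b + 1)) ≤ (w1 + (w2 + (w6 + (w4 + w5) + w3 + 5))) * (C * (b + 1)) :=
          Nat.mul_le_mul_right _ (by omega)
        nlinarith
      _ = _ := by ring

end Tri

/-! ### Instances stored in an array -/

/-- The transition cost from `i` to `j`, for an instance stored in the array `f`. -/
def inA (f : ℕ → ℕ) (i j : ℕ) : ℕ := f (4 + i * f 0 + j)

/-- The symbol observed at time `t`. -/
def inS (f : ℕ → ℕ) (t : ℕ) : ℕ := f (4 + f 0 * f 0 + f 0 * f 1 + t)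

/-- The cost of observing the symbol of time `t` in state `j`. -/
def inB (f : ℕ → ℕ) (t j : ℕ) : ℕ := f (4 + f 0 * f 0 + j * f 1 + inS f t)

/-- The first `t` steps of some state sequence that leads to `j` have cost at most `v`. -/
def Reach (f : ℕ → ℕ) (t j v : ℕ) : Prop :=
  ∃ u : ℕ → ℕ, u 0 = 0 ∧ u t = j ∧ (∀ s, u s < f 0) ∧
    ∑ s ∈ range t, (inA f (u s) (u (s + 1)) + inB f s (u (s + 1))) ≤ v

/-- The array stores a yes-instance. -/
def Yes (f : ℕ → ℕ) : Prop := ∃ j, Reach f (f 2) j (f 3)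

theorem optV_aux (f : ℕ → ℕ) (t j : ℕ) : ∃ v, f 3 + 1 ≤ v ∨ Reach f t j v := ⟨f 3 + 1, Or.inl le_rfl⟩

open Classical in
/-- The least cost of reaching `j` at time `t`, capped at the threshold plus one. -/
noncomputable def optV (f : ℕ → ℕ) (t j : ℕ) : ℕ := Nat.find (optV_aux f t j)

section OptV

variable {f : ℕ → ℕ}

theorem optV_le (t j : ℕ) : optV f t j ≤ f 3 + 1 := by
  classical exact Nat.find_min' _ (Or.inl le_rfl)

theorem optV_zero (hn : 0 < f 0) : optV f 0 0 = 0 := by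
  classical
  exact Nat.le_zero.1 (Nat.find_min' _ (Or.inr ⟨fun _ => 0, rfl, rfl, fun _ => hn, by simp⟩))

theorem Reach.succ {t i j v : ℕ} (h : Reach f t i v) (hj : j < f 0) :
    Reach f (t + 1) j (v + (inA f i j + inB f t j)) := by
  obtain ⟨u, h0, ht, hu, hs⟩ := h
  refine ⟨fun s => if s ≤ t then u s else j, by simpa, by simp, fun s => ?_, ?_⟩
  · dsimp only; split_ifs
    · exact hu s
    · exact hj
  · rw [sum_range_succ]
    have : ∀ s ∈ range t, (inA f (if s ≤ t then u s else j) (if s + 1 ≤ t then u (s + 1) else j) +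
        inB f s (if s + 1 ≤ t then u (s + 1) else j)) =
        inA f (u s) (u (s + 1)) + inB f s (u (s + 1)) := fun s hs => by
      have := mem_range.1 hs
      rw [if_pos (by omega), if_pos (by omega)]
    rw [sum_congr rfl this]
    simp only [le_refl, if_true, Nat.not_succ_le_self, if_false, ht]
    exact Nat.add_le_add_right hs _

/-- Bellman's inequality. The cap does no harm: if the value at `i` has reached it, the right side
is at least the cap. -/
theorem optV_succ_le {t i j : ℕ} (hj : j < f 0) :
    optV f (t + 1) j ≤ optV f t i + (inA f i j + inB f t j) := by
  classical
  refine Nat.find_min' _ ?_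
  rcases Nat.find_spec (optV_aux f t i) with h | h
  · exact Or.inl (h.trans (Nat.le_add_right _ _))
  · exact Or.inr (h.succ hj)

theorem lt_optV (h : ¬ Yes f) (j : ℕ) : f 3 + 1 ≤ optV f (f 2) j := by
  classical
  rcases Nat.find_spec (optV_aux f (f 2) j) with h' | ⟨u, h0, ht, hu, hs⟩
  · exact h'
  · by_contra hlt
    exact h ⟨j, u, h0, ht, hu, hs.trans (by unfold optV at hlt; omega)⟩

/-- A table of lower bounds shows that the instance is a no-instance. -/
theorem not_yes_of_table {V : ℕ → ℕ → ℕ} (h0 : V 0 0 = 0)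
    (hs : ∀ t < f 2, ∀ i < f 0, ∀ j < f 0, V (t + 1) j ≤ V t i + (inA f i j + inB f t j))
    (hT : ∀ j < f 0, f 3 + 1 ≤ V (f 2) j) : ¬ Yes f := by
  rintro ⟨j, u, hu0, huT, hu, hc⟩
  -- Along any path starting in state 0 the table stays below the accumulated cost, so `V 0 0` is
  -- the only entry of the first row that matters.
  have key : ∀ t ≤ f 2, V t (u t) ≤
      ∑ s ∈ range t, (inA f (u s) (u (s + 1)) + inB f s (u (s + 1))) := by
    intro t
    induction t with
    | zero => simp [hu0, h0]
    | succ t ih =>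
      intro ht
      rw [sum_range_succ]
      exact (hs t ht _ (hu t) _ (hu _)).trans (Nat.add_le_add_right (ih (by omega)) _)
  have := (key _ le_rfl).trans hc
  have := hT _ (hu (f 2))
  omega

end OptV

/-- The numbers that occur in a stored instance have at most `b` bits. -/
structure InBounded (f : ℕ → ℕ) (b : ℕ) : Prop where
  n_lt : f 0 < 2 ^ b
  σ_lt : f 1 < 2 ^ b
  T_lt : f 2 < 2 ^ b
  θ_lt : f 3 + 1 < 2 ^ b
  oS_lt : 4 + f 0 * f 0 + f 0 * f 1 < 2 ^ b
  nT_lt : (f 2 + 1) * f 0 < 2 ^ b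
  A_lt : ∀ i < f 0, ∀ j < f 0, inA f i j < 2 ^ b
  B_lt : ∀ t < f 2, ∀ j < f 0, inB f t j < 2 ^ b
  S_lt : ∀ t < f 2, inS f t < 2 ^ b

/-- The parameters of the instance are in registers. -/
structure HeadEnv (f : ℕ → ℕ) (s : State) : Prop where
  r0 : s.reg 0 = f 0
  r1 : s.reg 1 = f 1
  r2 : s.reg 2 = f 2
  r3 : s.reg 3 = f 3
  r4 : s.reg 4 = 4 + f 0 * f 0
  r5 : s.reg 5 = 4 + f 0 * f 0 + f 0 * f 1
  m0 : s.mem 0 = f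

/-- Read the parameters of the instance. -/
def headProg : Stmt :=
  .set 0 (.get 0 0) ;; .set 1 (.get 0 1) ;; .set 2 (.get 0 2) ;; .set 3 (.get 0 3) ;;
  .set 4 (4 + .var 0 * .var 0) ;; .set 5 (.var 4 + .var 0 * .var 1)

/-- Guess the number of levels and tabulate the powers of two. -/
def levelProg : Stmt :=
  (.pick 13 ;; .set 14 1) ;;
  .for 25 26 (.var 13) (.put 7 (.var 25) (.var 14) ;; .set 14 (2 * .var 14))

/-- Guess the table of lower bounds. -/
def tableProg : Stmt := .for 20 21 ((.var 2 + 1) * .var 0) (.pick 22 ;; .put 1 (.var 20) (.var 22))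

/-- Check the first and the last row of the table. -/
def finalProg : Stmt :=
  .check (.get 1 0) ;;
  .for 23 24 (.var 0) (.check (.var 3 + 1 - .get 1 (.var 2 * .var 0 + .var 23)))

/-- Compute the numbers on the left of the triple inequalities. -/
def leftProg : Stmt :=
  .for 27 28 (.var 2 * .var 0) (
    .put 2 (.var 27) (.get 1 (.var 27 + .var 0) -
      .get 0 (.var 4 + .var 27 % .var 0 * .var 1 + .get 0 (.var 5 + .var 27 / .var 0))) ;;
    .check (.get 2 (.var 27) + 1 - .var 14))

/-! ### Guessing and preparing the table -/

section Parts

variable {f : ℕ → ℕ} {m : Bool} {s : State} {b : ℕ}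

theorem HeadEnv.of_agree {vs ks : List ℕ} {s' : State} (E : HeadEnv f s)
    (hag : AgreeOff vs ks s s') (hv : ∀ x ∈ vs, 6 ≤ x) (hk : ∀ k ∈ ks, 1 ≤ k) : HeadEnv f s' := by
  have g : ∀ x < 6, s'.reg x = s.reg x := fun x hx => hag.1 x fun h' => by
    have := hv x h'; omega
  have gm : s'.mem 0 = s.mem 0 := hag.2 0 fun h' => by have := hk 0 h'; omega
  obtain ⟨a0, a1, a2, a3, a4, a5, a6⟩ := E
  constructor <;> first | (rw [g _ (by norm_num)]; assumption) | (rw [gm]; assumption)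

theorem headProg_ok (h0 : s.mem 0 = f) (hB : m = true → InBounded f b) :
    Ok m headProg s (HeadEnv f) b 1 := by
  refine Ok.wp ?_ fun _ => le_rfl
  simp only [headProg, wp, Small_get, Small_add, Small_mul, Small_var, Small_zero, Small_one,
    Small_two, Small_three, Small_four, eval_get, eval_add, eval_mul, eval_var, eval_zero, eval_one,
    eval_two, eval_three, eval_four, State.setReg_reg, State.setReg_mem, Nat.reduceEqDiff, reduceIte,
    h0, true_and, and_true]
  refine ⟨fun hm => (hB hm).n_lt, fun hm => (hB hm).σ_lt, fun hm => (hB hm).T_lt, fun hm => ?_,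
    fun hm => ?_, fun hm => ?_, ?_⟩
  · have := (hB hm).θ_lt; omega
  · simp only [(hB hm).n_lt, and_self]
  · have := (hB hm).oS_lt
    refine ⟨by omega, (hB hm).n_lt, (hB hm).σ_lt⟩
  · constructor <;> simp [State.setReg_reg, h0]

/-- The guessed number of levels is not trusted: `leftProg` checks that all left sides are below `2
^ L`, which is what the descent over the scales starts from. -/
theorem levelProg_ok (L₀ : ℕ) (hB : m = true → L₀ ≤ b ∧ 1 ≤ b) :
    Ok m levelProg s (fun s' => ∃ L, (m = true → L = L₀) ∧ s'.reg 13 = L ∧ s'.reg 14 = 2 ^ L ∧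
      ∀ l < L, s'.mem 7 l = 2 ^ l) b (L₀ + 1) := by
  have h2 : m = true → 1 < 2 ^ b := fun hm => Nat.one_lt_two_pow (by have := hB hm; omega)
  have hL : m = true → L₀ < 2 ^ b := fun hm => lt_of_le_of_lt (hB hm).1 Nat.lt_two_pow_self
  refine Ok.seq (n₁ := 1) (n₂ := L₀ + 1) (P := fun s' => ∃ L, (m = true → L = L₀) ∧
    s'.reg 13 = L ∧ s'.reg 14 = 1) (Ok.wp ⟨fun hm => ⟨L₀, hL hm, fun hm => by simp, L₀, fun _ => rfl,
      by simp [State.setReg_reg]⟩, fun hm v => ⟨fun h => by simp [hm] at h, v,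
      fun h => by simp [hm] at h, by simp [State.setReg_reg]⟩⟩ fun _ => le_rfl)
    (fun s₁ hs₁ h => ?_) (by omega)
  obtain ⟨L, hLL, h13, h14⟩ := h
  refine Ok.mono (Ok.for (c := 1) (n := L + 1) (I := fun i s' => s'.reg 14 = 2 ^ i ∧
    ∀ l < i, s'.mem 7 l = 2 ^ l) L (by simp [h13]) (fun hm => ?_) (by simp [Stmt.vars]) ?_
    (by simp [h14]) ?_ (fun _ => by omega)) (fun s' hag h => ⟨L, hLL, ?_, h⟩) fun hm => by
      rw [hLL hm]
  · have := hL hm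
    rw [← hLL hm] at this
    simp [h13, this]
  · intro i s s' hag h
    simpa [hag.1, hag.2] using h
  · intro i hi s₂ hs₂ h25 hI
    refine Ok.wp ⟨fun hm => ?_, fun hm => ?_, ?_, fun l hl => ?_⟩ fun _ => le_rfl
    · have h1 : 2 ^ i < 2 ^ b := Nat.pow_lt_pow_right (by norm_num) (by
        have := hLL hm; have := hB hm; omega)
      have h3 : i < 2 ^ b := lt_trans Nat.lt_two_pow_self h1
      simp [h25, hI.1, h1, h3]
    · have h1 : 2 ^ i < 2 ^ b := Nat.pow_lt_pow_right (by norm_num) (by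
        have := hLL hm; have := hB hm; omega)
      simp [hI.1, h1]
    · simp [State.setReg_reg, hI.1, pow_succ']
    · simp only [State.setReg_mem, State.setMem_mem, eval_var, h25, hI.1, true_and]
      split_ifs with hli
      · rw [hli]
      · exact hI.2 l (by omega)
  · rw [hag.1 13 (by simp [Stmt.vars, Stmt.for]), h13]

/-- For soundness the postcondition is empty, as any table may be guessed; it is the later checks
that constrain it. -/
theorem tableProg_ok (E : HeadEnv f s) (V : ℕ → ℕ) (hB : m = true → InBounded f b)
    (hV : m = true → ∀ u < (f 2 + 1) * f 0, V u < 2 ^ b) :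
    Ok m tableProg s (fun s' => m = true → ∀ u < (f 2 + 1) * f 0, s'.mem 1 u = V u) b
      ((f 2 + 1) * f 0 + 1) := by
  refine Ok.for (c := 1) (I := fun i s' => m = true → ∀ u < i, s'.mem 1 u = V u)
    ((f 2 + 1) * f 0) (by simp [E.r0, E.r2]) (fun hm => ?_) (by simp [Stmt.vars]) ?_ (by simp) ?_
    (fun _ => by omega)
  · simp [E.r0, E.r2, (hB hm).n_lt, (hB hm).T_lt, (hB hm).nT_lt]
  · intro i s s' hag h
    simpa [hag.2] using h
  · intro i hi s₁ hs₁ h20 hI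
    refine Ok.wp ⟨fun hm => ⟨V i, hV hm i hi, fun _ => ?_, fun _ u hu => ?_⟩, fun hm v =>
      ⟨fun h => by simp [hm] at h, fun h => by simp [hm] at h⟩⟩ fun _ => le_rfl
    · have := hV hm i hi
      have := (hB hm).nT_lt
      simp only [Small_var, State.setReg_reg, Nat.reduceEqDiff, reduceIte, h20]
      omega
    · simp only [State.setMem_mem, State.setReg_mem, eval_var, State.setReg_reg, Nat.reduceEqDiff,
        reduceIte, h20, true_and]
      split_ifs with h
      · rw [h]
      · exact hI hm u (by omega)

theorem finalProg_ok (E : HeadEnv f s) (hB : m = true → InBounded f b) (h0 : m = true → s.mem 1 0 = 0)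
    (hT : m = true → ∀ j < f 0, f 3 + 1 ≤ s.mem 1 (f 2 * f 0 + j) ∧ s.mem 1 (f 2 * f 0 + j) < 2 ^ b) :
    Ok m finalProg s (fun _ => s.mem 1 0 = 0 ∧ ∀ j < f 0, f 3 + 1 ≤ s.mem 1 (f 2 * f 0 + j)) b
      (f 0 + 1) := by
  refine Ok.seq (n₁ := 1) (n₂ := f 0 + 1) (P := fun _ => s.mem 1 0 = 0)
    (Ok.wp ⟨fun hm => by simp [h0 hm], fun h => by simpa using h⟩ fun _ => le_rfl)
    (fun s₁ hs₁ h => ?_) (by omega)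
  have E₁ := E.of_agree hs₁ (by simp [Stmt.vars]) (by simp [Stmt.arrs])
  refine Ok.mono (Ok.for (c := 1) (n := f 0 + 1) (I := fun i _ => ∀ j < i, f 3 + 1 ≤ s.mem 1 (f 2 * f 0 + j)) (f 0)
    (by simp [E₁.r0]) (fun hm => by simp [E₁.r0, (hB hm).n_lt]) (by simp [Stmt.vars])
    (fun _ _ _ _ h => h) (by simp) ?_ (fun _ => by omega)) (fun _ _ h' => ⟨h, h'⟩) fun _ => le_rfl
  intro i hi s₂ hs₂ h23 hI
  have E₂ := E₁.of_agree hs₂ (by simp [Stmt.vars]) (by simp [Stmt.arrs])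
  have k1 : s₂.mem 1 = s.mem 1 := by rw [hs₂.2 1 (by simp [Stmt.arrs]), hs₁.2 1 (by simp [Stmt.arrs])]
  refine Ok.wp ⟨fun hm => ?_, fun h j hj => ?_⟩ fun _ => le_rfl
  · have := (hB hm).θ_lt
    have h3 := hT hm i hi
    have : f 3 < 2 ^ b := by omega
    have hi' : i < 2 ^ b := hi.trans (hB hm).n_lt
    simp [E₂.r0, E₂.r2, E₂.r3, h23, k1, (hB hm).n_lt, (hB hm).T_lt, h3, this, hi']
  · rcases Nat.lt_succ_iff_lt_or_eq.1 hj with h' | rfl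
    · exact hI j h'
    · simpa [E₂.r0, E₂.r2, E₂.r3, h23, k1, Nat.sub_eq_zero_iff_le] using h

/-- The observation cost is moved to the left side, so that the right side depends on the pairs (i,
j) and (t, i) only. Truncation is harmless: a difference cut off at zero imposes the same inequality
on natural numbers. The shift by `f 0` selects the next row of the table. -/
theorem leftProg_ok {L : ℕ} (E : HeadEnv f s) (h14 : s.reg 14 = 2 ^ L) (hn : 0 < f 0)
    (hB : m = true → InBounded f b ∧ L < b)
    (hV : m = true → ∀ u < (f 2 + 1) * f 0, s.mem 1 u < 2 ^ L) :
    Ok m leftProg s (fun s' => ∀ u < f 2 * f 0, s'.mem 2 u = s.mem 1 (u + f 0) -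
      inB f (u / f 0) (u % f 0) ∧ s'.mem 2 u < 2 ^ L) b (f 2 * f 0 + 1) := by
  refine Ok.for (c := 1) (I := fun i s' => ∀ u < i, s'.mem 2 u = s.mem 1 (u + f 0) -
      inB f (u / f 0) (u % f 0) ∧ s'.mem 2 u < 2 ^ L)
    (f 2 * f 0) (by simp [E.r0, E.r2]) (fun hm => ?_) (by simp [Stmt.vars]) ?_ (by simp) ?_
    (fun _ => by omega)
  · have := (hB hm).1.nT_lt
    rw [add_mul] at this
    simp [E.r0, E.r2, (hB hm).1.n_lt, (hB hm).1.T_lt]; omega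
  · intro i s s' hag h
    simpa [hag.2] using h
  · intro i hi s₁ hs₁ h27 hI
    have E₁ := E.of_agree hs₁ (by simp [Stmt.vars]) (by simp [Stmt.arrs])
    have k1 : s₁.mem 1 = s.mem 1 := hs₁.2 1 (by simp [Stmt.arrs])
    have k14 : s₁.reg 14 = 2 ^ L := (hs₁.1 14 (by simp [Stmt.vars])).trans h14
    have ei : i + f 0 < (f 2 + 1) * f 0 := by rw [add_mul]; omega
    have et : i / f 0 < f 2 := Nat.div_lt_of_lt_mul (by rwa [mul_comm])
    have ej : i % f 0 < f 0 := Nat.mod_lt _ hn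
    have eB : f (4 + f 0 * f 0 + i % f 0 * f 1 + f (4 + f 0 * f 0 + f 0 * f 1 + i / f 0)) =
      inB f (i / f 0) (i % f 0) := rfl
    have hsm : m = true → i < 2 ^ b ∧ f 0 < 2 ^ b ∧ f 1 < 2 ^ b ∧ 4 + f 0 * f 0 < 2 ^ b ∧
        4 + f 0 * f 0 + f 0 * f 1 < 2 ^ b ∧ s.mem 1 (i + f 0) < 2 ^ b ∧
        inB f (i / f 0) (i % f 0) < 2 ^ b ∧ f (4 + f 0 * f 0 + f 0 * f 1 + i / f 0) < 2 ^ b ∧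
        s.mem 1 (i + f 0) - inB f (i / f 0) (i % f 0) < 2 ^ b ∧ 2 ^ L < 2 ^ b ∧
        s.mem 1 (i + f 0) < 2 ^ L := fun hm => by
      have h1 := (hB hm).1
      have h2 := h1.nT_lt
      have h3 := h1.oS_lt
      have h4 := hV hm _ ei
      have h5 : 2 ^ L < 2 ^ b := Nat.pow_lt_pow_right (by norm_num) (hB hm).2
      refine ⟨by omega, h1.n_lt, h1.σ_lt, by omega, h3, by omega, h1.B_lt _ et _ ej, h1.S_lt _ et,
        by omega, h5, h4⟩
    refine Ok.wp ?_ fun _ => le_rfl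
    simp only [wp, Small_add, Small_sub, Small_mul, Small_mod, Small_div, Small_get, Small_var,
      Small_one, eval_add, eval_sub, eval_mul, eval_mod, eval_div, eval_get, eval_var, eval_one,
      State.setMem_reg, State.setMem_mem, E₁.r0, E₁.r1, E₁.r4, E₁.r5, E₁.m0, h27, k1, k14, eB,
      and_self, true_and, reduceIte, and_true]
    refine ⟨fun hm => ?_, fun hm => ?_, fun h u hu => ?_⟩
    · simp only [hsm hm, and_self]
    · have := hsm hm
      refine ⟨⟨⟨this.1, this.2.2.2.2.2.2.2.2.1⟩, this.2.2.2.2.2.2.2.2.2.1⟩, ?_⟩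
      omega
    · split_ifs with hui
      · subst hui
        exact ⟨rfl, by omega⟩
      · exact hI u (by omega)

end Parts

/-! ### The verifier for no-instances -/

/-- Guess a table of lower bounds and prepare the triple inequalities. -/
def guessProg : Stmt := headProg ;; levelProg ;; tableProg ;; finalProg ;; leftProg

/-- Verify that the stored instance is a no-instance. -/
def noProg : Stmt := guessProg ;; setupProg ;; triProg

/-- The table of optimal costs as an array. -/
noncomputable def optTable (f : ℕ → ℕ) (u : ℕ) : ℕ := optV f (u / f 0) (u % f 0)

/-- The left sides of the triple inequalities for the table of optimal costs. -/
noncomputable def optLeft (f : ℕ → ℕ) (u : ℕ) : ℕ :=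
  optTable f (u + f 0) - inB f (u / f 0) (u % f 0)

/-- Conditions on the nondeterministic choices of the verifier for no-instances. -/
structure Params (f : ℕ → ℕ) (d p L b B : ℕ) : Prop where
  bB : b ≤ B
  B_le : 128 ≤ B
  two_le : 2 ≤ b
  L_pos : 0 < L
  L_lt : L < b
  G_lt : numBlocks (f 0) (f 2) d L < 2 ^ b
  p_lt : p < 2 ^ b
  d_lt : 8 ^ d < 2 ^ b
  X_lt : (3 * 8 ^ d) ^ p < 2 ^ B
  θ_lt : f 3 + 1 < 2 ^ L
  inb : InBounded f b

/-- The number of false positives, for the table of optimal costs. -/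
noncomputable def optCount (f : ℕ → ℕ) (d p L : ℕ) : ℕ :=
  ∑ g ∈ range (numBlocks (f 0) (f 2) d L),
    (blockOf f (optTable f) (optLeft f) (f 0) (f 2) d p g).count

section No

variable {f : ℕ → ℕ} {m : Bool} {s : State} {d p L b B : ℕ}

theorem optTable_mul_add {t j : ℕ} (hj : j < f 0) : optTable f (t * f 0 + j) = optV f t j := by
  unfold optTable
  rw [mul_comm, Nat.mul_add_div (by omega), Nat.div_eq_of_lt hj, Nat.mul_add_mod,
    Nat.mod_eq_of_lt hj, add_zero]

theorem optLeft_mul_add {t j : ℕ} (hj : j < f 0) :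
    optLeft f (t * f 0 + j) = optV f (t + 1) j - inB f t j := by
  unfold optLeft
  rw [show t * f 0 + j + f 0 = (t + 1) * f 0 + j by ring, optTable_mul_add hj]
  rw [mul_comm, Nat.mul_add_div (by omega), Nat.div_eq_of_lt hj, Nat.mul_add_mod,
    Nat.mod_eq_of_lt hj, add_zero]

theorem optLeft_le {t i j : ℕ} (hi : i < f 0) (hj : j < f 0) :
    optLeft f (t * f 0 + j) ≤ inA f i j + optTable f (t * f 0 + i) := by
  rw [optLeft_mul_add hj, optTable_mul_add hi]
  have := optV_succ_le (f := f) (t := t) (i := i) hj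
  omega

theorem optTable_le (u : ℕ) : optTable f u ≤ f 3 + 1 := optV_le _ _

theorem optLeft_le_succ (u : ℕ) : optLeft f u ≤ f 3 + 1 := (Nat.sub_le _ _).trans (optTable_le _)

theorem lt_mul_of_lt {t i n N : ℕ} (ht : t < N) (hi : i < n) : t * n + i < N * n := by
  have := Nat.mul_le_mul_right n (show t + 1 ≤ N from ht)
  rw [add_mul, one_mul] at this
  omega

section congr

variable {f0 f1 f2 g1 g2 : ℕ → ℕ} {n T : ℕ}

/-- The arrays in memory are known to match the optimal table only on the first `T * n` cells;
clamped indices never leave them. -/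
theorem blockOf_congr (hn : 0 < n) (hT : 0 < T) (h1 : ∀ u < T * n, f1 u = g1 u)
    (h2 : ∀ u < T * n, f2 u = g2 u) (g w : ℕ) :
    ((blockOf f0 f1 f2 n T d p g).Res w ↔ (blockOf f0 g1 g2 n T d p g).Res w) ∧
    ((blockOf f0 f1 f2 n T d p g).Good w ↔ (blockOf f0 g1 g2 n T d p g).Good w) := by
  have ey : ∀ t i, (blockOf f0 f1 f2 n T d p g).y t i = (blockOf f0 g1 g2 n T d p g).y t i :=
    fun t i => h1 _ (lt_mul_of_lt (clamp_lt hT _) (clamp_lt hn _))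
  have ez : ∀ j t, (blockOf f0 f1 f2 n T d p g).z j t = (blockOf f0 g1 g2 n T d p g).z j t :=
    fun j t => h2 _ (lt_mul_of_lt (clamp_lt hT _) (clamp_lt hn _))
  unfold Block.Res Block.Good Block.zres
  rw [ey, ez]
  exact ⟨Iff.rfl, Iff.rfl⟩

theorem count_blockOf_congr (hn : 0 < n) (hT : 0 < T) (h1 : ∀ u < T * n, f1 u = g1 u)
    (h2 : ∀ u < T * n, f2 u = g2 u) (g : ℕ) :
    (blockOf f0 f1 f2 n T d p g).count = (blockOf f0 g1 g2 n T d p g).count := by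
  unfold Block.count
  rw [Nat.count_eq_card_filter_range, Nat.count_eq_card_filter_range]
  congr 1
  exact filter_congr fun w _ => (blockOf_congr hn hT h1 h2 g w).1

end congr

/-- The state after guessing a table, with `L` levels. -/
structure GuessEnv (f : ℕ → ℕ) (L : ℕ) (s : State) : Prop where
  head : HeadEnv f s
  r13 : s.reg 13 = L
  m7 : ∀ l < L, s.mem 7 l = 2 ^ l
  first : s.mem 1 0 = 0
  last : ∀ j < f 0, f 3 + 1 ≤ s.mem 1 (f 2 * f 0 + j)
  left : ∀ u < f 2 * f 0, s.mem 2 u = s.mem 1 (u + f 0) - inB f (u / f 0) (u % f 0) ∧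
    s.mem 2 u < 2 ^ L

theorem GuessEnv.not_yes (h : GuessEnv f L s)
    (hle : ∀ t < f 2, ∀ i < f 0, ∀ j < f 0,
      s.mem 2 (t * f 0 + j) ≤ inA f i j + s.mem 1 (t * f 0 + i)) : ¬ Yes f := by
  refine not_yes_of_table (V := fun t j => s.mem 1 (t * f 0 + j)) (by simpa using h.first)
    (fun t ht i hi j hj => ?_) h.last
  have h1 := (h.left _ (lt_mul_of_lt ht hj)).1
  have h2 := hle t ht i hi j hj
  rw [mul_comm t, Nat.mul_add_div (by omega), Nat.div_eq_of_lt hj, Nat.mul_add_mod,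
    Nat.mod_eq_of_lt hj, add_zero, mul_comm (f 0)] at h1
  rw [show (t + 1) * f 0 + j = t * f 0 + j + f 0 by ring]
  omega

theorem guessProg_ok (h0 : s.mem 0 = f) (hn : 0 < f 0)
    (hB : m = true → L < b ∧ f 3 + 1 < 2 ^ L ∧ InBounded f b) (hno : m = true → ¬ Yes f) :
    Ok m guessProg s (fun s' => ∃ L', (m = true → L' = L ∧ (∀ u < f 2 * f 0,
        s'.mem 1 u = optTable f u) ∧ ∀ u < f 2 * f 0, s'.mem 2 u = optLeft f u) ∧
      GuessEnv f L' s') b ((f 2 + 1) * f 0 + L + 1) := by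
  have hN0 : (f 2 + 1) * f 0 = f 2 * f 0 + f 0 := by ring
  have htab : m = true → ∀ u < (f 2 + 1) * f 0, optTable f u < 2 ^ b := fun hm u _ =>
    (optTable_le u).trans_lt (hB hm).2.2.θ_lt
  refine Ok.seq (headProg_ok h0 fun hm => (hB hm).2.2) (fun s₁ hs₁ E₁ => ?_)
    (n₂ := (f 2 + 1) * f 0 + L + 1) (fun _ => by omega)
  refine Ok.seq (levelProg_ok L fun hm => ⟨(hB hm).1.le, by have := (hB hm).1; omega⟩)
    (fun s₂ hs₂ hL => ?_) (n₂ := (f 2 + 1) * f 0 + L + 1) (fun _ => by omega)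
  have E₂ := E₁.of_agree hs₂ (by simp [Stmt.vars, Stmt.for, levelProg])
    (by simp [Stmt.arrs, Stmt.for, levelProg])
  refine Ok.seq (tableProg_ok E₂ (optTable f) (fun hm => (hB hm).2.2) htab)
    (fun s₃ hs₃ hV => ?_) (n₂ := (f 2 + 1) * f 0 + L + 1) (fun _ => by omega)
  have v3 : tableProg.vars = [21, 20, 22, 20, 21] := rfl
  have a3 : tableProg.arrs = [1] := rfl
  rw [v3, a3] at hs₃
  have E₃ := E₂.of_agree hs₃ (by simp) (by simp)
  obtain ⟨L', hLL, h13, h14, h7⟩ := hL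
  refine Ok.seq (finalProg_ok E₃ (fun hm => (hB hm).2.2) (fun hm => ?_) fun hm j hj => ?_)
    (fun s₄ hs₄ hF => ?_) (n₂ := (f 2 + 1) * f 0 + L + 1) (fun _ => by omega)
  · rw [hV hm 0 (by positivity)]
    unfold optTable
    rw [Nat.zero_div, Nat.zero_mod, optV_zero hn]
  · have : f 2 * f 0 + j < (f 2 + 1) * f 0 := by omega
    rw [hV hm _ this]
    refine ⟨?_, htab hm _ this⟩
    rw [optTable_mul_add hj]
    exact lt_optV (hno hm) j
  have v4 : finalProg.vars = [24, 23, 23, 24] := rfl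
  have a4 : finalProg.arrs = [] := rfl
  rw [v4, a4] at hs₄
  have E₄ := E₃.of_agree hs₄ (by simp) (by simp)
  have k1 : s₄.mem 1 = s₃.mem 1 := hs₄.2 1 (by simp)
  refine Ok.mono (leftProg_ok (L := L') E₄ (by rw [hs₄.1 14 (by simp), hs₃.1 14 (by simp), h14]) hn
    (fun hm => ⟨(hB hm).2.2, by rw [hLL hm]; exact (hB hm).1⟩) fun hm u hu => ?_)
    (fun s₅ hs₅ hZ => ⟨L', fun hm => ⟨hLL hm, fun u hu => ?_, fun u hu => ?_⟩, ?_⟩) (fun _ => by omega)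
  · rw [k1, hV hm u hu, hLL hm]
    exact (optTable_le u).trans_lt (hB hm).2.1
  · rw [hs₅.2 1 (by simp [Stmt.arrs, Stmt.for, leftProg]), k1, hV hm u (by omega)]
  · rw [(hZ u hu).1, k1, hV hm _ (by omega)]; rfl
  · have v5 : leftProg.vars = [28, 27, 27, 28] := rfl
    have a5 : leftProg.arrs = [2] := rfl
    rw [v5, a5] at hs₅
    have k1' : s₅.mem 1 = s₃.mem 1 := (hs₅.2 1 (by simp)).trans k1
    have k7 : s₅.mem 7 = s₂.mem 7 := by rw [hs₅.2 7 (by simp), hs₄.2 7 (by simp), hs₃.2 7 (by simp)]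
    refine ⟨E₄.of_agree hs₅ (by simp) (by simp), ?_, by rw [k7]; exact h7, by rw [k1']; exact hF.1,
      by rw [k1']; exact hF.2, by rw [k1', ← k1]; exact hZ⟩
    rw [hs₅.1 13 (by simp), hs₄.1 13 (by simp), hs₃.1 13 (by simp), h13]

/-- A constant factor for the cost of `noProg`. -/
def noWeight : ℕ := guessProg.wt + setupProg.wt + triWeight

/-- For soundness the parameters `d`, `p`, `L`, `b`, `B` are irrelevant: the run works with its own
guesses, and the assertion does not mention them. For completeness they prescribe the guesses and
bound the cost. -/
theorem noProg_tr (h0 : s.mem 0 = f) (hn : 0 < f 0) (hT : 0 < f 2) (hp : 0 < p)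
    (hB : m = true → Params f d p L b B) (hno : m = true → ¬ Yes f) :
    Tr m noProg s (fun _ => ¬ Yes f)
      (noWeight * (((numBlocks (f 0) (f 2) d L + 1) * ((d + 1) * (7 ^ d + 1)) + L +
        (f 2 + 1) * f 0 + p + 100) * (B + 1) + optCount f d p L * (b + 1))) := by
  set G := numBlocks (f 0) (f 2) d L with hG
  set D := (d + 1) * (7 ^ d + 1) with hD
  have main := Tr.seq (guessProg_ok (m := m) (b := b) (L := L) h0 hn (fun hm => ⟨(hB hm).L_lt,
    (hB hm).θ_lt, (hB hm).inb⟩) hno) fun s₁ hs₁ hs => Tr.seq (setupProg_ok (m := m) (s := s₁) (B := B) d p hp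
      fun hm => ⟨(hB hm).B_le, (hB hm).p_lt.trans_le (Nat.pow_le_pow_right (by norm_num) (hB hm).bB),
        (hB hm).X_lt⟩) (Q := fun _ => ¬ Yes f)
      (c₂ := triWeight * ((G + 1) * D * (B + 1) + optCount f d p L * (b + 1)))
      fun s₂ hs₂ hS => by
        obtain ⟨L', hm1, hE⟩ := hs
        obtain ⟨d', p', hdp, S⟩ := hS
        have v2 : ∀ x ∈ setupProg.vars, 6 ≤ x ∧ x ≠ 13 := by
          simp [Stmt.vars, Stmt.for, setupProg, paramProg, paramLoop, powProg, coeffProg, mortProg]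
        have a2 : ∀ x ∈ setupProg.arrs, 3 ≤ x ∧ x ≠ 7 := by
          simp [Stmt.arrs, Stmt.for, setupProg, paramProg, paramLoop, powProg, coeffProg, mortProg]
        have H := hE.head.of_agree hs₂ (fun x hx => (v2 x hx).1) fun x hx =>
          (show 1 ≤ 3 by norm_num).trans (a2 x hx).1
        have k1 : s₂.mem 1 = s₁.mem 1 := hs₂.2 1 fun h => by have := a2 _ h; omega
        have k2 : s₂.mem 2 = s₁.mem 2 := hs₂.2 2 fun h => by have := a2 _ h; omega
        have k7 : s₂.mem 7 = s₁.mem 7 := hs₂.2 7 fun h => by have := a2 _ h; omega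
        have k13 : s₂.reg 13 = s₁.reg 13 := hs₂.1 13 fun h => by have := v2 _ h; omega
        have TE : TriEnv f (s₁.mem 1) (s₁.mem 2) (f 0) (f 2) d' p' L' s₂ :=
          ⟨S, H.r0, H.r2, k13.trans hE.r13, H.m0, k1, k2, by rw [k7]; exact hE.m7, hn, hT⟩
        refine (triProg_tr (m := m) (b := b) (B := B) TE (fun hm => ?_) fun hm g hg w hw hr => ?_).mono
          (fun s₃ hs₃ hq => ?_) fun hm => ?_
        · obtain ⟨rfl, e1, e2⟩ := hm1 hm
          obtain ⟨rfl, rfl⟩ := hdp hm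
          have h := hB hm
          refine ⟨h.bB, h.two_le, h.L_pos, h.L_lt.le, h.G_lt, h.inb.n_lt, h.inb.T_lt, h.p_lt,
            h.d_lt, h.inb.A_lt, fun t ht i hi => ?_, fun t ht j hj => ?_, h.X_lt⟩
          · rw [e1 _ (lt_mul_of_lt ht hi)]
            exact (optTable_le _).trans_lt h.inb.θ_lt
          · rw [e2 _ (lt_mul_of_lt ht hj)]
            exact (optLeft_le_succ _).trans_lt h.inb.θ_lt
        -- With the optimal table all triples are good, so in particular every solution passes its
        -- check.
        · obtain ⟨rfl, e1, e2⟩ := hm1 hm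
          rw [(blockOf_congr hn hT e1 e2 g w).2]
          exact optLeft_le (clamp_lt hn _) (clamp_lt hn _)
        · refine hE.not_yes fun t ht i hi j hj => ?_
          exact le_add_of_blocks S.p_pos hq hi hj ht (hE.left _ (lt_mul_of_lt ht hj)).2
        · obtain ⟨rfl, e1, e2⟩ := hm1 hm
          obtain ⟨rfl, rfl⟩ := hdp hm
          refine le_of_eq ?_
          rw [sum_congr rfl fun g _ => count_blockOf_congr hn hT e1 e2 g]
          rfl
  refine main.mono (fun _ _ h => h) fun hm => ?_
  have hbB := (hB hm).bB
  have hD1 : 7 ^ d ≤ D := by rw [hD]; nlinarith [Nat.zero_le (d * (7 ^ d + 1))]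
  have hD2 : D ≤ (G + 1) * D := Nat.le_mul_of_pos_left _ (by omega)
  set P := ((G + 1) * D + L + (f 2 + 1) * f 0 + p + 100) * (B + 1) with hP
  have e1 : ((f 2 + 1) * f 0 + L + 1) * (b + 1) ≤ P := by
    rw [hP]; exact Nat.mul_le_mul (by omega) (by omega)
  have e2 : (p + 7 ^ d + 100) * (B + 1) ≤ P := Nat.mul_le_mul_right _ (by omega)
  have e3 : (G + 1) * D * (B + 1) ≤ P := Nat.mul_le_mul_right _ (by omega)
  unfold noWeight
  generalize guessProg.wt = w1
  generalize setupProg.wt = w2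
  generalize triWeight = w3
  generalize optCount f d p L * (b + 1) = C
  calc _ ≤ w1 * P + (w2 * P + w3 * (P + C)) := by gcongr
    _ ≤ (w1 + w2 + w3) * (P + C) := by
      have := Nat.zero_le ((w1 + w2) * C)
      nlinarith

end No

/-! ### The verifier for yes-instances -/

def yesStep : Stmt :=
  .pick 54 ;;
  .check (.var 54 + 1 - .var 0) ;;
  .set 51 (.var 51 + .get 0 (4 + .var 50 * .var 0 + .var 54) +
    .get 0 (.var 4 + .var 54 * .var 1 + .get 0 (.var 5 + .var 52))) ;;
  .set 50 (.var 54)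

/-- Verify that the stored instance is a yes-instance. -/
def yesProg : Stmt :=
  headProg ;; .set 50 0 ;; .set 51 0 ;; .for 52 53 (.var 2) yesStep ;; .check (.var 51 - .var 3)

section Yes

variable {f : ℕ → ℕ} {m : Bool} {s : State} {b : ℕ}

/-- The path is guessed state by state and not stored. For soundness the invariant keeps `Reach` as
a witness of the choices made so far; for completeness it follows a fixed optimal path `u` whose
partial sums stay below the threshold. -/
theorem yesProg_ok (h0 : s.mem 0 = f) (hn : 0 < f 0) (hB : m = true → InBounded f b)
    (hyes : m = true → Yes f) : Ok m yesProg s (fun _ => Yes f) b (f 2 + 1) := by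
  refine Ok.seq (n₁ := 1) (n₂ := f 2 + 1) (headProg_ok h0 hB) (fun s₁ hs₁ E₁ => ?_) (by omega)
  refine Ok.seq (n₁ := 1) (n₂ := f 2 + 1) (P := fun s' => s'.reg 50 = 0)
    (Ok.wp ⟨fun _ => by simp, by simp [State.setReg_reg]⟩ fun _ => le_rfl)
    (fun s₂ hs₂ h50 => ?_) (by omega)
  refine Ok.seq (n₁ := 1) (n₂ := f 2 + 1) (P := fun s' => s'.reg 51 = 0)
    (Ok.wp ⟨fun _ => by simp, by simp [State.setReg_reg]⟩ fun _ => le_rfl)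
    (fun s₃ hs₃ h51 => ?_) (by omega)
  have E₃ := (E₁.of_agree hs₂ (by simp [Stmt.vars]) (by simp [Stmt.arrs])).of_agree hs₃
    (by simp [Stmt.vars]) (by simp [Stmt.arrs])
  replace h50 : s₃.reg 50 = 0 := (hs₃.1 50 (by simp [Stmt.vars])).trans h50
  obtain ⟨u, hu0, hu, huc⟩ : ∃ u : ℕ → ℕ, u 0 = 0 ∧ (∀ s, u s < f 0) ∧ (m = true →
      ∑ s ∈ range (f 2), (inA f (u s) (u (s + 1)) + inB f s (u (s + 1))) ≤ f 3) := by
    by_cases hm : m = true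
    · obtain ⟨j, u, h1, h2, h3, h4⟩ := hyes hm
      exact ⟨u, h1, h3, fun _ => h4⟩
    · exact ⟨fun _ => 0, rfl, fun _ => hn, fun h => absurd h hm⟩
  set c : ℕ → ℕ := fun t => ∑ s ∈ range t, (inA f (u s) (u (s + 1)) + inB f s (u (s + 1))) with hc
  have hcle : m = true → ∀ t ≤ f 2, c t < 2 ^ b := fun hm t ht => by
    have h1 : c t ≤ c (f 2) := sum_le_sum_of_subset (range_subset_range.2 ht)
    have h2 := huc hm
    have h3 := (hB hm).θ_lt
    change c (f 2) ≤ _ at h2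
    omega
  refine Ok.seq (n₁ := f 2 + 1) (n₂ := 1) (Ok.for (c := 1) (I := fun t s' =>
    Reach f t (s'.reg 50) (s'.reg 51) ∧ (m = true → s'.reg 50 = u t ∧ s'.reg 51 = c t)) (f 2)
    (by simp [E₃.r2]) (fun hm => by simp [E₃.r2, (hB hm).T_lt]) (by simp [Stmt.vars, yesStep]) ?_ ?_
    ?_ (fun _ => by omega)) (fun s₄ hs₄ h => ?_) (by omega)
  · intro i s s' hag h
    simpa [hag.1] using h
  · rw [h50, h51]
    exact ⟨⟨fun _ => 0, rfl, rfl, fun _ => hn, by simp⟩, fun _ => ⟨hu0.symm, by simp [hc]⟩⟩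
  · intro t ht s₄ hs₄ h52 hI
    have E₄ := E₃.of_agree hs₄ (by simp [Stmt.vars, yesStep]) (by simp [Stmt.arrs, yesStep])
    obtain ⟨hR, hI⟩ := hI
    have key : ∀ v, (m = true → v = u (t + 1)) → wp m b (
        .check (.var 54 + 1 - .var 0) ;;
        .set 51 (.var 51 + .get 0 (4 + .var 50 * .var 0 + .var 54) +
          .get 0 (.var 4 + .var 54 * .var 1 + .get 0 (.var 5 + .var 52))) ;;
        .set 50 (.var 54)) (s₄.setReg 54 v) (fun s' => Reach f (t + 1) (s'.reg 50) (s'.reg 51) ∧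
          (m = true → s'.reg 50 = u (t + 1) ∧ s'.reg 51 = c (t + 1))) := by
      intro v hv
      have eA : f (4 + s₄.reg 50 * f 0 + v) = inA f (s₄.reg 50) v := rfl
      have eB : f (4 + f 0 * f 0 + v * f 1 + f (4 + f 0 * f 0 + f 0 * f 1 + t)) = inB f t v := rfl
      have eS : f (4 + f 0 * f 0 + f 0 * f 1 + t) = inS f t := rfl
      simp only [wp, Small_add, Small_sub, Small_mul, Small_get, Small_var, Small_one, Small_four,
        eval_add, eval_sub, eval_mul, eval_get, eval_var, eval_one, eval_four, State.setReg_reg,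
        State.setReg_mem, Nat.reduceEqDiff, reduceIte, E₄.r0, E₄.r1, E₄.r4, E₄.r5, E₄.m0, h52, eA,
        eB, true_and, and_true]
      refine ⟨fun hm => ?_, fun h => ⟨fun hm => ?_, fun hm => ?_, ?_, fun hm => ⟨hv hm, ?_⟩⟩⟩
      · have h1 := hu (t + 1)
        have h2 := (hB hm).n_lt
        rw [← hv hm] at h1
        omega
      · have h1 := hu (t + 1)
        have h3 := hB hm
        have h2 := h3.n_lt
        have h4 := h3.oS_lt
        have h5 := hu t
        have h6 := h3.A_lt _ h5 _ h1
        have h7 := h3.B_lt t ht _ h1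
        have h8 := h3.S_lt t ht
        have h9 := hcle hm t ht.le
        have h10 := h3.T_lt
        have h11 := h3.σ_lt
        rw [eS, (hI hm).1, (hI hm).2, hv hm]
        simp only [h2, h11, h6, h7, h8, h9, h4, and_true, true_and]
        omega
      · have h1 := hu (t + 1)
        have h2 := (hB hm).n_lt
        rw [← hv hm] at h1
        omega
      · rw [add_assoc]
        exact hR.succ (by omega)
      · rw [(hI hm).1, (hI hm).2, hv hm]
        simp only [hc]
        rw [sum_range_succ, add_assoc]
    refine Ok.wp ⟨fun hm => ⟨u (t + 1), (hu _).trans (hB hm).n_lt, key _ fun _ => rfl⟩, fun hm v =>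
      key v fun h => by simp [hm] at h⟩ fun _ => le_rfl
  · have E₄ := E₃.of_agree hs₄ (by simp [Stmt.vars, Stmt.for, yesStep])
      (by simp [Stmt.arrs, Stmt.for, yesStep])
    refine Ok.wp ⟨fun hm => ?_, fun h' => ?_⟩ fun _ => le_rfl
    · have h1 := (hB hm).θ_lt
      have h2 := hcle hm _ le_rfl
      have h3 : c (f 2) ≤ f 3 := huc hm
      have h4 : f 3 < 2 ^ b := by omega
      simp [E₄.r3, (h.2 hm).2, h2, h4, Nat.sub_eq_zero_of_le h3]
    · obtain ⟨w, h1, h2, h3, h4⟩ := h.1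
      refine ⟨_, w, h1, h2, h3, h4.trans ?_⟩
      simpa [E₄.r3, Nat.sub_eq_zero_iff_le] using h'

end Yes

/-! ### Encodings -/

/-- The array `f` stores the instance `x`. -/
structure Stored (x : ViterbiInstance) (f : ℕ → ℕ) : Prop where
  n : f 0 = x.n
  σ : f 1 = x.σ
  T : f 2 = x.T
  θ : f 3 = x.threshold
  A : ∀ i j : Fin x.n, inA f i j = x.A i j
  S : ∀ t : Fin x.T, inS f t = x.S t
  B : ∀ (t : Fin x.T) (j : Fin x.n), inB f t j = x.B j (x.S t)

theorem length_flatten_ofFn {m n : ℕ} (g : Fin m → Fin n → ℕ) :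
    (List.ofFn fun i => List.ofFn fun j => g i j).flatten.length = m * n := by
  simp [List.length_flatten, List.map_ofFn, Function.comp_def, List.sum_ofFn]

theorem getD_ofFn {n : ℕ} (g : Fin n → ℕ) (j : Fin n) : (List.ofFn g).getD j 0 = g j := by
  simp [List.getD_eq_getElem?_getD]

theorem getD_flatten_ofFn {m n : ℕ} (g : Fin m → Fin n → ℕ) (i : Fin m) (j : Fin n) :
    (List.ofFn fun i => List.ofFn fun j => g i j).flatten.getD (i * n + j) 0 = g i j := by
  induction m with
  | zero => exact i.elim0
  | succ m ih =>
    rw [List.ofFn_succ, List.flatten_cons]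
    refine Fin.cases ?_ (fun i => ?_) i
    · rw [List.getD_append _ _ _ _ (by simp)]
      simp
    · rw [List.getD_append_right _ _ _ _ (by simp [add_mul]; omega)]
      rw [← ih (fun i => g i.succ) i]
      congr 1
      simp [add_mul]; omega

section Stored

variable {x : ViterbiInstance} {f : ℕ → ℕ}

theorem ViterbiInstance.length_enc (x : ViterbiInstance) :
    x.enc.length = 4 + x.n * x.n + x.n * x.σ + x.T := by
  unfold ViterbiInstance.enc
  rw [List.length_append, List.length_append, List.length_append, length_flatten_ofFn,
    length_flatten_ofFn, List.length_ofFn]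
  rfl

/-- Only cells inside the encoding matter. The array may contain anything beyond it, as it does when
an oracle query is replaced. -/
theorem Stored.of_enc (h : ∀ k < x.enc.length, f k = x.enc.getD k 0) : Stored x f := by
  rw [x.length_enc] at h
  have hA : ∀ k < x.n * x.n, f (4 + k) =
      (List.ofFn fun i => List.ofFn fun j => x.A i j).flatten.getD k 0 := fun k hk => by
    rw [h _ (by omega), ViterbiInstance.enc, List.append_assoc, List.append_assoc,
      List.getD_append_right _ _ _ _ (by simp), List.getD_append _ _ _ _ (by
        rw [length_flatten_ofFn]; simpa using hk)]
    simp
  have hB : ∀ k < x.n * x.σ, f (4 + x.n * x.n + k) =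
      (List.ofFn fun i => List.ofFn fun a => x.B i a).flatten.getD k 0 := fun k hk => by
    have hl : ([x.n, x.σ, x.T, x.threshold] ++
        (List.ofFn fun i => List.ofFn fun j => x.A i j).flatten).length = 4 + x.n * x.n := by
      rw [List.length_append, length_flatten_ofFn]; rfl
    rw [h _ (by omega), ViterbiInstance.enc, List.append_assoc _ _ (List.ofFn _),
      List.getD_append_right _ _ _ _ (by rw [hl]; omega), List.getD_append _ _ _ _ (by
        rw [length_flatten_ofFn, hl]; omega), hl]
    congr 1; omega
  have hS : ∀ t : Fin x.T, f (4 + x.n * x.n + x.n * x.σ + t) = x.S t := fun t => by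
    have hl : ([x.n, x.σ, x.T, x.threshold] ++
        (List.ofFn fun i => List.ofFn fun j => x.A i j).flatten ++
        (List.ofFn fun i => List.ofFn fun a => x.B i a).flatten).length =
        4 + x.n * x.n + x.n * x.σ := by
      rw [List.length_append, List.length_append, length_flatten_ofFn, length_flatten_ofFn]; rfl
    rw [h _ (by omega), ViterbiInstance.enc,
      List.getD_append_right _ _ _ _ (by rw [hl]; omega), hl, ← getD_ofFn (fun t => (x.S t : ℕ)) t]
    congr 1; omega
  have n0 : f 0 = x.n := h 0 (by omega)
  have n1 : f 1 = x.σ := h 1 (by omega)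
  have aux : ∀ {a b : ℕ} (i : Fin a) (j : Fin b), (i : ℕ) * b + j < a * b := fun i j =>
    lt_mul_of_lt i.2 j.2
  have hS' : ∀ t : Fin x.T, inS f t = x.S t := fun t => by
    unfold inS; rw [n0, n1]; exact hS t
  refine ⟨n0, n1, h 2 (by omega), h 3 (by omega), fun i j => ?_, hS', fun t j => ?_⟩
  · unfold inA
    rw [n0, add_assoc, hA _ (aux i j), getD_flatten_ofFn]
  · unfold inB
    rw [n0, n1, hS', add_assoc _ ((j : ℕ) * x.σ), hB _ (aux j (x.S t)), getD_flatten_ofFn]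

theorem Stored.cost (h : Stored x f) (u : Fin (x.T + 1) → Fin x.n) (w : ℕ → ℕ)
    (hw : ∀ t : Fin (x.T + 1), w t = u t) :
    ∑ s ∈ range (f 2), (inA f (w s) (w (s + 1)) + inB f s (w (s + 1))) = x.cost u := by
  rw [h.T, Finset.sum_range]
  refine sum_congr rfl fun t _ => ?_
  have h1 := hw t.castSucc
  have h2 := hw t.succ
  rw [Fin.val_castSucc] at h1
  rw [Fin.val_succ] at h2
  rw [h1, h2, h.A, h.B]

theorem Stored.yes_iff (h : Stored x f) : Yes f ↔ x.IsYes := by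
  constructor
  · rintro ⟨j, w, h0, -, hw, hc⟩
    refine ⟨fun t => ⟨w t, h.n ▸ hw t⟩, Fin.ext h0, ?_⟩
    rw [← h.cost _ w fun _ => rfl, ← h.θ]
    exact hc
  · rintro ⟨u, h0, hc⟩
    refine ⟨_, fun t => if ht : t < x.T + 1 then u ⟨t, ht⟩ else 0, ?_, rfl, fun t => ?_, ?_⟩
    · simp only [Nat.zero_lt_succ, dite_true]
      exact congrArg Fin.val h0
    · dsimp only
      split_ifs
      · rw [h.n]; exact Fin.is_lt _
      · rw [h.n]; exact x.n_pos
    · rw [h.cost u _ fun t => by rw [dif_pos t.2], h.θ]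
      exact hc

theorem Stored.inBounded (h : Stored x f) {b : ℕ} (hσ : x.σ < 2 ^ b) (hθ : x.threshold + 1 < 2 ^ b)
    (hoS : 4 + x.n * x.n + x.n * x.σ < 2 ^ b) (hT : (x.T + 1) * x.n < 2 ^ b)
    (hA : ∀ i j, x.A i j < 2 ^ b) (hB : ∀ i a, x.B i a < 2 ^ b) : InBounded f b := by
  have hn := x.n_pos
  have h1 : x.T + 1 ≤ (x.T + 1) * x.n := Nat.le_mul_of_pos_right _ hn
  have h2 : x.n ≤ (x.T + 1) * x.n := Nat.le_mul_of_pos_left _ (by omega)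
  refine ⟨by rw [h.n]; omega, by rwa [h.σ], by rw [h.T]; omega, by rwa [h.θ], by rwa [h.n, h.σ],
    by rwa [h.n, h.T], fun i hi j hj => ?_, fun t ht j hj => ?_, fun t ht => ?_⟩
  · rw [h.n] at hi hj
    rw [h.A ⟨i, hi⟩ ⟨j, hj⟩]; exact hA _ _
  · rw [h.n] at hj
    rw [h.T] at ht
    rw [h.B ⟨t, ht⟩ ⟨j, hj⟩]; exact hB _ _
  · rw [h.T] at ht
    rw [h.S ⟨t, ht⟩]; exact (Fin.is_lt _).trans hσ

end Stored

/-! ### The choice of the modulus -/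

/-- A weak Chebyshev bound with N = `2 ^ e`: the least common multiple of the numbers up to N is at
least 2^N / (N + 1), and it is at most N to the number of primes up to N, since each prime
contributes a power not exceeding N. -/
theorem two_pow_le_mul_card_primesLE {e : ℕ} (he : 0 < e) :
    2 ^ e ≤ (2 * e + 1) * #(Nat.primesLE (2 ^ e)) := by
  set P := Nat.primesLE (2 ^ e) with hP
  have hcard : 0 < #P := card_pos.2 ⟨2, Nat.mem_primesLE.2 ⟨by
    calc 2 = 2 ^ 1 := rfl
      _ ≤ 2 ^ e := Nat.pow_le_pow_right (by norm_num) he, Nat.prime_two⟩⟩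
  have h1 := Chebyshev.two_pow_le_mul_lcmUpto (2 ^ e)
  have h2 : Nat.lcmUpto (2 ^ e) ≤ (2 ^ e) ^ #P := by
    rw [Nat.lcmUpto_eq_prod_pow_log]
    exact prod_le_pow_card _ _ _ fun p _ => Nat.pow_log_le_self p (by positivity)
  have h3 : 2 ^ e + 1 ≤ 2 ^ (e + 1) := by
    have : 0 < 2 ^ e := by positivity
    rw [pow_succ]; omega
  have h4 : 2 ^ 2 ^ e ≤ 2 ^ (e + 1 + e * #P) := by
    rw [pow_add, pow_mul]
    exact h1.trans (Nat.mul_le_mul h3 h2)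
  have h5 := (Nat.pow_le_pow_iff_right (by norm_num)).1 h4
  nlinarith

/-- The product of the primes in question divides `D` and is at least two to their number. -/
theorem card_primes_dvd_le {P : Finset ℕ} (hP : ∀ p ∈ P, p.Prime) {D k : ℕ} (hD : 0 < D)
    (hk : D < 2 ^ k) : #{p ∈ P | p ∣ D} ≤ k := by
  have h1 : ∏ p ∈ P with p ∣ D, p ∣ D := Finset.prod_primes_dvd _
    (fun p hp => (hP p (mem_filter.1 hp).1).prime) fun p hp => (mem_filter.1 hp).2
  have h2 : 2 ^ #{p ∈ P | p ∣ D} ≤ ∏ p ∈ P with p ∣ D, p :=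
    pow_card_le_prod _ _ _ fun p hp => (hP p (mem_filter.1 hp).1).two_le
  have h3 := (h2.trans (Nat.le_of_dvd hD h1)).trans_lt hk
  exact ((Nat.pow_lt_pow_iff_right (by norm_num)).1 h3).le

theorem cdiv_le_self {x h : ℕ} (hh : 0 < h) : cdiv x h ≤ x := by
  unfold cdiv
  refine Nat.le_of_lt_succ (Nat.div_lt_of_lt_mul ?_)
  obtain ⟨r, rfl⟩ : ∃ r, h = r + 1 := ⟨h - 1, by omega⟩
  have : (r + 1) * x.succ = x + r + 1 + r * x := by simp only [Nat.succ_eq_add_one]; ring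
  rw [this, Nat.add_sub_cancel]
  omega

/-- Because the inequality holds and `v` is at least one, the defect of the equation is a positive
number with at most `b + 2` bits, and any prime for which the triple is a false positive divides it.
-/
theorem card_res_le {f : ℕ → ℕ} {d b : ℕ} (hn : 0 < f 0) (hB : InBounded f b)
    (hb : 1 ≤ b) {P : Finset ℕ} (hP : ∀ p ∈ P, p.Prime) (g w : ℕ) :
    #{p ∈ P | (blockOf f (optTable f) (optLeft f) (f 0) (f 2) d p g).Res w} ≤ b + 2 := by
  set K := blockOf f (optTable f) (optLeft f) (f 0) (f 2) d 0 g with hK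
  set x := K.x (K.ci w) (K.cj w) with hx
  set y := K.y (K.ct w) (K.ci w) with hy
  set z := K.z (K.cj w) (K.ct w) with hz
  have hh : 0 < K.h := by simp [hK, blockOf]
  have hv : K.v ≤ 3 ∧ 1 ≤ K.v := by
    change _ % 3 + 1 ≤ 3 ∧ 1 ≤ _ % 3 + 1
    omega
  have hgood : z ≤ x + y := optLeft_le (clamp_lt hn _) (clamp_lt hn _)
  have hzd : z / K.h ≤ cdiv x K.h + cdiv y K.h := div_le_cdiv_add_cdiv hh hgood
  have hxb : x < 2 ^ b := hB.A_lt _ (clamp_lt hn _) _ (clamp_lt hn _)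
  have hyb : y < 2 ^ b := (optTable_le _).trans_lt hB.θ_lt
  have h2 : 2 ≤ 2 ^ b := by
    calc 2 = 2 ^ 1 := rfl
      _ ≤ 2 ^ b := Nat.pow_le_pow_right (by norm_num) hb
  refine le_trans (card_le_card fun p hp => ?_) (card_primes_dvd_le (P := P) hP
    (D := cdiv x K.h + cdiv y K.h + K.v - z / K.h) (k := b + 2) (by omega) ?_)
  · rw [mem_filter] at hp ⊢
    exact ⟨hp.1, dvd_of_residue (hP p hp.1).pos hzd hp.2⟩
  · have := cdiv_le_self (x := x) hh
    have := cdiv_le_self (x := y) hh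
    rw [pow_add]
    generalize z / K.h = q at *
    omega

/-- Some modulus leads to few false positives. -/
theorem exists_modulus {f : ℕ → ℕ} {b e : ℕ} (hn : 0 < f 0) (hB : InBounded f b)
    (hb : 1 ≤ b) (he : 0 < e) (d L : ℕ) : ∃ p, 0 < p ∧ p ≤ 2 ^ e ∧
      optCount f d p L * 2 ^ e ≤ (2 * e + 1) * (numBlocks (f 0) (f 2) d L * 8 ^ d * (b + 2)) := by
  set P := Nat.primesLE (2 ^ e) with hP
  have hPp : ∀ p ∈ P, p.Prime := fun p hp => Nat.prime_of_mem_primesLE hp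
  have hcard := two_pow_le_mul_card_primesLE he
  have hne : P.Nonempty := by
    rw [← card_pos]
    by_contra h
    have h0 : #P = 0 := by omega
    rw [← hP, h0, mul_zero] at hcard
    have : 0 < 2 ^ e := by positivity
    omega
  set R := numBlocks (f 0) (f 2) d L * 8 ^ d * (b + 2) with hR
  have hsum : ∑ p ∈ P, optCount f d p L ≤ R := by
    unfold optCount Block.count
    simp only [Nat.count_eq_card_filter_range, card_filter]
    -- Double counting: for a fixed block and triple, the primes that produce a false positive are
    -- counted.
    rw [sum_comm]
    have : ∀ g ∈ range (numBlocks (f 0) (f 2) d L), ∑ p ∈ P, ∑ w ∈ range (8 ^ d),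
        (if (blockOf f (optTable f) (optLeft f) (f 0) (f 2) d p g).Res w then 1 else 0) ≤
        8 ^ d * (b + 2) := fun g _ => by
      rw [sum_comm]
      refine (sum_le_card_nsmul _ _ (b + 2) fun w _ => ?_).trans (by simp)
      rw [← card_filter]
      exact card_res_le hn hB hb hPp g w
    refine (sum_le_card_nsmul _ _ _ this).trans ?_
    rw [card_range, smul_eq_mul, hR, mul_assoc]
  obtain ⟨p, hp, hle⟩ := exists_le_of_sum_le (s := P) (f := fun p => optCount f d p L * #P)
    (g := fun _ => R) hne (by
      rw [← sum_mul, sum_const, smul_eq_mul, mul_comm]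
      exact Nat.mul_le_mul_left _ hsum)
  refine ⟨p, (hPp p hp).pos, (Nat.mem_primesLE.1 hp).1, ?_⟩
  calc _ ≤ optCount f d p L * ((2 * e + 1) * #P) := Nat.mul_le_mul_left _ hcard
    _ = (2 * e + 1) * (optCount f d p L * #P) := by ring
    _ ≤ _ := Nat.mul_le_mul_left _ hle

/-! ### The cost of the verifiers -/

/-- The source of the saving and of the number 20: replacing 8 by 7 gains a factor 8 for every 20
levels of the recursion. -/
theorem seven_pow_mul_le (d : ℕ) : 7 ^ d * 8 ^ (d / 20) ≤ 8 ^ d := by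
  have h1 : 7 ^ 20 * 8 ≤ 8 ^ 20 := by norm_num
  calc 7 ^ d * 8 ^ (d / 20) = 7 ^ (20 * (d / 20) + d % 20) * 8 ^ (d / 20) := by rw [Nat.div_add_mod]
    _ = (7 ^ 20 * 8) ^ (d / 20) * 7 ^ (d % 20) := by rw [pow_add, pow_mul, mul_pow]; ring
    _ ≤ (8 ^ 20) ^ (d / 20) * 8 ^ (d % 20) :=
      Nat.mul_le_mul (Nat.pow_le_pow_left h1 _) (Nat.pow_le_pow_left (by norm_num) _)
    _ = 8 ^ d := by rw [← pow_mul, ← pow_add, Nat.div_add_mod]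

theorem four_pow_eq (a : ℕ) : 4 ^ a = 2 ^ a * 2 ^ a := by
  rw [← mul_pow]; norm_num

theorem eight_pow_eq (a : ℕ) : 8 ^ a = 2 ^ a * 2 ^ a * 2 ^ a := by
  rw [← mul_pow, ← mul_pow]; norm_num

theorem div_succ_mul_le {n s : ℕ} (h : s ≤ n) : (n / s + 1) * s ≤ 2 * n := by
  have := Nat.div_mul_le_self n s
  rw [add_mul]; omega

section Cost

variable {n T w k ℓ d L b B p : ℕ}

/-- When the side of the cubes exceeds no dimension, covering at most doubles each of the three;
together with three offsets per level this gives 24. -/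
theorem numBlocks_mul_le (hsn : 2 ^ d ≤ n) (hsT : 2 ^ d ≤ T) :
    numBlocks n T d L * 8 ^ d ≤ 24 * L * (n ^ 2 * T) := by
  have h1 := div_succ_mul_le hsn
  have h2 := div_succ_mul_le hsT
  calc numBlocks n T d L * 8 ^ d = L * 3 * ((n / 2 ^ d + 1) * 2 ^ d) * ((n / 2 ^ d + 1) * 2 ^ d) *
        ((T / 2 ^ d + 1) * 2 ^ d) := by rw [eight_pow_eq, numBlocks]; ring
    _ ≤ L * 3 * (2 * n) * (2 * n) * (2 * T) := by gcongr
    _ = _ := by ring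

theorem four_pow_le (hsn : 2 ^ d ≤ n) : 4 ^ (d / 20) ≤ n := by
  calc 4 ^ (d / 20) = 2 ^ (2 * (d / 20)) := by rw [pow_mul]; norm_num
    _ ≤ 2 ^ d := Nat.pow_le_pow_right (by norm_num) (by omega)
    _ ≤ n := hsn

/-- Three costs, each compared with n²T after multiplication by Q = 2^(d/20). Counting involves
numbers of about Q bits, so it needs 7^d · Q² ≤ 8^d. Guessing and tabulation take about nT steps,
charged at Q bits, and Q² ≤ n. Listing takes about n²T / Q steps by the choice of the modulus, on
short numbers. -/
theorem no_cost_le (hℓ : 1 ≤ ℓ) (hk : 1 ≤ k) (hd : d ≤ ℓ) (hsn : 2 ^ d ≤ n) (hsT : 2 ^ d ≤ T)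
    (hL : L = w * ℓ + 2) (hb : b = k * ℓ) (hB : B = b + 128 + p * (3 * d + 2))
    (hp : p ≤ 2 ^ (d / 20 + 1)) {O : ℕ} (hO : O * 2 ^ (d / 20 + 1) ≤
      (2 * (d / 20 + 1) + 1) * (numBlocks n T d L * 8 ^ d * (b + 2))) :
    (((numBlocks n T d L + 1) * ((d + 1) * (7 ^ d + 1)) + L + (T + 1) * n + p + 100) * (B + 1) +
      O * (b + 1)) * 2 ^ (d / 20) ≤ 1000 * (k + 140) ^ 2 * (w + 110) * ℓ ^ 4 * (n ^ 2 * T) := by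
  have h78 := seven_pow_mul_le d
  have h4q := four_pow_le hsn
  have hG := numBlocks_mul_le (L := L) hsn hsT
  have hqd : d / 20 ≤ d := Nat.div_le_self _ _
  have hs : 0 < 2 ^ d := by positivity
  have h8 : 8 ^ d ≤ n ^ 2 * T := by
    calc 8 ^ d = 2 ^ d * 2 ^ d * 2 ^ d := eight_pow_eq d
      _ ≤ n * n * T := by gcongr
      _ = _ := by ring
  have hLw : L ≤ (w + 2) * ℓ := by rw [hL, add_mul]; omega
  have hL1 : 1 ≤ L := by omega
  generalize hq : d / 20 = q at *
  generalize numBlocks n T d L = G at *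
  set Q := 2 ^ q with hQ
  have hQ1 : 1 ≤ Q := Nat.one_le_two_pow
  have hQ4 : 4 ^ q = Q * Q := four_pow_eq q
  have hQ8 : 8 ^ q = Q * Q * Q := eight_pow_eq q
  have hp' : p ≤ 2 * Q := by rw [pow_succ] at hp; omega
  set k₁ := k + 140 with hk₁
  have hB1 : B + 1 ≤ k₁ * ℓ * (2 * Q) := by
    have h1 : p * (3 * d + 2) ≤ 2 * Q * (5 * ℓ) := Nat.mul_le_mul hp' (by omega)
    have h2 : k * ℓ + 129 ≤ (k + 129) * ℓ * (2 * Q) := by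
      calc k * ℓ + 129 ≤ (k + 129) * ℓ * 1 := by rw [mul_one, add_mul]; omega
        _ ≤ _ := Nat.mul_le_mul_left _ (by omega)
    calc B + 1 = k * ℓ + 129 + p * (3 * d + 2) := by rw [hB, hb]; ring
      _ ≤ (k + 129) * ℓ * (2 * Q) + 2 * Q * (5 * ℓ) := by omega
      _ = (k + 134) * ℓ * (2 * Q) := by ring
      _ ≤ _ := by gcongr; omega
  have hn1 : 1 ≤ n := by omega
  have hT1 : 1 ≤ T := by omega
  have t1 : (G + 1) * ((d + 1) * (7 ^ d + 1)) * (B + 1) * Q ≤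
      200 * k₁ * (w + 2) * ℓ ^ 3 * (n ^ 2 * T) := by
    have a1 : 7 ^ d * (Q * Q) ≤ 8 ^ d := by
      refine le_trans ?_ h78
      rw [hQ8]
      exact Nat.mul_le_mul_left _ (Nat.le_mul_of_pos_right _ hQ1)
    have a2 : (G + 1) * 8 ^ d ≤ 25 * L * (n ^ 2 * T) := by
      have : 8 ^ d ≤ L * (n ^ 2 * T) := h8.trans (Nat.le_mul_of_pos_left _ hL1)
      calc (G + 1) * 8 ^ d = G * 8 ^ d + 8 ^ d := by ring
        _ ≤ 24 * L * (n ^ 2 * T) + L * (n ^ 2 * T) := Nat.add_le_add hG this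
        _ = _ := by ring
    have a3 : 7 ^ d + 1 ≤ 2 * 7 ^ d := by
      have : 0 < 7 ^ d := by positivity
      omega
    calc (G + 1) * ((d + 1) * (7 ^ d + 1)) * (B + 1) * Q
        ≤ (G + 1) * ((2 * ℓ) * (2 * 7 ^ d)) * (k₁ * ℓ * (2 * Q)) * Q := by gcongr; omega
      _ = 8 * k₁ * ℓ ^ 2 * ((G + 1) * (7 ^ d * (Q * Q))) := by ring
      _ ≤ 8 * k₁ * ℓ ^ 2 * (25 * ((w + 2) * ℓ) * (n ^ 2 * T)) := by
        refine Nat.mul_le_mul_left _ ((Nat.mul_le_mul_left _ a1).trans (a2.trans ?_))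
        gcongr
      _ = _ := by ring
  have t2 : (L + (T + 1) * n + p + 100) * (B + 1) * Q ≤
      2 * k₁ * (w + 110) * ℓ ^ 2 * (n ^ 2 * T) := by
    have hQn : Q ≤ n := by
      rw [hQ4] at h4q
      exact (Nat.le_mul_of_pos_right _ hQ1).trans h4q
    have hnT : n ≤ n * T := Nat.le_mul_of_pos_right _ hT1
    have hℓn : ℓ ≤ ℓ * (n * T) := Nat.le_mul_of_pos_right _ (by positivity)
    have hnℓ : n * T ≤ ℓ * (n * T) := Nat.le_mul_of_pos_left _ hℓ
    have a1 : L + (T + 1) * n + p + 100 ≤ (w + 110) * (ℓ * (n * T)) := by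
      have : (w + 2) * ℓ ≤ (w + 2) * (ℓ * (n * T)) := Nat.mul_le_mul_left _ hℓn
      have e : (w + 110) * (ℓ * (n * T)) = (w + 2) * (ℓ * (n * T)) + 108 * (ℓ * (n * T)) := by ring
      have e2 : (T + 1) * n = n * T + n := by ring
      rw [e, e2]
      omega
    calc (L + (T + 1) * n + p + 100) * (B + 1) * Q
        ≤ (w + 110) * (ℓ * (n * T)) * (k₁ * ℓ * (2 * Q)) * Q := by gcongr
      _ = 2 * k₁ * (w + 110) * ℓ ^ 2 * (n * T * (Q * Q)) := by ring
      _ ≤ 2 * k₁ * (w + 110) * ℓ ^ 2 * (n * T * n) := by rw [← hQ4]; gcongr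
      _ = _ := by ring
  have t3 : O * (b + 1) * Q ≤ 720 * k ^ 2 * (w + 2) * ℓ ^ 4 * (n ^ 2 * T) := by
    have a0 : O * Q ≤ O * 2 ^ (q + 1) := Nat.mul_le_mul_left _ (Nat.pow_le_pow_right (by norm_num)
      (by omega))
    have hb1 : 1 ≤ b := by rw [hb]; exact Nat.mul_pos hk hℓ
    have hG' : G * 8 ^ d ≤ 24 * ((w + 2) * ℓ) * (n ^ 2 * T) := hG.trans (by gcongr)
    generalize G * 8 ^ d = H at hG' hO
    calc O * (b + 1) * Q = O * Q * (b + 1) := by ring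
      _ ≤ (2 * (q + 1) + 1) * (H * (b + 2)) * (b + 1) := Nat.mul_le_mul_right _ (a0.trans hO)
      _ ≤ (5 * ℓ) * (24 * ((w + 2) * ℓ) * (n ^ 2 * T) * (3 * b)) * (2 * b) := by
        gcongr
        · omega
        · omega
        · omega
      _ = _ := by rw [hb]; ring
  have u1 : 200 * k₁ * (w + 2) * ℓ ^ 3 ≤ 200 * k₁ ^ 2 * (w + 110) * ℓ ^ 4 := by
    gcongr <;> first | omega | (exact Nat.le_self_pow (by norm_num) _)
  have u2 : 2 * k₁ * (w + 110) * ℓ ^ 2 ≤ 2 * k₁ ^ 2 * (w + 110) * ℓ ^ 4 := by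
    gcongr <;> first | omega | (exact Nat.le_self_pow (by norm_num) _)
  have u3 : 720 * k ^ 2 * (w + 2) * ℓ ^ 4 ≤ 720 * k₁ ^ 2 * (w + 110) * ℓ ^ 4 := by
    gcongr <;> omega
  calc _ = (G + 1) * ((d + 1) * (7 ^ d + 1)) * (B + 1) * Q +
        (L + (T + 1) * n + p + 100) * (B + 1) * Q + O * (b + 1) * Q := by ring
    _ ≤ 200 * k₁ ^ 2 * (w + 110) * ℓ ^ 4 * (n ^ 2 * T) + 2 * k₁ ^ 2 * (w + 110) * ℓ ^ 4 * (n ^ 2 * T) +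
        720 * k₁ ^ 2 * (w + 110) * ℓ ^ 4 * (n ^ 2 * T) :=
      Nat.add_le_add (Nat.add_le_add (t1.trans (Nat.mul_le_mul_right _ u1))
        (t2.trans (Nat.mul_le_mul_right _ u2))) (t3.trans (Nat.mul_le_mul_right _ u3))
    _ = 922 * k₁ ^ 2 * (w + 110) * ℓ ^ 4 * (n ^ 2 * T) := by ring
    _ ≤ _ := by gcongr; norm_num

theorem yes_cost_le (hℓ : 1 ≤ ℓ) (hk : 1 ≤ k) (hT : 1 ≤ T) (hsn : 2 ^ d ≤ n) (hb : b = k * ℓ) :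
    (T + 1) * (b + 1) * 2 ^ (d / 20) ≤ 4 * k * ℓ ^ 4 * (n ^ 2 * T) := by
  have h1 : 2 ^ (d / 20) ≤ n ^ 2 := by
    have h2 := four_pow_le hsn
    have h3 : 2 ^ (d / 20) ≤ 4 ^ (d / 20) := Nat.pow_le_pow_left (by norm_num) _
    exact h3.trans (h2.trans (Nat.le_self_pow (by norm_num) _))
  have hb1 : 1 ≤ b := by rw [hb]; exact Nat.mul_pos hk hℓ
  have h4 : ℓ ≤ ℓ ^ 4 := Nat.le_self_pow (by norm_num) _
  calc (T + 1) * (b + 1) * 2 ^ (d / 20) ≤ (2 * T) * (2 * b) * n ^ 2 := by gcongr <;> omega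
    _ = 4 * k * ℓ * (n ^ 2 * T) := by rw [hb]; ring
    _ ≤ _ := by gcongr

end Cost

/-- Translation of the savings into a power of the input size. -/
theorem le_rpow_of_mul_le {c C : ℝ} (hc : 0 < c) (hcC : c ≤ C) (K₀ : ℕ) :
    ∃ K : ℝ, 0 ≤ K ∧ ∀ n T cost : ℕ, 1 ≤ n → (n : ℝ) ^ c ≤ T → (T : ℝ) ≤ (n : ℝ) ^ C →
      cost * 2 ^ (Nat.log 2 (min n T) / 20) ≤ K₀ * (Nat.log 2 n + 1) ^ 4 * (n ^ 2 * T) →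
      (cost : ℝ) ≤ K * ((T : ℝ) * (n : ℝ) ^ 2) ^ (1 - min c 1 / (40 * (C + 2))) := by
  set γ := min c 1 with hγ
  have hγ0 : 0 < γ := lt_min hc one_pos
  have hC2 : 0 < C + 2 := by linarith
  set α := γ / (40 * (C + 2)) with hα
  -- With this exponent the fourth power of the logarithm is at most a constant times n^(γ/40).
  set η := γ / 160 with hη
  have hη0 : 0 < η := by positivity
  set A := 1 + 1 / (η * Real.log 2) with hA
  have hlog2 : 0 < Real.log 2 := Real.log_pos (by norm_num)
  have hA0 : 0 < A := by positivity
  refine ⟨4 * K₀ * A ^ 4, by positivity, fun n T cost hn h1 h2 h3 => ?_⟩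
  have hn1 : (1 : ℝ) ≤ n := by exact_mod_cast hn
  have hn0 : (0 : ℝ) < n := by linarith
  have hT1 : (1 : ℝ) ≤ T := (Real.one_le_rpow hn1 hc.le).trans h1
  have hTn : 1 ≤ T := by exact_mod_cast hT1
  set d := Nat.log 2 (min n T) with hd
  set ℓ := Nat.log 2 n + 1 with hℓ
  have hℓb : (ℓ : ℝ) ≤ A * (n : ℝ) ^ η := by
    have e1 : (Nat.log 2 n : ℝ) ≤ Real.log n / Real.log 2 := by
      have := Real.natLog_le_logb n 2
      simpa [Real.logb] using this
    have e2 := Real.log_le_rpow_div hn0.le hη0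
    have e3 := Real.one_le_rpow hn1 hη0.le
    have e4 : Real.log n / Real.log 2 ≤ 1 / (η * Real.log 2) * (n : ℝ) ^ η := by
      rw [div_le_iff₀ hlog2]
      calc Real.log n ≤ (n : ℝ) ^ η / η := e2
        _ = _ := by field_simp
    rw [hℓ, hA]
    push_cast
    linarith
  -- Both dimensions are at least n^γ, which is why the saving depends on `min c 1`; the factor 4
  -- covers the rounding in `d` and in `d / 20`.
  have hQ : (n : ℝ) ^ (γ / 20) ≤ 4 * 2 ^ (d / 20) := by
    have hmin : (n : ℝ) ^ γ ≤ ((min n T : ℕ) : ℝ) := by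
      push_cast
      refine le_min ?_ ?_
      · calc (n : ℝ) ^ γ ≤ (n : ℝ) ^ (1 : ℝ) := Real.rpow_le_rpow_of_exponent_le hn1 (min_le_right _ _)
          _ = n := Real.rpow_one _
      · exact (Real.rpow_le_rpow_of_exponent_le hn1 (min_le_left _ _)).trans h1
    have hlt : ((min n T : ℕ) : ℝ) ≤ 2 ^ (d + 1) := by
      exact_mod_cast (Nat.lt_pow_succ_log_self (by norm_num) (min n T)).le
    have e1 : (n : ℝ) ^ (γ / 20) ≤ ((2 : ℝ) ^ (d + 1)) ^ ((1 : ℝ) / 20) := by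
      rw [show γ / 20 = γ * (1 / 20) by ring, Real.rpow_mul hn0.le]
      exact Real.rpow_le_rpow (by positivity) (hmin.trans hlt) (by norm_num)
    refine e1.trans ?_
    rw [← Real.rpow_natCast 2 (d + 1), ← Real.rpow_mul (by norm_num),
      show (4 : ℝ) * 2 ^ (d / 20) = 2 ^ (d / 20 + 2) by ring, ← Real.rpow_natCast 2 (d / 20 + 2)]
    refine Real.rpow_le_rpow_of_exponent_le (by norm_num) ?_
    have e2 : d + 1 ≤ 20 * (d / 20 + 2) := by omega
    have e3 : ((d + 1 : ℕ) : ℝ) ≤ 20 * ((d / 20 + 2 : ℕ) : ℝ) := by exact_mod_cast e2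
    linarith
  set t := (T : ℝ) * (n : ℝ) ^ 2 with ht
  have ht0 : 0 < t := by positivity
  have hta : t ^ α ≤ (n : ℝ) ^ (γ / 40) := by
    have e1 : t ≤ (n : ℝ) ^ (C + 2) := by
      rw [ht, Real.rpow_add hn0, Real.rpow_two]
      gcongr
    calc t ^ α ≤ ((n : ℝ) ^ (C + 2)) ^ α := Real.rpow_le_rpow ht0.le e1 (by positivity)
      _ = (n : ℝ) ^ (γ / 40) := by
        rw [← Real.rpow_mul hn0.le]
        congr 1
        rw [hα]; field_simp
  have h3' : (cost : ℝ) * 2 ^ (d / 20) ≤ K₀ * (ℓ : ℝ) ^ 4 * t := by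
    have : ((cost * 2 ^ (d / 20) : ℕ) : ℝ) ≤ ((K₀ * ℓ ^ 4 * (n ^ 2 * T) : ℕ) : ℝ) := by
      exact_mod_cast h3
    push_cast at this
    rw [ht, mul_comm (T : ℝ)]
    exact this
  -- The gain n^(γ/20) is spent in two halves: one pays for the logarithms, the other for t^α, which
  -- is at most n^(γ/40) by `hta`.
  have h4 : (cost : ℝ) * (n : ℝ) ^ (γ / 20) ≤ 4 * K₀ * A ^ 4 * (n : ℝ) ^ (γ / 40) * t := by
    calc (cost : ℝ) * (n : ℝ) ^ (γ / 20) ≤ cost * (4 * 2 ^ (d / 20)) := by gcongr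
      _ = 4 * (cost * 2 ^ (d / 20)) := by ring
      _ ≤ 4 * (K₀ * (A * (n : ℝ) ^ η) ^ 4 * t) := by
        refine mul_le_mul_of_nonneg_left (h3'.trans ?_) (by norm_num)
        gcongr
      _ = _ := by
        have : ((n : ℝ) ^ η) ^ 4 = (n : ℝ) ^ (γ / 40) := by
          rw [← Real.rpow_natCast, ← Real.rpow_mul hn0.le]
          congr 1
          rw [hη]; push_cast; ring
        rw [mul_pow, this]; ring
  have h5 : (n : ℝ) ^ (γ / 20) = (n : ℝ) ^ (γ / 40) * (n : ℝ) ^ (γ / 40) := by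
    rw [← Real.rpow_add hn0]; congr 1; ring
  have hpos : 0 < (n : ℝ) ^ (γ / 40) := by positivity
  have h6 : (cost : ℝ) * (n : ℝ) ^ (γ / 40) ≤ 4 * K₀ * A ^ 4 * t := by
    rw [h5] at h4
    refine le_of_mul_le_mul_right ?_ hpos
    calc _ = (cost : ℝ) * ((n : ℝ) ^ (γ / 40) * (n : ℝ) ^ (γ / 40)) := by ring
      _ ≤ _ := h4
      _ = _ := by ring
  rw [Real.rpow_sub ht0, Real.rpow_one, ← mul_div_assoc, le_div_iff₀ (by positivity)]
  exact (mul_le_mul_of_nonneg_left hta (by positivity)).trans h6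

/-! ### Verifiers for instances in the given range -/

theorem numBlocks_le {n T d L : ℕ} (hn : 0 < n) (hT : 0 < T) :
    numBlocks n T d L ≤ 24 * L * (n * n * T) := by
  have h : ∀ a, 0 < a → a / 2 ^ d + 1 ≤ 2 * a := fun a ha => by
    have := Nat.div_le_self a (2 ^ d)
    omega
  calc numBlocks n T d L ≤ L * 3 * (2 * n) * (2 * n) * (2 * T) := by
        unfold numBlocks
        exact Nat.mul_le_mul (Nat.mul_le_mul (Nat.mul_le_mul le_rfl (h n hn)) (h n hn)) (h T hT)
    _ = _ := by ring

section Range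

variable {x : ViterbiInstance} {f : ℕ → ℕ} {w r ℓ : ℕ}

/-- The number of bits of the numbers that occur. -/
theorem Stored.inBounded_of_le (h : Stored x f) (hT : 0 < x.T) (hℓ : 1 ≤ ℓ) (hn : x.n ≤ 2 ^ ℓ)
    (hTn : x.T ≤ 2 ^ (r * ℓ)) (hσ : x.σ ≤ 2 ^ (w * ℓ)) (hA : ∀ i j, x.A i j ≤ 2 ^ (w * ℓ))
    (hB : ∀ i a, x.B i a ≤ 2 ^ (w * ℓ)) (hθ : x.threshold ≤ 2 ^ (w * ℓ)) :
    f 3 + 1 < 2 ^ (w * ℓ + 2) ∧ InBounded f ((w + r + 20) * ℓ) := by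
  have e : (w + r + 20) * ℓ = w * ℓ + r * ℓ + 20 * ℓ := by ring
  have up : ∀ {u v : ℕ}, u ≤ v → 2 ^ u ≤ 2 ^ v := fun h => Nat.pow_le_pow_right (by norm_num) h
  have lt : ∀ {a u : ℕ}, a ≤ 2 ^ u → u < (w + r + 20) * ℓ → a < 2 ^ ((w + r + 20) * ℓ) :=
    fun h1 h2 => h1.trans_lt (Nat.pow_lt_pow_right (by norm_num) h2)
  have hθ' : x.threshold + 1 ≤ 2 ^ (w * ℓ + 1) := by
    have : 0 < 2 ^ (w * ℓ) := by positivity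
    rw [pow_succ]; omega
  refine ⟨?_, h.inBounded (lt hσ (by omega)) (lt hθ' (by omega)) (lt (u := w * ℓ + 2 * ℓ + 2) ?_
    (by omega)) (lt (u := r * ℓ + ℓ + 1) ?_ (by omega)) (fun i j => lt (hA i j) (by omega))
    fun i a => lt (hB i a) (by omega)⟩
  · rw [h.θ]
    exact hθ'.trans_lt (Nat.pow_lt_pow_right (by norm_num) (by omega))
  · have h1 : x.n * x.n ≤ 2 ^ (w * ℓ + 2 * ℓ) := by
      calc x.n * x.n ≤ 2 ^ ℓ * 2 ^ ℓ := Nat.mul_le_mul hn hn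
        _ = 2 ^ (ℓ + ℓ) := (pow_add _ _ _).symm
        _ ≤ _ := up (by omega)
    have h2 : x.n * x.σ ≤ 2 ^ (w * ℓ + 2 * ℓ) := by
      calc x.n * x.σ ≤ 2 ^ ℓ * 2 ^ (w * ℓ) := Nat.mul_le_mul hn hσ
        _ = 2 ^ (ℓ + w * ℓ) := (pow_add _ _ _).symm
        _ ≤ _ := up (by omega)
    have h3 : 2 ^ 2 ≤ 2 ^ (w * ℓ + 2 * ℓ) := up (by omega)
    rw [pow_add _ _ 2]
    omega
  · calc (x.T + 1) * x.n ≤ (2 * 2 ^ (r * ℓ)) * 2 ^ ℓ := Nat.mul_le_mul (by omega) hn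
      _ = _ := by rw [pow_succ, pow_add]; ring

/-- In the larger bit length, 128 makes room for the encoded Strassen coefficients and `p * (3 * d +
2)` for the powers of `X`, as `3 * 8 ^ d ≤ 2 ^ (3 * d + 2)`. -/
theorem params_of_le (h : Stored x f) (hT : 0 < x.T) (hℓ : 1 ≤ ℓ) (hn : x.n ≤ 2 ^ ℓ)
    (hTn : x.T ≤ 2 ^ (r * ℓ)) (hσ : x.σ ≤ 2 ^ (w * ℓ)) (hA : ∀ i j, x.A i j ≤ 2 ^ (w * ℓ))
    (hB : ∀ i a, x.B i a ≤ 2 ^ (w * ℓ)) (hθ : x.threshold ≤ 2 ^ (w * ℓ)) {d p : ℕ} (hd : d ≤ ℓ)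
    (hp : p ≤ 2 ^ (d / 20 + 1)) :
    Params f d p (w * ℓ + 2) ((w + r + 20) * ℓ) ((w + r + 20) * ℓ + 128 + p * (3 * d + 2)) := by
  have e : (w + r + 20) * ℓ = w * ℓ + r * ℓ + 20 * ℓ := by ring
  have up : ∀ {u v : ℕ}, u ≤ v → 2 ^ u ≤ 2 ^ v := fun h => Nat.pow_le_pow_right (by norm_num) h
  have lt : ∀ {a u : ℕ}, a ≤ 2 ^ u → u < (w + r + 20) * ℓ → a < 2 ^ ((w + r + 20) * ℓ) :=
    fun h1 h2 => h1.trans_lt (Nat.pow_lt_pow_right (by norm_num) h2)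
  obtain ⟨h1, h2⟩ := h.inBounded_of_le hT hℓ hn hTn hσ hA hB hθ
  refine ⟨by omega, by omega, by omega, by omega, by omega, ?_, lt hp (by omega), ?_, ?_, h1, h2⟩
  · rw [h.n, h.T]
    refine lt (u := 5 + (w * ℓ + 2) + (ℓ + ℓ + r * ℓ)) ?_ (by omega)
    refine (numBlocks_le x.n_pos hT).trans ?_
    have h3 : w * ℓ + 2 ≤ 2 ^ (w * ℓ + 2) := Nat.lt_two_pow_self.le
    calc 24 * (w * ℓ + 2) * (x.n * x.n * x.T) ≤ 2 ^ 5 * 2 ^ (w * ℓ + 2) *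
          (2 ^ ℓ * 2 ^ ℓ * 2 ^ (r * ℓ)) := by gcongr; norm_num
      _ = _ := by rw [← pow_add, ← pow_add, ← pow_add, ← pow_add]
  · refine lt (u := 3 * d) ?_ (by omega)
    rw [pow_mul]; norm_num
  · have h3 : 3 * 8 ^ d ≤ 2 ^ (3 * d + 2) := by
      rw [pow_add, pow_mul]; norm_num; omega
    calc (3 * 8 ^ d) ^ p ≤ (2 ^ (3 * d + 2)) ^ p := Nat.pow_le_pow_left h3 p
      _ = 2 ^ (p * (3 * d + 2)) := by rw [← pow_mul, mul_comm]
      _ < _ := Nat.pow_lt_pow_right (by norm_num) (by omega)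

end Range

theorem ViterbiInstance.InRange.T_pos {c C : ℝ} {w : ℕ} {x : ViterbiInstance}
    (h : x.InRange c C w) : 0 < x.T := by
  have h1 : (0 : ℝ) < (x.n : ℝ) ^ c := Real.rpow_pos_of_pos (by exact_mod_cast x.n_pos) _
  exact_mod_cast h1.trans_le h.T_lower

/-- The exponent saved by the verifiers. -/
noncomputable def saving (c C : ℝ) : ℝ := min c 1 / (40 * (C + 2))

/-- The memory is arbitrary apart from array `0`. This allows the verifiers to run both on the
initial state and in the middle of a simulated reduction, without any clean-up. -/
theorem exists_verifiers {c C : ℝ} (hc : 0 < c) (hcC : c ≤ C) (w : ℕ) :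
    ∃ K : ℝ, 0 ≤ K ∧ ∀ x : (viterbi c C w).Inst, ∀ s : State, Stored x.1 (s.mem 0) →
      (x.1.IsYes → ∃ τ : ℕ, Tr true yesProg s (fun _ => True) τ ∧
        (τ : ℝ) ≤ K * viterbiTime (saving c C) x) ∧
      (¬ x.1.IsYes → ∃ τ : ℕ, Tr true noProg s (fun _ => True) τ ∧
        (τ : ℝ) ≤ K * viterbiTime (saving c C) x) := by
  set r := ⌈C⌉₊ with hr
  set k := w + r + 20 with hk
  obtain ⟨K, hK0, hK⟩ := le_rpow_of_mul_le hc hcC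
    (yesProg.wt * (4 * k) + noWeight * (1000 * (k + 140) ^ 2 * (w + 110)))
  refine ⟨K, hK0, fun x s hS => ?_⟩
  obtain ⟨x, hx⟩ := x
  change Stored x (s.mem 0) at hS
  have hn := x.n_pos
  have hT := hx.T_pos
  set f := s.mem 0 with hf
  set ℓ := Nat.log 2 x.n + 1 with hℓ
  -- The largest cubes that fit into both dimensions.
  set d := Nat.log 2 (min x.n x.T) with hd
  have hnℓ : x.n ≤ 2 ^ ℓ := (Nat.lt_pow_succ_log_self (by norm_num) x.n).le
  have hpow : ∀ a, x.n ^ a ≤ 2 ^ (a * ℓ) := fun a => by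
    rw [mul_comm, pow_mul]
    exact Nat.pow_le_pow_left hnℓ a
  have hTr : x.T ≤ 2 ^ (r * ℓ) := by
    refine le_trans ?_ (hpow r)
    have h1 : (x.T : ℝ) ≤ (x.n : ℝ) ^ (r : ℝ) := hx.T_upper.trans
      (Real.rpow_le_rpow_of_exponent_le (by exact_mod_cast hn) (Nat.le_ceil C))
    rw [Real.rpow_natCast] at h1
    exact_mod_cast h1
  have hdℓ : d ≤ ℓ := (Nat.log_mono_right (min_le_left _ _)).trans (Nat.le_succ _)
  have hdm : 2 ^ d ≤ min x.n x.T := Nat.pow_log_le_self 2 (by omega)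
  have hdn : 2 ^ d ≤ x.n := hdm.trans (min_le_left _ _)
  have hdT : 2 ^ d ≤ x.T := hdm.trans (min_le_right _ _)
  have f0 : 0 < f 0 := by rw [hS.n]; exact hn
  have f2 : 0 < f 2 := by rw [hS.T]; exact hT
  have inb := (hS.inBounded_of_le hT (ℓ := ℓ) (by omega) hnℓ hTr (hx.σ_le.trans (hpow w))
    (fun i j => (hx.A_le i j).trans (hpow w)) (fun i j => (hx.B_le i j).trans (hpow w))
    (hx.threshold_le.trans (hpow w))).2
  have fin : ∀ τ : ℕ, τ * 2 ^ (d / 20) ≤ (yesProg.wt * (4 * k) +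
      noWeight * (1000 * (k + 140) ^ 2 * (w + 110))) * ℓ ^ 4 * (x.n ^ 2 * x.T) →
      (τ : ℝ) ≤ K * viterbiTime (saving c C) ⟨x, hx⟩ := fun τ hτ =>
    hK x.n x.T τ hn hx.T_lower hx.T_upper hτ
  refine ⟨fun hyes => ⟨_, (yesProg_ok rfl f0 (fun _ => inb) fun _ => hS.yes_iff.2 hyes).mono
    (fun _ _ _ => trivial) fun _ => le_rfl, fin _ ?_⟩, fun hno => ?_⟩
  · have := yes_cost_le (k := k) (ℓ := ℓ) (T := x.T) (by omega) (by omega) hT hdn rfl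
    rw [← hf, hS.T, mul_assoc]
    refine (Nat.mul_le_mul_left _ this).trans ?_
    rw [show yesProg.wt * (4 * k * ℓ ^ 4 * (x.n ^ 2 * x.T)) =
      yesProg.wt * (4 * k) * ℓ ^ 4 * (x.n ^ 2 * x.T) by ring]
    exact Nat.mul_le_mul_right _ (Nat.mul_le_mul_right _ (Nat.le_add_right _ _))
  · obtain ⟨p, hp0, hp, hO⟩ := exists_modulus (e := d / 20 + 1) f0 inb (by nlinarith) (by omega) d
      (w * ℓ + 2)
    have P := params_of_le hS hT (ℓ := ℓ) (by omega) hnℓ hTr (hx.σ_le.trans (hpow w))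
      (fun i j => (hx.A_le i j).trans (hpow w)) (fun i j => (hx.B_le i j).trans (hpow w))
      (hx.threshold_le.trans (hpow w)) hdℓ hp
    refine ⟨_, (noProg_tr rfl f0 f2 hp0 (fun _ => P) fun _ h => hno (hS.yes_iff.1 h)).mono
      (fun _ _ _ => trivial) fun _ => le_rfl, fin _ ?_⟩
    rw [← hf, hS.n, hS.T] at *
    have := no_cost_le (w := w) (k := k) (ℓ := ℓ) (by omega) (by omega) hdℓ hdn hdT rfl rfl rfl hp hO
    rw [mul_assoc]
    refine (Nat.mul_le_mul_left _ this).trans ?_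
    rw [show noWeight * (1000 * (k + 140) ^ 2 * (w + 110) * ℓ ^ 4 * (x.n ^ 2 * x.T)) =
      noWeight * (1000 * (k + 140) ^ 2 * (w + 110)) * ℓ ^ 4 * (x.n ^ 2 * x.T) by ring]
    exact Nat.mul_le_mul_right _ (Nat.mul_le_mul_right _ (Nat.le_add_left _ _))

theorem yesProg_sound {x : ViterbiInstance} {s : State} (hS : Stored x (s.mem 0)) :
    Tr false yesProg s (fun _ => x.IsYes) 0 :=
  Tr.mono (yesProg_ok (m := false) (b := 0) rfl (by rw [hS.n]; exact x.n_pos) (fun h => by simp at h)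
    fun h => by simp at h) (fun _ _ h => hS.yes_iff.1 h) fun h => by simp at h

/-- All numeric parameters are dummies here, since they matter only for completeness and cost. -/
theorem noProg_sound {x : ViterbiInstance} {s : State} (hS : Stored x (s.mem 0)) (hT : 0 < x.T) :
    Tr false noProg s (fun _ => ¬ x.IsYes) 0 :=
  Tr.mono (noProg_tr (m := false) (d := 0) (p := 1) (L := 0) (b := 0) (B := 0) rfl (by rw [hS.n]; exact x.n_pos)
    (by rw [hS.T]; exact hT) one_pos (fun h => by simp at h)
    fun h => by simp at h) (fun _ _ h h' => h (hS.yes_iff.2 h')) fun h => by simp at h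

/-! ### Replacing oracle calls by verifiers -/

/-- All registers and arrays of the program have names below `β`. -/
def Cmd.Below (β : ℕ) : Cmd → Prop
  | .const r _ => r < β
  | .arith _ r a b => r < β ∧ a < β ∧ b < β
  | .load r m a => r < β ∧ m < β ∧ a < β
  | .store m a r => m < β ∧ a < β ∧ r < β
  | .guess r => r < β
  | .query m l r => m < β ∧ l < β ∧ r < β
  | .seq p q => p.Below β ∧ q.Below β
  | .cond r p q => r < β ∧ p.Below β ∧ q.Below β
  | .loop r p => r < β ∧ p.Below β

theorem Cmd.Below.mono {β β' : ℕ} (h : β ≤ β') {p : Cmd} (hp : p.Below β) : p.Below β' := by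
  induction p with
  | const r k => exact lt_of_lt_of_le hp h
  | guess r => exact lt_of_lt_of_le hp h
  | arith _ r a b => exact ⟨hp.1.trans_le h, hp.2.1.trans_le h, hp.2.2.trans_le h⟩
  | load r m a => exact ⟨hp.1.trans_le h, hp.2.1.trans_le h, hp.2.2.trans_le h⟩
  | store m a r => exact ⟨hp.1.trans_le h, hp.2.1.trans_le h, hp.2.2.trans_le h⟩
  | query m l r => exact ⟨hp.1.trans_le h, hp.2.1.trans_le h, hp.2.2.trans_le h⟩
  | seq p q ihp ihq => exact ⟨ihp hp.1, ihq hp.2⟩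
  | cond r p q ihp ihq => exact ⟨hp.1.trans_le h, ihp hp.2.1, ihq hp.2.2⟩
  | loop r p ih => exact ⟨hp.1.trans_le h, ih hp.2⟩

theorem Cmd.exists_below (p : Cmd) : ∃ β, p.Below β := by
  induction p with
  | const r k => exact ⟨r + 1, Nat.lt_succ_self r⟩
  | guess r => exact ⟨r + 1, Nat.lt_succ_self r⟩
  | arith _ r a b => exact ⟨r + a + b + 1, by simp only [Below]; omega⟩
  | load r a b => exact ⟨r + a + b + 1, by simp only [Below]; omega⟩
  | store r a b => exact ⟨r + a + b + 1, by simp only [Below]; omega⟩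
  | query r a b => exact ⟨r + a + b + 1, by simp only [Below]; omega⟩
  | seq p q ihp ihq =>
    obtain ⟨β, h⟩ := ihp
    obtain ⟨β', h'⟩ := ihq
    exact ⟨β + β', h.mono (by omega), h'.mono (by omega)⟩
  | cond r p q ihp ihq =>
    obtain ⟨β, h⟩ := ihp
    obtain ⟨β', h'⟩ := ihq
    exact ⟨r + β + β' + 1, by omega, h.mono (by omega), h'.mono (by omega)⟩
  | loop r p ih =>
    obtain ⟨β, h⟩ := ih
    exact ⟨r + β + 1, by omega, h.mono (by omega)⟩

/-- Replace every query by a guess of the answer and its verification. -/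
def Cmd.sim (β : ℕ) : Cmd → Cmd
  | .query m _ r => .seq (.guess r) (.cond r (.seq (yesProg.comp β m) (.const r 1))
      (.seq (noProg.comp β m) (.const r 0)))
  | .seq p q => .seq (p.sim β) (q.sim β)
  | .cond r p q => .cond r (p.sim β) (q.sim β)
  | .loop r p => .loop r (p.sim β)
  | p => p

theorem Cmd.sim_queryFree (β : ℕ) (p : Cmd) : (p.sim β).QueryFree := by
  induction p <;> simp_all [sim, QueryFree, Stmt.comp_queryFree]

/-- The states agree on the registers and arrays below `β`. -/
def AgreeBelow (β : ℕ) (s s' : State) : Prop :=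
  (∀ r < β, s'.reg r = s.reg r) ∧ ∀ m < β, s'.mem m = s.mem m

section AgreeBelow

variable {β : ℕ} {s s' s'' : State}

theorem AgreeBelow.refl (β : ℕ) (s : State) : AgreeBelow β s s :=
  ⟨fun _ _ => rfl, fun _ _ => rfl⟩

theorem AgreeBelow.trans (h : AgreeBelow β s s') (h' : AgreeBelow β s' s'') : AgreeBelow β s s'' :=
  ⟨fun r hr => (h'.1 r hr).trans (h.1 r hr), fun r hr => (h'.2 r hr).trans (h.2 r hr)⟩

theorem AgreeBelow.setReg (h : AgreeBelow β s s') (r v : ℕ) :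
    AgreeBelow β (s.setReg r v) (s'.setReg r v) := by
  refine ⟨fun x hx => ?_, h.2⟩
  simp only [State.setReg_reg]
  split_ifs
  · rfl
  · exact h.1 x hx

theorem AgreeBelow.setMem (h : AgreeBelow β s s') (m i v : ℕ) :
    AgreeBelow β (s.setMem m i v) (s'.setMem m i v) := by
  refine ⟨h.1, fun x hx => funext fun j => ?_⟩
  simp only [State.setMem_mem]
  split_ifs
  · rfl
  · rw [h.2 x hx]

theorem setReg_setReg (s : State) (r v v' : ℕ) : (s.setReg r v).setReg r v' = s.setReg r v' := by
  simp [State.setReg]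

theorem AgreeBelow.of_setReg {r v : ℕ} (h : AgreeBelow β (s.setReg r v) s') (v' : ℕ) :
    AgreeBelow β (s.setReg r v') (s'.setReg r v') := by
  rw [← setReg_setReg s r v v']
  exact h.setReg r v'

/-- A program placed at `β` does not change what lies below. -/
theorem agreeBelow_of_exec {μ : ℕ} {S : Stmt} (h0 : 0 ∉ S.arrs) {τ : ℕ} {qs : List (List ℕ)}
    (h : Exec ∅ (S.comp β μ) s τ qs s') : AgreeBelow β s s' := by
  have hw : (S.comp β μ).WritesIn (fun r => β ≤ r) (fun m => β ≤ m) := by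
    refine S.comp_writesIn β μ (fun t => by omega) (fun x _ => by omega) fun k hk => ?_
    have : k ≠ 0 := fun h => h0 (h ▸ hk)
    unfold Expr.arrOf
    rw [if_neg this]
    omega
  obtain ⟨h1, h2⟩ := h.frame hw
  exact ⟨fun r hr => h1 r (by omega), fun m hm => h2 m (by omega)⟩

end AgreeBelow

/-- Array `0` of a verifier is the queried array of the surrounding program, used in place and
without copying. It must be read only. -/
theorem zero_notMem_yesProg_arrs : 0 ∉ yesProg.arrs := by
  simp [Stmt.arrs, Stmt.for, yesProg, yesStep, headProg]

theorem zero_notMem_noProg_arrs : 0 ∉ noProg.arrs := by decide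

theorem Exec.one_le_cost {O : Set (List ℕ)} {p : Cmd} {s s' : State} {τ : ℕ} {qs : List (List ℕ)}
    (h : Exec O p s τ qs s') : 1 ≤ τ := by
  induction h <;> omega

theorem Stored.of_block {x : ViterbiInstance} {s : State} {m l : ℕ} (h : x.enc = s.block m l) :
    Stored x (s.mem m) := by
  refine Stored.of_enc fun k hk => ?_
  rw [h, State.block] at hk ⊢
  simp at hk
  simp [List.getD_eq_getElem?_getD, hk]

section Sim

variable {c C : ℝ} {w : ℕ} {β : ℕ}

/-- The oracle sees encodings only. Two instances with the same encoding are stored in the same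
array, which determines the answer. -/
theorem mem_oracle_iff {y : (viterbi c C w).Inst} {s : State} {m l : ℕ}
    (h : (viterbi c C w).enc y = s.block m l) :
    s.block m l ∈ (viterbi c C w).oracle ↔ y.1.IsYes := by
  constructor
  · rintro ⟨y', hy', he⟩
    exact (Stored.of_block h).yes_iff.1 ((Stored.of_block he).yes_iff.2 hy')
  · exact fun hy => ⟨y, hy, h⟩

theorem view_mem_zero {s σ : State} {m : ℕ} (hag : AgreeBelow β s σ) (hm : m < β) (r v : ℕ) :
    ((σ.setReg r v).view β m).mem 0 = s.mem m := hag.2 m hm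

/-- With every answer guessed correctly the simulation follows the original run. Each query is paid
for by the time bound of the queried instance, so the total is governed by the sum in the definition
of the reduction; the factor 6 covers the guess, the branch and the final assignment. -/
theorem Cmd.sim_exec {K α : ℝ} (hK : ∀ y : (viterbi c C w).Inst, ∀ s : State,
      Stored y.1 (s.mem 0) →
      (y.1.IsYes → ∃ τ : ℕ, Tr true yesProg s (fun _ => True) τ ∧ (τ : ℝ) ≤ K * viterbiTime α y) ∧
      (¬ y.1.IsYes → ∃ τ : ℕ, Tr true noProg s (fun _ => True) τ ∧ (τ : ℝ) ≤ K * viterbiTime α y))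
    {p : Cmd} {s s' : State} {τ : ℕ} {qs : List (List ℕ)}
    (h : Exec (viterbi c C w).oracle p s τ qs s') (hp : p.Below β) (hg : p.GuessFree) :
    ∀ ys : List (viterbi c C w).Inst, qs = ys.map (viterbi c C w).enc → ∀ σ, AgreeBelow β s σ →
      ∃ (τ' : ℕ) (σ' : State), Exec ∅ (p.sim β) σ τ' [] σ' ∧ AgreeBelow β s' σ' ∧
        (τ' : ℝ) ≤ 6 * τ + K * (ys.map (viterbiTime α)).sum := by
  have triv : ∀ {τ : ℕ} (ys : List (viterbi c C w).Inst), [] = ys.map (viterbi c C w).enc →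
      (τ : ℝ) ≤ 6 * τ + K * (ys.map (viterbiTime α)).sum := fun {τ} ys hys => by
    rw [List.map_eq_nil_iff.1 hys.symm]
    have : (0 : ℝ) ≤ τ := Nat.cast_nonneg τ
    simp; linarith
  have qcase : ∀ (m l r : ℕ) (s σ : State) (ys : List (viterbi c C w).Inst) (v : ℕ)
      (S : Stmt), (Cmd.query m l r).Below β → AgreeBelow β s σ →
      [s.block m (s.reg l)] = ys.map (viterbi c C w).enc → v ≤ 1 → 0 ∉ S.arrs →
      (∀ y : (viterbi c C w).Inst, (viterbi c C w).enc y = s.block m (s.reg l) →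
        ∃ τ : ℕ, Tr true S ((σ.setReg r v).view β m) (fun _ => True) τ ∧
          (τ : ℝ) ≤ K * viterbiTime α y) →
      ∃ (τ' : ℕ) (σ' : State), Exec ∅ (.seq (S.comp β m) (.const r v)) (σ.setReg r v) τ' [] σ' ∧
        AgreeBelow β (s.setReg r v) σ' ∧ (τ' : ℝ) ≤ 2 + K * (ys.map (viterbiTime α)).sum := by
    intro m l r s σ ys v S hp hag hys hv h0 hS
    obtain ⟨y, rfl, hy⟩ : ∃ y, ys = [y] ∧ (viterbi c C w).enc y = s.block m (s.reg l) :=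
      List.map_eq_singleton_iff.1 hys.symm
    obtain ⟨τ, hT, hτ⟩ := hS y hy
    obtain ⟨τ', σ', he, -, hle⟩ := (hT β m hp.1 _ rfl).1 rfl
    have hag' := (hag.setReg r v).trans (agreeBelow_of_exec h0 he)
    refine ⟨_, _, Exec.seq he (Exec.const r v σ'), hag'.of_setReg v, ?_⟩
    have h1 : v.size ≤ 1 := Nat.size_le.2 (by omega)
    have h2 : ((τ' + (1 + v.size) : ℕ) : ℝ) ≤ τ + 2 := by
      exact_mod_cast (by omega : τ' + (1 + v.size) ≤ τ + 2)
    simp only [List.map_cons, List.map_nil, List.sum_cons, List.sum_nil, add_zero]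
    linarith
  have qcost : ∀ (τ τ₀ : ℕ) (R : ℝ), (τ : ℝ) ≤ 2 + R → 1 ≤ τ₀ → ∀ a ≤ 1,
      ((1 + a + (1 + a + τ) : ℕ) : ℝ) ≤ 6 * τ₀ + R := fun τ τ₀ R h1 h2 a ha => by
    have e1 : (1 : ℝ) ≤ τ₀ := by exact_mod_cast h2
    have e2 : (a : ℝ) ≤ 1 := by exact_mod_cast ha
    push_cast
    linarith
  induction h with
  | const r k s => exact fun ys hys σ hag => ⟨_, _, Exec.const r k σ, hag.setReg r k, triv ys hys⟩
  | arith op r a b s =>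
    intro ys hys σ hag
    have := Exec.arith (O := ∅) op r a b σ
    rw [hag.1 a hp.2.1, hag.1 b hp.2.2] at this
    exact ⟨_, _, this, hag.setReg _ _, triv ys hys⟩
  | load r m a s =>
    intro ys hys σ hag
    have := Exec.load (O := ∅) r m a σ
    rw [hag.1 a hp.2.2, hag.2 m hp.2.1] at this
    exact ⟨_, _, this, hag.setReg _ _, triv ys hys⟩
  | store m a r s =>
    intro ys hys σ hag
    have := Exec.store (O := ∅) m a r σ
    rw [hag.1 a hp.2.1, hag.1 r hp.2.2] at this
    exact ⟨_, _, this, hag.setMem _ _ _, triv ys hys⟩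
  | guess r v s => exact hg.elim
  | queryYes m l r s h =>
    intro ys hys σ hag
    obtain ⟨τ', σ', he, hag', hle⟩ := qcase m l r s σ ys 1 yesProg hp hag hys le_rfl
      zero_notMem_yesProg_arrs fun y hy => (hK y _ (by
        rw [view_mem_zero hag hp.1]; exact Stored.of_block hy)).1 ((mem_oracle_iff hy).1 h)
    refine ⟨_, σ', Exec.seq (Exec.guess r 1 σ) (Exec.condTrue (by simp [State.setReg_reg]) he),
      hag', ?_⟩
    simp only [State.setReg_reg, if_true]
    exact qcost _ _ _ hle (by omega) _ (by decide)
  | queryNo m l r s h =>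
    intro ys hys σ hag
    obtain ⟨τ', σ', he, hag', hle⟩ := qcase m l r s σ ys 0 noProg hp hag hys (by norm_num)
      zero_notMem_noProg_arrs fun y hy => (hK y _ (by
        rw [view_mem_zero hag hp.1]; exact Stored.of_block hy)).2 fun hyes =>
          h ((mem_oracle_iff hy).2 hyes)
    refine ⟨_, σ', Exec.seq (Exec.guess r 0 σ) (Exec.condFalse (by simp [State.setReg_reg]) he),
      hag', ?_⟩
    simp only [State.setReg_reg, if_true]
    exact qcost _ _ _ hle (by omega) _ (by decide)
  | seq _ _ ih1 ih2 =>
    intro ys hys σ hag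
    obtain ⟨y1, y2, rfl, e1, e2⟩ := List.map_eq_append_iff.1 hys.symm
    obtain ⟨τ1, σ1, x1, a1, c1⟩ := ih1 hp.1 hg.1 y1 e1.symm σ hag
    obtain ⟨τ2, σ2, x2, a2, c2⟩ := ih2 hp.2 hg.2 y2 e2.symm σ1 a1
    refine ⟨_, _, Exec.seq x1 x2, a2, ?_⟩
    rw [List.map_append, List.sum_append]
    push_cast
    linarith
  | @condTrue r _ _ s _ _ _ h _ ih =>
    intro ys hys σ hag
    obtain ⟨τ1, σ1, x1, a1, c1⟩ := ih hp.2.1 hg.1 ys hys σ hag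
    have e := hag.1 _ hp.1
    refine ⟨_, _, Exec.condTrue (by rwa [e]) x1, a1, ?_⟩
    rw [e]
    push_cast
    linarith [Nat.cast_nonneg (α := ℝ) (s.reg r).size]
  | @condFalse r _ _ s _ _ _ h _ ih =>
    intro ys hys σ hag
    obtain ⟨τ1, σ1, x1, a1, c1⟩ := ih hp.2.2 hg.2 ys hys σ hag
    have e := hag.1 _ hp.1
    refine ⟨_, _, Exec.condFalse (by rwa [e]) x1, a1, ?_⟩
    rw [e]
    push_cast
    linarith [Nat.cast_nonneg (α := ℝ) (s.reg r).size]
  | loopDone h =>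
    intro ys hys σ hag
    have e := hag.1 _ hp.1
    refine ⟨_, _, Exec.loopDone (by rwa [e]), hag, ?_⟩
    rw [e]
    exact triv ys hys
  | @loopStep r _ s _ _ _ _ _ _ h _ _ ih1 ih2 =>
    intro ys hys σ hag
    obtain ⟨y1, y2, rfl, e1, e2⟩ := List.map_eq_append_iff.1 hys.symm
    obtain ⟨τ1, σ1, x1, a1, c1⟩ := ih1 hp.2 hg y1 e1.symm σ hag
    obtain ⟨τ2, σ2, x2, a2, c2⟩ := ih2 hp hg y2 e2.symm σ1 a1
    have e := hag.1 _ hp.1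
    refine ⟨_, _, Exec.loopStep (by rwa [e]) x1 x2, a2, ?_⟩
    rw [List.map_append, List.sum_append, e]
    push_cast
    linarith [Nat.cast_nonneg (α := ℝ) (s.reg r).size]

/-- A wrong guess never survives, since the verifier of a wrong answer cannot halt. So every halting
run of the simulation ends like the deterministic run, whatever was guessed. -/
theorem Cmd.sim_sound {p : Cmd} {s s' : State} {τ : ℕ} {qs : List (List ℕ)}
    (h : Exec (viterbi c C w).oracle p s τ qs s') (hp : p.Below β) (hg : p.GuessFree) :
    ∀ ys : List (viterbi c C w).Inst, qs = ys.map (viterbi c C w).enc → ∀ σ, AgreeBelow β s σ →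
      ∀ (τ' : ℕ) (qs' : List (List ℕ)) (σ' : State), Exec ∅ (p.sim β) σ τ' qs' σ' →
        AgreeBelow β s' σ' := by
  have qcase : ∀ (m l r : ℕ) (s σ : State) (ys : List (viterbi c C w).Inst),
      (Cmd.query m l r).Below β → AgreeBelow β s σ →
      [s.block m (s.reg l)] = ys.map (viterbi c C w).enc →
      ∀ (τ' : ℕ) (qs' : List (List ℕ)) (σ' : State), Exec ∅ ((Cmd.query m l r).sim β) σ τ' qs' σ' →
        (s.block m (s.reg l) ∈ (viterbi c C w).oracle ∧ AgreeBelow β (s.setReg r 1) σ') ∨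
        (s.block m (s.reg l) ∉ (viterbi c C w).oracle ∧ AgreeBelow β (s.setReg r 0) σ') := by
    intro m l r s σ ys hp hag hys τ' qs' σ' he
    obtain ⟨y, -, hy⟩ := List.map_eq_singleton_iff.1 hys.symm
    have hS : ∀ v, Stored y.1 (((σ.setReg r v).view β m).mem 0) := fun v => by
      rw [view_mem_zero hag hp.1]; exact Stored.of_block hy
    rw [mem_oracle_iff hy]
    cases he with
    | seq a b =>
      cases a with
      | guess _ v _ =>
        cases b with
        | condTrue h1 b =>
          cases b with
          | seq b1 b2 =>
            cases b2
            have h2 := (yesProg_sound (hS v) β m hp.1 _ rfl).2 rfl _ _ _ b1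
            exact Or.inl ⟨h2, ((hag.setReg r v).trans
              (agreeBelow_of_exec zero_notMem_yesProg_arrs b1)).of_setReg 1⟩
        | condFalse h1 b =>
          cases b with
          | seq b1 b2 =>
            cases b2
            have h2 := (noProg_sound (hS v) y.2.T_pos β m hp.1 _ rfl).2 rfl _ _ _ b1
            exact Or.inr ⟨h2, ((hag.setReg r v).trans
              (agreeBelow_of_exec zero_notMem_noProg_arrs b1)).of_setReg 0⟩
  induction h with
  | const r k s =>
    intro ys hys σ hag τ' qs' σ' he
    cases he
    exact hag.setReg _ _
  | arith op r a b s =>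
    intro ys hys σ hag τ' qs' σ' he
    cases he
    rw [hag.1 a hp.2.1, hag.1 b hp.2.2]
    exact hag.setReg _ _
  | load r m a s =>
    intro ys hys σ hag τ' qs' σ' he
    cases he
    rw [hag.1 a hp.2.2, hag.2 m hp.2.1]
    exact hag.setReg _ _
  | store m a r s =>
    intro ys hys σ hag τ' qs' σ' he
    cases he
    rw [hag.1 a hp.2.1, hag.1 r hp.2.2]
    exact hag.setMem _ _ _
  | guess r v s => exact hg.elim
  | queryYes m l r s h =>
    intro ys hys σ hag τ' qs' σ' he
    rcases qcase m l r s σ ys hp hag hys τ' qs' σ' he with h' | h'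
    · exact h'.2
    · exact absurd h h'.1
  | queryNo m l r s h =>
    intro ys hys σ hag τ' qs' σ' he
    rcases qcase m l r s σ ys hp hag hys τ' qs' σ' he with h' | h'
    · exact absurd h'.1 h
    · exact h'.2
  | seq _ _ ih1 ih2 =>
    intro ys hys σ hag τ' qs' σ' he
    obtain ⟨y1, y2, rfl, e1, e2⟩ := List.map_eq_append_iff.1 hys.symm
    cases he with
    | seq x1 x2 =>
      exact ih2 hp.2 hg.2 y2 e2.symm _ (ih1 hp.1 hg.1 y1 e1.symm σ hag _ _ _ x1) _ _ _ x2
  | condTrue h _ ih =>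
    intro ys hys σ hag τ' qs' σ' he
    have e := hag.1 _ hp.1
    cases he with
    | condTrue h' x => exact ih hp.2.1 hg.1 ys hys σ hag _ _ _ x
    | condFalse h' x => exact absurd (e.symm.trans h') h
  | condFalse h _ ih =>
    intro ys hys σ hag τ' qs' σ' he
    have e := hag.1 _ hp.1
    cases he with
    | condTrue h' x => exact absurd (e.trans h) h'
    | condFalse h' x => exact ih hp.2.2 hg.2 ys hys σ hag _ _ _ x
  | loopDone h =>
    intro ys hys σ hag τ' qs' σ' he
    have e := hag.1 _ hp.1
    cases he with
    | loopDone h' => exact hag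
    | loopStep h' x1 x2 => exact absurd (e.trans h) h'
  | loopStep h _ _ ih1 ih2 =>
    intro ys hys σ hag τ' qs' σ' he
    obtain ⟨y1, y2, rfl, e1, e2⟩ := List.map_eq_append_iff.1 hys.symm
    have e := hag.1 _ hp.1
    cases he with
    | loopDone h' => exact absurd (e.symm.trans h') h
    | loopStep h' x1 x2 =>
      exact ih2 hp hg y2 e2.symm _ (ih1 hp.2 hg y1 e1.symm σ hag _ _ _ x1) _ _ _ x2

end Sim

/-! ### The main results -/

theorem saving_pos {c C : ℝ} (hc : 0 < c) (hcC : c ≤ C) : 0 < saving c C :=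
  div_pos (lt_min hc one_pos) (by linarith)

theorem saving_lt_one {c C : ℝ} (hc : 0 < c) (hcC : c ≤ C) : saving c C < 1 := by
  unfold saving
  rw [div_lt_one (by linarith)]
  exact (min_le_right _ _).trans_lt (by linarith)

theorem stored_init (x : ViterbiInstance) : Stored x (((State.init x.enc).view 1 0).mem 0) :=
  Stored.of_enc fun _ _ => rfl

/-- A verifying statement gives a nondeterministic algorithm. -/
theorem inNTIME_of_verifier {P : Problem} {t : P.Inst → ℝ} {S : Stmt} {K : ℝ}
    (h₁ : ∀ x ∈ P.yes, ∃ τ : ℕ,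
      Tr true S ((State.init (P.enc x)).view 1 0) (fun _ => True) τ ∧ (τ : ℝ) ≤ K * t x)
    (h₂ : ∀ x, Tr false S ((State.init (P.enc x)).view 1 0) (fun _ => x ∈ P.yes) 0) :
    InNTIME P t := by
  -- Halting is acceptance, so the program just sets the answer at the end. Those two extra units
  -- are absorbed by the factor 3, as every run costs at least one.
  refine ⟨.seq (S.comp 1 0) (.const 0 1), ⟨S.comp_queryFree 1 0, trivial⟩, 3 * K, fun x =>
    ⟨fun hx => ?_, fun hx τ qs s he => ?_⟩⟩
  · obtain ⟨τ, hT, hτ⟩ := h₁ x hx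
    obtain ⟨τ', σ', he, -, hle⟩ := (hT 1 0 one_pos _ rfl).1 rfl
    refine ⟨_, _, _, Exec.seq he (Exec.const 0 1 σ'), by simp [State.Accepts, State.setReg_reg], ?_⟩
    have h1 := he.one_le_cost
    have h2 : Nat.size 1 = 1 := by decide
    have h3 : ((τ' + (1 + Nat.size 1) : ℕ) : ℝ) ≤ 3 * τ := by
      rw [h2]
      exact_mod_cast (by omega : τ' + (1 + 1) ≤ 3 * τ)
    linarith
  · cases he with
    | seq a b => exact absurd ((h₂ x 1 0 one_pos _ rfl).2 rfl _ _ _ a) hx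

theorem viterbi_inNTIME_inCoNTIME {c C : ℝ} (hc : 0 < c) (hcC : c ≤ C) (w : ℕ) :
    InNTIME (viterbi c C w) (viterbiTime (saving c C)) ∧
      InCoNTIME (viterbi c C w) (viterbiTime (saving c C)) := by
  obtain ⟨K, -, hK⟩ := exists_verifiers hc hcC w
  exact ⟨inNTIME_of_verifier (S := yesProg) (K := K)
      (fun x hx => (hK x _ (stored_init x.1)).1 hx) fun x => yesProg_sound (stored_init x.1),
    inNTIME_of_verifier (P := (viterbi c C w).compl) (S := noProg) (K := K)
      (fun x hx => (hK x _ (stored_init x.1)).2 hx) fun x => noProg_sound (stored_init x.1) x.2.T_pos⟩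

/-- A problem that reduces to the Viterbi path problem lies in `coNTIME`. -/
theorem inCoNTIME_of_reduces {c C : ℝ} (hc : 0 < c) (hcC : c ≤ C) {w : ℕ} {P : Problem}
    {t : P.Inst → ℝ} (h : FineGrainedReduces P t (viterbi c C w) (viterbiTime (saving c C))) :
    InCoNTIME P t := by
  obtain ⟨K, hK0, hK⟩ := exists_verifiers hc hcC w
  obtain ⟨p, hg, K₁, hp⟩ := h
  obtain ⟨β, hβ⟩ := p.exists_below
  -- The bound is raised so that register 0, which carries the answer, certainly lies below the
  -- working space of the verifiers.
  replace hβ := hβ.mono (Nat.le_succ β)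
  -- The answer is flipped at the end, since the complement is to be accepted; this is legitimate
  -- because all halting runs agree on it.
  refine ⟨.seq (p.sim (β + 1)) (.cond 0 (.const 0 0) (.const 0 1)),
    ⟨p.sim_queryFree _, trivial, trivial⟩, 9 * K₁ + K * K₁, fun x => ?_⟩
  obtain ⟨τ, ys, s, he, hacc, hτ, hsum⟩ := hp x
  refine ⟨fun hx => ?_, fun hx τ' qs σ' hσ' => ?_⟩
  · obtain ⟨τ', σ', he', hag, hle⟩ := Cmd.sim_exec hK he hβ hg ys rfl _ (AgreeBelow.refl _ _)
    have h0 : σ'.reg 0 = 0 := by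
      rw [hag.1 0 (by omega)]
      by_contra h
      exact hx (hacc.1 h)
    refine ⟨_, _, _, Exec.seq he' (Exec.condFalse h0 (Exec.const 0 1 σ')),
      by simp [State.Accepts, State.setReg_reg], ?_⟩
    have h1 : (1 : ℝ) ≤ τ := by exact_mod_cast he.one_le_cost
    have h2 : Nat.size 1 = 1 := by decide
    rw [h0, h2, Nat.size_zero]
    push_cast
    have h3 : K * (ys.map (viterbiTime (saving c C))).sum ≤ K * (K₁ * t x) :=
      mul_le_mul_of_nonneg_left hsum hK0
    change _ ≤ (9 * K₁ + K * K₁) * t x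
    linarith
  · cases hσ' with
    | seq a b =>
      have hag := Cmd.sim_sound he hβ hg ys rfl _ (AgreeBelow.refl _ _) _ _ _ a
      have h0 : s.Accepts := hacc.2 (not_not.1 hx)
      have h1 := hag.1 0 (by omega)
      cases b with
      | condTrue h b => cases b; simp [State.Accepts, State.setReg_reg]
      | condFalse h b => exact absurd (h1.symm.trans h) h0

end ViterbiNTIME

theorem mainTheorem7 (c C : ℝ) (hc : 0 < c) (hcC : c ≤ C) :
    (∃ α : ℝ, 0 < α ∧ α < 1 ∧ ∀ w : ℕ,
      ViterbiNTIME.InNTIME (ViterbiNTIME.viterbi c C w) (ViterbiNTIME.viterbiTime α) ∧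
      ViterbiNTIME.InCoNTIME (ViterbiNTIME.viterbi c C w) (ViterbiNTIME.viterbiTime α)) ∧
    (ViterbiNTIME.NSETH → ¬ ViterbiNTIME.TightSETHLowerBound c C) := by
  refine ⟨⟨_, ViterbiNTIME.saving_pos hc hcC, ViterbiNTIME.saving_lt_one hc hcC, fun w =>
    ViterbiNTIME.viterbi_inNTIME_inCoNTIME hc hcC w⟩, fun hN hT => ?_⟩
  -- The saving does not depend on `w`, so it can serve as ε before `w` is known; and δ is fixed
  -- before `k`, so NSETH may choose `k` for this δ.
  obtain ⟨δ, hδ, h⟩ := hT _ (ViterbiNTIME.saving_pos hc hcC)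
  obtain ⟨k, hk⟩ := hN δ hδ
  obtain ⟨w, hw⟩ := h k
  exact hk (ViterbiNTIME.inCoNTIME_of_reduces hc hcC hw)
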